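/- For $n\ge 1$ let $F_n$ be the free group of rank $n$, let $H=H_1(F_n,\mathbb{Q})\cong\mathbb{Q}^n$ be the standard representation of $\mathrm{GL}(n,\mathbb{Q})$, and let $\mathrm{IO}_n$ be the kernel of the canonical map $\mathrm{Out}(F_n)\to \mathrm{GL}(n,\mathbb{Z})$. For a group $G$, the Albanese homology of $G$ is $$H^A_i(G,\mathbb{Q})=\mathrm{im}\bigl(\pi_*:H_i(G,\mathbb{Q})\to H_i(H_1(G,\mathbb{Z}),\mathbb{Q})\bigr),$$ where $\pi:G\to H_1(G,\mathbb{Z})$ is the abelianization map. Let $U^O=\mathrm{Hom}(H,\bigwedge^2H)/H$, where $H$ is embedded by $h\mapsto (x\mapsto h\wedge x)$. The Johnson homomorphism $\tau^O:H_1(\mathrm{IO}_n,\mathbb{Z})\to U^O$, induced by $[\varphi]\mapsto ([x]\mapsto x^{-1}\varphi(x) \bmod \Gamma_3)$, gives a map $H^A_i(\mathrm{IO}_n,\mathbb{Q})\to H_i(U^O,\mathbb{Q})\cong\bigwedge^i U^O$, and $H^A_i(\mathrm{IO}_n,\mathbb{Q})$ carries the $\mathrm{GL}(n,\mathbb{Q})$-action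 for which this map is equivariant. For a bipartition $(\lambda^+,\lambda^-)$ let $V_{\lambda^+,\lambda^-}=T_{p,q}\otimes_{\mathbb{Q}[\mathfrak{S}_p\times\mathfrak{S}_q]}(S^{\lambda^+}\otimes S^{\lambda^-})$, where $p=|\lambda^+|$, $q=|\lambda^-|$, $T_{p,q}\subset H^{\otimes p}\otimes (H^*)^{\otimes q}$ is the intersection of the kernels of all contractions and $S^{\lambda^\pm}$ are Specht modules. Let $i\ge 2$. (1) For every $n\ge i+2+\frac{1-(-1)^i}{2}$ there is a surjective $\mathrm{GL}(n,\mathbb{Q})$-homomorphism $$H^A_i(\mathrm{IO}_n,\mathbb{Q})\twoheadrightarrow \textstyle\bigwedge^i H\cong V_{1^i,0}.$$ (2) There is an $N$ depending only on $i$ such that for every $n\ge N$ there is a surjective $\mathrm{GL}(n,\mathbb{Q})$-homomorphism $$H^A_i(\mathrm{IO}_n,\mathbb{Q})\twoheadrightarrow \mathrm{Hom}(H,\textstyle\bigwedge^{i+1}H)\cong V_{1^{i+1},1}\oplus V_{1^i,0}.$$ In both cases the composite with $H_i(\mathrm{IO}_n,\mathbb{Q})\twoheadrightarrow H^A_i(\mathrm{IO}_n,\mathbb{Q})$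 is equivariant for the conjugation action of $\mathrm{Out}(F_n)$, which acts on the target through $\mathrm{Out}(F_n)\to\mathrm{GL}(n,\mathbb{Z})\subset\mathrm{GL}(n,\mathbb{Q})$. Consequently $H^A_i(\mathrm{IO}_n,\mathbb{Q})\neq 0$ in these ranges. -/

import Mathlib

noncomputable section

open scoped TensorProduct CategoryTheory

namespace AlbaneseIO

/-! ### Automorphisms and outer automorphisms of the free group -/

/-- The free group `F_n` on `x_1, …, x_n` (indexed by `Fin n`). -/
abbrev F (n : ℕ) : Type := FreeGroup (Fin n)

/-- The abelianization `F_n → ℤⁿ`, `x_j ↦ e_j`. -/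
def ab (n : ℕ) : F n →* Multiplicative (Fin n → ℤ) :=
  FreeGroup.lift fun j => Multiplicative.ofAdd (Pi.single j 1)

/-- The matrix of the action of `φ` on `H_1(F_n, ℤ) = ℤⁿ`: its `j`-th column is the class of
`φ x_j`. -/
def autMatrix (n : ℕ) (φ : MulAut (F n)) : Matrix (Fin n) (Fin n) ℤ :=
  Matrix.of fun k j => (ab n (φ (FreeGroup.of j))).toAdd k

theorem toAdd_ab_apply (n : ℕ) (φ : MulAut (F n)) (x : F n) :
    (ab n (φ x)).toAdd = (autMatrix n φ).mulVec (ab n x).toAdd := by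
  have h : (ab n).comp φ.toMonoidHom =
      (AddMonoidHom.toMultiplicative (autMatrix n φ).mulVecLin.toAddMonoidHom).comp (ab n) := by
    refine FreeGroup.ext_hom _ _ fun j => ?_
    apply Multiplicative.toAdd.injective
    ext k
    simp [ab, autMatrix]
  exact congrArg Multiplicative.toAdd (DFunLike.congr_fun h x)

/-- The canonical homomorphism `Aut(F_n) → GL(n, ℤ)`. -/
def autToGL (n : ℕ) : MulAut (F n) →* GL (Fin n) ℤ :=
  MonoidHom.toHomUnits
    { toFun := autMatrix n
      map_one' := by
        ext k j
        simp [autMatrix, ab, Matrix.one_apply, Pi.single_apply]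
      map_mul' := fun φ ψ => by
        ext k j
        have h := congrFun (toAdd_ab_apply n φ (ψ (FreeGroup.of j))) k
        simpa [autMatrix, Matrix.mul_apply, Matrix.mulVec, dotProduct] using h }

theorem autToGL_eq_one_iff (n : ℕ) (φ : MulAut (F n)) :
    autToGL n φ = 1 ↔ ∀ x, ab n (φ x) = ab n x := by
  have h1 : autToGL n φ = 1 ↔ autMatrix n φ = 1 := by
    rw [Units.ext_iff]; rfl
  rw [h1]
  constructor
  · intro h x
    apply Multiplicative.toAdd.injective
    rw [toAdd_ab_apply, h, Matrix.one_mulVec]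
  · intro h
    ext k j
    rw [autMatrix, Matrix.of_apply, h]
    simp [ab, Matrix.one_apply, Pi.single_apply]

/-- The inner automorphism group `Inn(F_n)`. -/
def inn (n : ℕ) : Subgroup (MulAut (F n)) := MulAut.conj.range

instance inn_normal (n : ℕ) : (inn n).Normal where
  conj_mem := by
    rintro _ ⟨x, rfl⟩ φ
    refine ⟨φ x, ?_⟩
    ext y
    simp [MulAut.conj_apply]

/-- The outer automorphism group `Out(F_n) = Aut(F_n) / Inn(F_n)`. -/
abbrev OutF (n : ℕ) : Type := MulAut (F n) ⧸ inn n

/-- The canonical homomorphism `Out(F_n) → GL(n, ℤ)`. -/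
def outToGL (n : ℕ) : OutF n →* GL (Fin n) ℤ :=
  QuotientGroup.lift (inn n) (autToGL n) (by
    rintro _ ⟨x, rfl⟩
    rw [MonoidHom.mem_ker, autToGL_eq_one_iff]
    intro y
    simp [MulAut.conj_apply])

/-- `IO_n`, the kernel of `Out(F_n) → GL(n, ℤ)`. -/
abbrev IOut (n : ℕ) : Subgroup (OutF n) := (outToGL n).ker

/-! ### Representations of `GL(n, ℚ)` -/

/-- `H = H_1(F_n, ℚ) = ℚⁿ` with its basis `e_1, …, e_n`. -/
abbrev H (n : ℕ) : Type := Fin n → ℚ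

/-- The standard representation of `GL(n, ℚ)` on `H`. -/
def stdRep (n : ℕ) : Representation ℚ (GL (Fin n) ℚ) (H n) where
  toFun g := Matrix.toLin' g.1
  map_one' := by simp; rfl
  map_mul' g h := by simp [Matrix.toLin'_mul]; rfl

/-- The exterior power `⋀^i V` of a representation `V`. -/
def extRep {G V : Type*} [Group G] [AddCommGroup V] [Module ℚ V] (i : ℕ)
    (ρ : Representation ℚ G V) : Representation ℚ G (⋀[ℚ]^i V) where
  toFun g := exteriorPower.map i (ρ g)
  map_one' := by rw [map_one]; exact exteriorPower.map_id
  map_mul' g h := by rw [map_mul]; exact exteriorPower.map_comp _ _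

/-- The representation of `GL(n, ℚ)` on `⋀^i H`. -/
def extHRep (n i : ℕ) : Representation ℚ (GL (Fin n) ℚ) (⋀[ℚ]^i (H n)) :=
  extRep i (stdRep n)

/-- The representation of `GL(n, ℚ)` on `Hom(H, ⋀^i H)`. -/
def homExtHRep (n i : ℕ) : Representation ℚ (GL (Fin n) ℚ) (H n →ₗ[ℚ] ⋀[ℚ]^i (H n)) :=
  (stdRep n).linHom (extRep i (stdRep n))

/-- `U = Hom(H, ⋀² H)`. -/
abbrev U (n : ℕ) : Type := H n →ₗ[ℚ] ⋀[ℚ]^2 (H n)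

instance (n : ℕ) : AddCommGroup (U n) :=
  { (LinearMap.addCommMonoid : AddCommMonoid (U n)),
    (LinearMap.addCommGroup : AddCommGroup (U n)) with }

/-- The representation of `GL(n, ℚ)` on `U`. -/
def URep (n : ℕ) : Representation ℚ (GL (Fin n) ℚ) (U n) :=
  (stdRep n).linHom (extRep 2 (stdRep n))

theorem update_vec_0 {V : Type*} (a b c : V) : Function.update ![a, b] 0 c = ![c, b] := by
  ext j; fin_cases j <;> rfl

theorem update_vec_1 {V : Type*} (a b c : V) : Function.update ![a, b] 1 c = ![a, c] := by
  ext j; fin_cases j <;> rfl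

/-- The bilinear map `(a, b) ↦ a ∧ b`. As a map `H → Hom(H, ⋀² H) = U` it is the embedding
of `H` in `U` whose cokernel is `U^O`. -/
def wedge (n : ℕ) : H n →ₗ[ℚ] U n :=
  LinearMap.mk₂ ℚ (fun a b => exteriorPower.ιMulti ℚ 2 ![a, b])
    (fun a a' b => by
      have h := (exteriorPower.ιMulti ℚ 2 (M := H n)).map_update_add ![a, b] 0 a a'
      rw [update_vec_0, update_vec_0, update_vec_0] at h
      exact h)
    (fun c a b => by
      have h := (exteriorPower.ιMulti ℚ 2 (M := H n)).map_update_smul ![a, b] 0 c a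
      rw [update_vec_0, update_vec_0] at h
      exact h)
    (fun a b b' => by
      have h := (exteriorPower.ιMulti ℚ 2 (M := H n)).map_update_add ![a, b] 1 b b'
      rw [update_vec_1, update_vec_1, update_vec_1] at h
      exact h)
    (fun c a b => by
      have h := (exteriorPower.ιMulti ℚ 2 (M := H n)).map_update_smul ![a, b] 1 c b
      rw [update_vec_1, update_vec_1] at h
      exact h)

theorem wedge_apply (n : ℕ) (a b : H n) : wedge n a b = exteriorPower.ιMulti ℚ 2 ![a, b] := rfl

theorem wedge_self (n : ℕ) (a : H n) : wedge n a a = 0 :=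
  (exteriorPower.ιMulti ℚ 2 (M := H n)).map_eq_zero_of_eq ![a, a] (i := 0) (j := 1) rfl (by simp)

theorem wedge_swap (n : ℕ) (a b : H n) : wedge n a b = - wedge n b a := by
  have h := wedge_self n (a + b)
  simp only [map_add, LinearMap.add_apply, wedge_self, zero_add, add_zero] at h
  exact eq_neg_of_add_eq_zero_right h

theorem extRep_wedge (n : ℕ) (g : GL (Fin n) ℚ) (a b : H n) :
    extRep 2 (stdRep n) g (wedge n a b) = wedge n (stdRep n g a) (stdRep n g b) := by
  change exteriorPower.map 2 _ (exteriorPower.ιMulti ℚ 2 ![a, b]) = _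
  rw [exteriorPower.map_apply_ιMulti, wedge_apply]
  congr 1
  ext j
  fin_cases j <;> rfl

/-- `U^O = Hom(H, ⋀² H) / H`. -/
abbrev UO (n : ℕ) : Type := U n ⧸ LinearMap.range (wedge n)

/-- The representation of `GL(n, ℚ)` on `U^O`. -/
def UORep (n : ℕ) : Representation ℚ (GL (Fin n) ℚ) (UO n) :=
  (URep n).quotient (LinearMap.range (wedge n)) (by
    rintro g _ ⟨a, rfl⟩
    refine ⟨stdRep n g a, ?_⟩
    refine LinearMap.ext fun b => ?_
    change _ = extRep 2 (stdRep n) g (wedge n a (stdRep n g⁻¹ b))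
    rw [extRep_wedge, Representation.self_inv_apply])

/-! ### The Johnson homomorphism -/

/-- The free 2-step nilpotent rational Lie algebra `H ⊕ ⋀² H`, made into a group by the
Baker–Campbell–Hausdorff formula. -/
@[ext]
structure Nil2 (n : ℕ) where
  deg1 : H n
  deg2 : ⋀[ℚ]^2 (H n)

instance (n : ℕ) : Group (Nil2 n) where
  mul a b := ⟨a.deg1 + b.deg1, a.deg2 + b.deg2 + (1 / 2 : ℚ) • wedge n a.deg1 b.deg1⟩
  one := ⟨0, 0⟩
  inv a := ⟨-a.deg1, -a.deg2⟩
  mul_assoc a b c := by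
    apply Nil2.ext
    · exact add_assoc _ _ _
    · change (a.deg2 + b.deg2 + (1 / 2 : ℚ) • wedge n a.deg1 b.deg1) + c.deg2 +
        (1 / 2 : ℚ) • wedge n (a.deg1 + b.deg1) c.deg1 =
        a.deg2 + (b.deg2 + c.deg2 + (1 / 2 : ℚ) • wedge n b.deg1 c.deg1) +
        (1 / 2 : ℚ) • wedge n a.deg1 (b.deg1 + c.deg1)
      simp only [map_add, LinearMap.add_apply, smul_add]
      abel
  one_mul a := by
    apply Nil2.ext
    · exact zero_add _
    · change 0 + a.deg2 + (1 / 2 : ℚ) • wedge n 0 a.deg1 = a.deg2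
      simp
  mul_one a := by
    apply Nil2.ext
    · exact add_zero _
    · change a.deg2 + 0 + (1 / 2 : ℚ) • wedge n a.deg1 0 = a.deg2
      simp
  inv_mul_cancel a := by
    apply Nil2.ext
    · exact neg_add_cancel _
    · change -a.deg2 + a.deg2 + (1 / 2 : ℚ) • wedge n (-a.deg1) a.deg1 = 0
      simp [wedge_self]

theorem Nil2.mul_deg1 {n : ℕ} (a b : Nil2 n) : (a * b).deg1 = a.deg1 + b.deg1 := rfl

theorem Nil2.mul_deg2 {n : ℕ} (a b : Nil2 n) :
    (a * b).deg2 = a.deg2 + b.deg2 + (1 / 2 : ℚ) • wedge n a.deg1 b.deg1 := rfl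

theorem Nil2.inv_deg1 {n : ℕ} (a : Nil2 n) : (a⁻¹).deg1 = -a.deg1 := rfl

theorem Nil2.inv_deg2 {n : ℕ} (a : Nil2 n) : (a⁻¹).deg2 = -a.deg2 := rfl

theorem Nil2.one_deg1 {n : ℕ} : (1 : Nil2 n).deg1 = 0 := rfl

theorem Nil2.one_deg2 {n : ℕ} : (1 : Nil2 n).deg2 = 0 := rfl

/-- The homomorphism from `F_n` to the group `H ⊕ ⋀² H` with `x_j ↦ e_j`. On the commutator
subgroup `Γ_2` it is the projection `Γ_2 → Γ_2 / Γ_3 = ⋀² H_ℤ ⊆ ⋀² H`, `[x, y] ↦ x ∧ y`. -/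
def nil2 (n : ℕ) : F n →* Nil2 n :=
  FreeGroup.lift fun j => ⟨Pi.single j 1, 0⟩

/-- `H_1(F_n, ℤ) → H`. -/
def toH (n : ℕ) (x : F n) : H n := fun k => ((ab n x).toAdd k : ℚ)

theorem toH_mul (n : ℕ) (x y : F n) : toH n (x * y) = toH n x + toH n y := by
  ext k; simp [toH]

theorem toH_of (n : ℕ) (j : Fin n) : toH n (FreeGroup.of j) = Pi.single j 1 := by
  ext k
  by_cases h : k = j <;> simp [toH, ab, h]

theorem nil2_deg1 (n : ℕ) (x : F n) : (nil2 n x).deg1 = toH n x := by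
  induction x using FreeGroup.induction_on with
  | C1 => ext k; simp [toH, Nil2.one_deg1]
  | of j => rw [toH_of]; simp [nil2]
  | inv_of j h =>
    rw [map_inv, Nil2.inv_deg1, h]; ext k; simp [toH]
  | mul x y hx hy => rw [map_mul, Nil2.mul_deg1, hx, hy, toH_mul]

theorem nil2_commutator (n : ℕ) (x y : F n) :
    nil2 n (x * y * x⁻¹ * y⁻¹) = ⟨0, wedge n (toH n x) (toH n y)⟩ := by
  apply Nil2.ext
  · simp only [map_mul, map_inv, Nil2.mul_deg1, Nil2.inv_deg1]; abel
  · simp only [map_mul, map_inv, Nil2.mul_deg2, Nil2.mul_deg1, Nil2.inv_deg1, Nil2.inv_deg2,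
      map_add, map_neg, LinearMap.add_apply, LinearMap.neg_apply, nil2_deg1, wedge_self,
      wedge_swap n (toH n y) (toH n x), smul_add, smul_neg]
    module

/-- The Johnson homomorphism `τ(φ) : H → ⋀² H`, `[x] ↦ x⁻¹ φ(x) ∈ Γ_2 / Γ_3`, of an automorphism
`φ` of `F_n` acting trivially on `H_1(F_n, ℤ)`. (For other `φ` the value has no meaning.) -/
def johnson (n : ℕ) (φ : MulAut (F n)) : U n :=
  (Pi.basisFun ℚ (Fin n)).constr ℚ fun j =>
    (nil2 n ((FreeGroup.of j)⁻¹ * φ (FreeGroup.of j))).deg2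

theorem nil2_apply (n : ℕ) {φ : MulAut (F n)} (hφ : autToGL n φ = 1) (x : F n) :
    nil2 n (φ x) = nil2 n x * ⟨0, johnson n φ (toH n x)⟩ := by
  rw [autToGL_eq_one_iff] at hφ
  have hH : ∀ y, toH n (φ y) = toH n y := fun y => by ext k; simp [toH, hφ]
  let L : F n →* Nil2 n :=
    { toFun := fun y => nil2 n y * ⟨0, johnson n φ (toH n y)⟩
      map_one' := by
        have : toH n 1 = 0 := by ext k; simp [toH]
        rw [this, map_zero, map_one, one_mul]; rfl
      map_mul' := fun y z => by
        apply Nil2.ext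
        · simp [Nil2.mul_deg1]
        · simp only [map_mul, toH_mul, map_add, Nil2.mul_deg2, Nil2.mul_deg1, map_zero,
            smul_zero, add_zero]
          abel }
  have h : (nil2 n).comp φ.toMonoidHom = L := by
    refine FreeGroup.ext_hom _ _ fun j => ?_
    change nil2 n (φ (FreeGroup.of j)) =
      nil2 n (FreeGroup.of j) * ⟨0, johnson n φ (toH n (FreeGroup.of j))⟩
    have h1 : johnson n φ (toH n (FreeGroup.of j)) =
        (nil2 n ((FreeGroup.of j)⁻¹ * φ (FreeGroup.of j))).deg2 := by
      rw [toH_of, johnson, ← Pi.basisFun_apply, Module.Basis.constr_basis]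
    have h2 : nil2 n ((FreeGroup.of j)⁻¹ * φ (FreeGroup.of j)) =
        ⟨0, johnson n φ (toH n (FreeGroup.of j))⟩ := by
      apply Nil2.ext
      · rw [nil2_deg1, toH_mul, hH, ← toH_mul, inv_mul_cancel]
        ext k; simp [toH]
      · exact h1.symm
    rw [← h2, ← map_mul, mul_inv_cancel_left]
  exact DFunLike.congr_fun h x

theorem johnson_eq_of_forall (n : ℕ) {φ : MulAut (F n)} (hφ : autToGL n φ = 1) (L : U n)
    (h : ∀ x, nil2 n (φ x) = nil2 n x * ⟨0, L (toH n x)⟩) : johnson n φ = L := by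
  refine (Pi.basisFun ℚ (Fin n)).ext fun j => ?_
  rw [Pi.basisFun_apply, ← toH_of]
  have h1 := (nil2_apply n hφ (FreeGroup.of j)).symm.trans (h (FreeGroup.of j))
  exact congrArg Nil2.deg2 (mul_left_cancel h1)

theorem johnson_mul (n : ℕ) {φ ψ : MulAut (F n)} (hφ : autToGL n φ = 1) (hψ : autToGL n ψ = 1) :
    johnson n (φ * ψ) = johnson n φ + johnson n ψ := by
  refine johnson_eq_of_forall n (by rw [map_mul, hφ, hψ, one_mul]) _ fun x => ?_
  have hH : toH n (ψ x) = toH n x := by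
    ext k; simp [toH, (autToGL_eq_one_iff n ψ).1 hψ]
  rw [MulAut.mul_apply, nil2_apply n hφ, nil2_apply n hψ, hH, mul_assoc]
  congr 1
  apply Nil2.ext
  · simp [Nil2.mul_deg1]
  · simp [Nil2.mul_deg2, add_comm]

theorem autToGL_conj (n : ℕ) (y : F n) : autToGL n (MulAut.conj y) = 1 := by
  rw [autToGL_eq_one_iff]
  intro x
  simp [MulAut.conj_apply]

theorem johnson_conj (n : ℕ) (y : F n) : johnson n (MulAut.conj y) = wedge n (toH n y) := by
  refine johnson_eq_of_forall n (autToGL_conj n y) _ fun x => ?_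
  have h : MulAut.conj y x = x * (x⁻¹ * y * x⁻¹⁻¹ * y⁻¹) := by
    rw [MulAut.conj_apply]; group
  rw [h, map_mul, nil2_commutator]
  congr 1
  have h2 : toH n x⁻¹ = - toH n x := by ext k; simp [toH]
  rw [h2, wedge_swap n (toH n y)]
  simp

theorem autToGL_of_mk {n : ℕ} {φ : MulAut (F n)} (h : (φ : OutF n) ∈ IOut n) : autToGL n φ = 1 := h

theorem mk_johnson_congr {n : ℕ} {φ ψ : MulAut (F n)} (hφ : autToGL n φ = 1)
    (h : (φ : OutF n) = ψ) :
    (Submodule.Quotient.mk (johnson n φ) : UO n) = Submodule.Quotient.mk (johnson n ψ) := by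
  obtain ⟨y, hy⟩ := QuotientGroup.eq.1 h
  have h1 : ψ = φ * MulAut.conj y := by rw [hy, mul_inv_cancel_left]
  rw [h1, johnson_mul n hφ (autToGL_conj n y), johnson_conj]
  symm
  rw [Submodule.Quotient.eq]
  exact ⟨toH n y, by abel⟩

/-- The Johnson homomorphism `τ^O : IO_n → U^O`: the class of `φ` is sent to the class of
`τ(φ)`. -/
def johnsonOut (n : ℕ) : IOut n →* Multiplicative (UO n) where
  toFun o := Multiplicative.ofAdd (Submodule.Quotient.mk (johnson n (Quotient.out o.1)))
  map_one' := by
    have h : ((Quotient.out (1 : OutF n) : MulAut (F n)) : OutF n) = ((1 : MulAut (F n)) : OutF n) :=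
      Quotient.out_eq _
    have h1 : autToGL n (Quotient.out (1 : OutF n)) = 1 :=
      autToGL_of_mk (by rw [h]; exact (IOut n).one_mem)
    have h2 : johnson n 1 = 0 := by
      have := johnson_mul n (map_one (autToGL n)) (map_one (autToGL n))
      simpa using this
    change Multiplicative.ofAdd _ = Multiplicative.ofAdd (0 : UO n)
    congr 1
    exact (mk_johnson_congr h1 h).trans (by rw [h2]; rfl)
  map_mul' a b := by
    have hh : ∀ c : OutF n, ((Quotient.out c : MulAut (F n)) : OutF n) = c :=
      fun c => Quotient.out_eq _
    have h1 : ∀ c : IOut n, autToGL n (Quotient.out c.1) = 1 :=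
      fun c => autToGL_of_mk (by rw [hh]; exact c.2)
    have h2 : ((Quotient.out (a * b).1 : MulAut (F n)) : OutF n) =
        ((Quotient.out a.1 * Quotient.out b.1 : MulAut (F n)) : OutF n) := by
      rw [hh, QuotientGroup.mk_mul, hh, hh]; rfl
    rw [← ofAdd_add]
    congr 1
    rw [mk_johnson_congr (h1 _) h2, johnson_mul n (h1 a) (h1 b)]
    rfl

theorem johnsonOut_mk (n : ℕ) (φ : MulAut (F n)) (h : (φ : OutF n) ∈ IOut n) :
    johnsonOut n ⟨φ, h⟩ = Multiplicative.ofAdd (Submodule.Quotient.mk (johnson n φ)) := by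
  have hh : ((Quotient.out (φ : OutF n) : MulAut (F n)) : OutF n) = φ := Quotient.out_eq _
  exact congrArg Multiplicative.ofAdd
    (mk_johnson_congr (autToGL_of_mk (by rw [hh]; exact h)) hh)

/-! ### Albanese homology -/

/-- `H_i(G, ℚ)`. -/
abbrev Hom (G : Type) [Group G] (i : ℕ) : ModuleCat ℚ :=
  groupHomology (Rep.trivial ℚ G ℚ) i

/-- The map `H_i(G, ℚ) → H_i(K, ℚ)` induced by a homomorphism `f : G → K`. -/
def homologyMap {G K : Type} [Group G] [Group K] (f : G →* K) (i : ℕ) : Hom G i →ₗ[ℚ] Hom K i :=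
  (groupHomology.map (A := Rep.trivial ℚ G ℚ) (B := Rep.trivial ℚ K ℚ) f
    (Rep.ofHom ⟨LinearMap.id, fun _ => rfl⟩) i).hom

/-- The Albanese homology `H^A_i(G, ℚ)`: the image of `H_i(G, ℚ) → H_i(H_1(G, ℤ), ℚ)`, where
`H_1(G, ℤ)` is the abelianization of `G`. -/
def albanese (G : Type) [Group G] (i : ℕ) : Submodule ℚ (Hom (Abelianization G) i) :=
  LinearMap.range (homologyMap (Abelianization.of (G := G)) i)

/-- The surjection `H_i(G, ℚ) → H^A_i(G, ℚ)`. -/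
def toAlbanese (G : Type) [Group G] (i : ℕ) : Hom G i →ₗ[ℚ] albanese G i :=
  LinearMap.rangeRestrict _

/-! ### The comparison of `H_i` with exterior powers -/

theorem multilinear_contractNth {V W : Type*} [AddCommGroup V] [Module ℚ V] [AddCommGroup W]
    [Module ℚ W] (i : ℕ) (m : MultilinearMap ℚ (fun _ : Fin i => V) W) (v : Fin (i + 1) → V) :
    m (fun k => v k.succ) +
      ∑ j : Fin (i + 1), (-1 : ℚ) ^ ((j : ℕ) + 1) • m (Fin.contractNth j (· + ·) v) = 0 := by
  let f : Fin (i + 1) → W := fun p => m (fun k => v (p.succAbove k))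
  have h0 : m (fun k => v k.succ) = f 0 := by simp [f]
  have hlast : m (Fin.contractNth (Fin.last i) (· + ·) v) = f (Fin.last i) := by
    simp only [f]
    congr 1
    funext k
    rw [Fin.contractNth_apply_of_lt _ _ _ _ k.2, Fin.succAbove_last]
  have hj : ∀ j : Fin i, m (Fin.contractNth j.castSucc (· + ·) v) = f j.castSucc + f j.succ := by
    intro j
    let w : Fin i → V := fun k => v (j.castSucc.succAbove k)
    have h1 : Fin.contractNth j.castSucc (· + ·) v =
        Function.update w j (v j.castSucc + v j.succ) := by
      funext k
      rcases lt_trichotomy (k : ℕ) j with h | h | h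
      · rw [Fin.contractNth_apply_of_lt _ _ _ _ h,
          Function.update_of_ne (fun e => by rw [e] at h; exact lt_irrefl _ h)]
        simp only [w]
        rw [Fin.succAbove_of_castSucc_lt j.castSucc k (Fin.lt_def.2 h)]
      · have e : k = j := Fin.ext h
        subst e
        rw [Fin.contractNth_apply_of_eq _ _ _ _ rfl, Function.update_self]
      · rw [Fin.contractNth_apply_of_gt _ _ _ _ h,
          Function.update_of_ne (fun e => by rw [e] at h; exact lt_irrefl _ h)]
        simp only [w]
        rw [Fin.succAbove_of_le_castSucc j.castSucc k (Fin.le_def.2 h.le)]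
    have h2 : Function.update w j (v j.succ) = fun k => v (j.castSucc.succAbove k) := by
      funext k
      by_cases e : k = j
      · subst e; simp
      · rw [Function.update_of_ne e]
    have h3 : Function.update w j (v j.castSucc) = fun k => v (j.succ.succAbove k) := by
      funext k
      rcases lt_trichotomy (k : ℕ) j with h | h | h
      · rw [Function.update_of_ne (fun e => by rw [e] at h; exact lt_irrefl _ h)]
        simp only [w]
        rw [Fin.succAbove_of_castSucc_lt j.castSucc k (Fin.lt_def.2 h),
          Fin.succAbove_of_castSucc_lt j.succ k (Fin.lt_def.2 (Nat.lt_succ_of_lt h))]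
      · have e : k = j := Fin.ext h
        subst e
        rw [Function.update_self, Fin.succAbove_of_castSucc_lt k.succ k (Fin.lt_def.2 (Nat.lt_succ_self _))]
      · rw [Function.update_of_ne (fun e => by rw [e] at h; exact lt_irrefl _ h)]
        simp only [w]
        rw [Fin.succAbove_of_le_castSucc j.castSucc k (Fin.le_def.2 h.le),
          Fin.succAbove_of_le_castSucc j.succ k (Fin.le_def.2 h)]
    rw [h1, MultilinearMap.map_update_add, h2, h3, add_comm]
  have e1 := Fin.sum_univ_castSucc fun p : Fin (i + 1) => (-1 : ℚ) ^ (p : ℕ) • f p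
  have e2 := Fin.sum_univ_succ fun p : Fin (i + 1) => (-1 : ℚ) ^ (p : ℕ) • f p
  rw [e1] at e2
  simp only [Fin.val_castSucc, Fin.val_last, Fin.val_zero, Fin.val_succ, pow_zero, one_smul] at e2
  rw [Fin.sum_univ_castSucc, h0, hlast]
  simp only [hj, smul_add, Finset.sum_add_distrib, Fin.val_castSucc, Fin.val_last]
  have e3 : ∑ j : Fin i, (-1 : ℚ) ^ ((j : ℕ) + 1) • f j.castSucc =
      - ∑ j : Fin i, (-1 : ℚ) ^ (j : ℕ) • f j.castSucc := by
    rw [← Finset.sum_neg_distrib]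
    refine Finset.sum_congr rfl fun j _ => ?_
    rw [pow_succ, mul_neg_one, neg_smul]
  rw [e3, pow_succ, mul_neg_one, neg_smul]
  have e4 := sub_eq_zero.2 e2
  rw [← neg_eq_zero, ← e4]
  abel

/-- The chain map `[g_1 | … | g_i] ↦ θ(g_1) ∧ … ∧ θ(g_i)`. -/
def wedgeChain {G V : Type} [Group G] [AddCommGroup V] [Module ℚ V] (θ : G →* Multiplicative V)
    (i : ℕ) : ((Fin i → G) →₀ ℚ) →ₗ[ℚ] ⋀[ℚ]^i V :=
  Finsupp.lsum ℚ fun g =>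
    LinearMap.toSpanSingleton ℚ _ (exteriorPower.ιMulti ℚ i fun k => (θ (g k)).toAdd)

theorem wedgeChain_d {G V : Type} [Group G] [AddCommGroup V] [Module ℚ V]
    (θ : G →* Multiplicative V) (i : ℕ) :
    (groupHomology.inhomogeneousChains (Rep.trivial ℚ G ℚ)).d (i + 1) i ≫
      ModuleCat.ofHom (wedgeChain θ i) = 0 := by
  rw [groupHomology.inhomogeneousChains.d_def]
  apply ModuleCat.hom_ext
  refine Finsupp.lhom_ext fun g a => ?_
  have key := multilinear_contractNth i (exteriorPower.ιMulti ℚ i (M := V)).toMultilinearMap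
    (fun k => (θ (g k)).toAdd)
  have h : ∀ j : Fin (i + 1), (fun k => (θ (Fin.contractNth j (· * ·) g k)).toAdd) =
      Fin.contractNth j (· + ·) (fun k => (θ (g k)).toAdd) := by
    intro j
    funext k
    unfold Fin.contractNth
    split_ifs <;> simp
  change wedgeChain θ i (groupHomology.inhomogeneousChains.d _ i (Finsupp.single g a)) = 0
  rw [groupHomology.inhomogeneousChains.d_single]
  have hs : ∀ (x : Fin i → G) (b : ℚ), wedgeChain θ i (Finsupp.single x b) =
      b • exteriorPower.ιMulti ℚ i fun k => (θ (x k)).toAdd := by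
    intro x b
    simp [wedgeChain]
  rw [map_add, map_sum]
  simp only [map_smul]
  erw [hs]
  have hs' : ∀ j : Fin (i + 1),
      wedgeChain θ i (Finsupp.single (Fin.contractNth j (· * ·) g) a) =
      a • exteriorPower.ιMulti ℚ i (Fin.contractNth j (· + ·) (fun k => (θ (g k)).toAdd)) := by
    intro j
    rw [hs, h]
  have e : ∀ j : Fin (i + 1), (-1 : ℚ) ^ ((j : ℕ) + 1) •
      wedgeChain θ i (Finsupp.single (Fin.contractNth j (· * ·) g) a) =
      a • ((-1 : ℚ) ^ ((j : ℕ) + 1) •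
        exteriorPower.ιMulti ℚ i (Fin.contractNth j (· + ·) (fun k => (θ (g k)).toAdd))) := by
    intro j
    rw [hs', smul_comm]
  have := congrArg (fun z => a • z) key
  simp only [smul_add, Finset.smul_sum, smul_zero] at this
  rw [← this]
  congr 1
  exact Finset.sum_congr rfl fun j _ => e j

/-- The natural map `H_i(G, ℚ) → ⋀^i V` induced by a homomorphism `θ` from `G` to (the additive
group of) a rational vector space `V`, given on inhomogeneous cycles by
`[g_1 | … | g_i] ↦ θ(g_1) ∧ … ∧ θ(g_i)`. For abelian `G` with `G ⊗ ℚ ≅ V` it is, up to the factor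
`i!`, the inverse of the standard isomorphism `⋀^i V ≅ H_i(G, ℚ)`. -/
def homologyToExt {G V : Type} [Group G] [AddCommGroup V] [Module ℚ V]
    (θ : G →* Multiplicative V) (i : ℕ) : Hom G i →ₗ[ℚ] ⋀[ℚ]^i V :=
  ((groupHomology.inhomogeneousChains (Rep.trivial ℚ G ℚ)).homologyι i ≫
    (groupHomology.inhomogeneousChains (Rep.trivial ℚ G ℚ)).descOpcycles
      (ModuleCat.ofHom (wedgeChain θ i)) (i + 1) (ChainComplex.prev ℕ i) (wedgeChain_d θ i)).hom

/-- The map `H^A_i(IO_n, ℚ) → ⋀^i U^O` induced by the Johnson homomorphism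
`H_1(IO_n, ℤ) → U^O`. -/
def albaneseToExt (n i : ℕ) : albanese (IOut n) i →ₗ[ℚ] ⋀[ℚ]^i (UO n) :=
  homologyToExt (Abelianization.lift (johnsonOut n)) i ∘ₗ Submodule.subtype _

/-- A linear action of `GL(n, ℚ)` on `H^A_i(IO_n, ℚ)` is the standard one if it is the restriction
of the action on `⋀^i U^O ≅ H_i(U^O, ℚ)` along the map induced by the Johnson homomorphism. -/
def IsStandardAction (n i : ℕ) (ρ : Representation ℚ (GL (Fin n) ℚ) (albanese (IOut n) i)) : Prop :=
  ∀ g x, albaneseToExt n i (ρ g x) = extRep i (UORep n) g (albaneseToExt n i x)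

/-- The action of `o ∈ Out(F_n)` on `H_i(IO_n, ℚ)` induced by conjugation on `IO_n`. -/
def conjAction (n i : ℕ) (o : OutF n) : Hom (IOut n) i →ₗ[ℚ] Hom (IOut n) i :=
  homologyMap (MulAut.conjNormal o).toMonoidHom i

/-- The homomorphism `Out(F_n) → GL(n, ℤ) ⊆ GL(n, ℚ)`. -/
def outToGLQ (n : ℕ) : OutF n →* GL (Fin n) ℚ :=
  (Matrix.GeneralLinearGroup.map (Int.castRingHom ℚ)).comp (outToGL n)

/-- There is a surjective `GL(n, ℚ)`-homomorphism `f : H^A_i(IO_n, ℚ) → M`, where `H^A_i(IO_n, ℚ)`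
carries the standard action of `GL(n, ℚ)`. The composite of `f` with `H_i(IO_n, ℚ) → H^A_i(IO_n, ℚ)`
is moreover compatible with the conjugation action of `Out(F_n)` on `H_i(IO_n, ℚ)`. -/
def SurjectsOnto (n i : ℕ) {M : Type} [AddCommMonoid M] [Module ℚ M]
    (σ : Representation ℚ (GL (Fin n) ℚ) M) : Prop :=
  ∃ ρ : Representation ℚ (GL (Fin n) ℚ) (albanese (IOut n) i), IsStandardAction n i ρ ∧
    ∃ f : ρ.IntertwiningMap σ, Function.Surjective f ∧
      ∀ (o : OutF n) (c : Hom (IOut n) i),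
        f (toAlbanese (IOut n) i (conjAction n i o c)) =
          σ (outToGLQ n o) (f (toAlbanese (IOut n) i c))

/-! ### The irreducible representations `V_{λ⁺, λ⁻}` -/

section Bipartition

variable {α β : Type} [DecidableEq α] [DecidableEq β]

/-- `H^{⊗ α} ⊗ (H^*)^{⊗ β}` for index sets `α`, `β`. -/
abbrev Mixed (n : ℕ) (α β : Type) : Type :=
  (⨂[ℚ] _ : α, H n) ⊗[ℚ] (⨂[ℚ] _ : β, Module.Dual ℚ (H n))

/-- The isomorphism `V^{⊗ α} ≅ V ⊗ V^{⊗ (α ∖ {k})}`. -/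
def splitAt (V : Type) [AddCommGroup V] [Module ℚ V] (k : α) :
    (⨂[ℚ] _ : α, V) ≃ₗ[ℚ] V ⊗[ℚ] (⨂[ℚ] _ : {a : α // ¬ a = k}, V) :=
  PiTensorProduct.reindex ℚ (fun _ => V) (Equiv.sumCompl fun a => a = k).symm ≪≫ₗ
    (PiTensorProduct.tmulEquiv ℚ V).symm ≪≫ₗ
    TensorProduct.congr (PiTensorProduct.subsingletonEquiv ⟨k, rfl⟩) (LinearEquiv.refl ℚ _)

theorem splitAt_tprod (V : Type) [AddCommGroup V] [Module ℚ V] (k : α) (v : α → V) :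
    splitAt V k (PiTensorProduct.tprod ℚ v) =
      v k ⊗ₜ[ℚ] PiTensorProduct.tprod ℚ fun a : {a : α // ¬ a = k} => v a := by
  simp only [splitAt, LinearEquiv.trans_apply]
  erw [PiTensorProduct.reindex_tprod, PiTensorProduct.tmulEquiv_symm_apply]
  rw [TensorProduct.congr_tmul]
  erw [PiTensorProduct.subsingletonEquiv_apply_tprod]
  rfl

/-- The contraction map `c_{k,l}`, pairing the `k`-th factor `H` with the `l`-th factor `H^*`. -/
def contraction (n : ℕ) (k : α) (l : β) :
    Mixed n α β →ₗ[ℚ] Mixed n {a : α // ¬ a = k} {b : β // ¬ b = l} :=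
  (TensorProduct.lid ℚ _).toLinearMap ∘ₗ
    TensorProduct.map (contractRight ℚ (H n)) LinearMap.id ∘ₗ
    (TensorProduct.tensorTensorTensorComm ℚ _ _ _ _).toLinearMap ∘ₗ
    TensorProduct.map (splitAt (H n) k).toLinearMap
      (splitAt (Module.Dual ℚ (H n)) l).toLinearMap

theorem contraction_tprod (n : ℕ) (k : α) (l : β) (v : α → H n) (f : β → Module.Dual ℚ (H n)) :
    contraction n k l (PiTensorProduct.tprod ℚ v ⊗ₜ[ℚ] PiTensorProduct.tprod ℚ f) =
      f l (v k) • ((PiTensorProduct.tprod ℚ fun a : {a : α // ¬ a = k} => v a) ⊗ₜ[ℚ]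
        (PiTensorProduct.tprod ℚ fun b : {b : β // ¬ b = l} => f b)) := by
  simp [contraction, splitAt_tprod]

/-- The traceless part `T_{α,β}`: the intersection of the kernels of all contractions. -/
def traceless (n : ℕ) (α β : Type) [DecidableEq α] [DecidableEq β] :
    Submodule ℚ (Mixed n α β) :=
  ⨅ (k : α) (l : β), LinearMap.ker (contraction n k l)

/-- The tensor power representation `V^{⊗ α}`. -/
def piRep {G V : Type} [Group G] [AddCommGroup V] [Module ℚ V] (α : Type)
    (ρ : Representation ℚ G V) : Representation ℚ G (⨂[ℚ] _ : α, V) where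
  toFun g := PiTensorProduct.map fun _ => ρ g
  map_one' := by simp only [map_one]; exact PiTensorProduct.map_id
  map_mul' g h := by simp only [map_mul]; exact PiTensorProduct.map_comp _ _

/-- `GL(n, ℚ)` acting on `H^{⊗ α} ⊗ (H^*)^{⊗ β}`. -/
def mixedRep (n : ℕ) (α β : Type) : Representation ℚ (GL (Fin n) ℚ) (Mixed n α β) :=
  (piRep α (stdRep n)).tprod (piRep β (stdRep n).dual)

/-- The symmetric group of `α` permuting the factors of `V^{⊗ α}`. -/
def permRep (V : Type) [AddCommGroup V] [Module ℚ V] (α : Type) :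
    Representation ℚ (Equiv.Perm α) (⨂[ℚ] _ : α, V) where
  toFun s := (PiTensorProduct.reindex ℚ (fun _ => V) s).toLinearMap
  map_one' := by
    ext v
    simp
    rfl
  map_mul' s t := by
    ext v
    simp
    rfl

/-- `S_α × S_β` permuting the factors of `H^{⊗ α} ⊗ (H^*)^{⊗ β}`. -/
def mixedPermRep (n : ℕ) (α β : Type) :
    Representation ℚ (Equiv.Perm α × Equiv.Perm β) (Mixed n α β) :=
  Representation.tprod ((permRep (H n) α).comp (MonoidHom.fst _ _))
    ((permRep (Module.Dual ℚ (H n)) β).comp (MonoidHom.snd _ _))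

theorem contraction_mixedRep (n : ℕ) (k : α) (l : β) (g : GL (Fin n) ℚ) :
    contraction n k l ∘ₗ mixedRep n α β g =
      mixedRep n {a : α // ¬ a = k} {b : β // ¬ b = l} g ∘ₗ contraction n k l := by
  refine TensorProduct.ext (PiTensorProduct.ext (MultilinearMap.ext fun v => ?_))
  refine PiTensorProduct.ext (MultilinearMap.ext fun f => ?_)
  have h1 : ∀ (α' β' : Type) (v : α' → H n) (f : β' → Module.Dual ℚ (H n)),
      mixedRep n α' β' g (PiTensorProduct.tprod ℚ v ⊗ₜ[ℚ] PiTensorProduct.tprod ℚ f) =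
        PiTensorProduct.tprod ℚ (fun a => stdRep n g (v a)) ⊗ₜ[ℚ]
          PiTensorProduct.tprod ℚ (fun b => (stdRep n).dual g (f b)) := by
    intro α' β' v f
    change TensorProduct.map (PiTensorProduct.map _) (PiTensorProduct.map _) _ = _
    rw [TensorProduct.map_tmul, PiTensorProduct.map_tprod, PiTensorProduct.map_tprod]
  change contraction n k l (mixedRep n α β g (PiTensorProduct.tprod ℚ v ⊗ₜ[ℚ] PiTensorProduct.tprod ℚ f)) =
    mixedRep n _ _ g (contraction n k l (PiTensorProduct.tprod ℚ v ⊗ₜ[ℚ] PiTensorProduct.tprod ℚ f))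
  rw [h1, contraction_tprod, contraction_tprod, map_smul, h1]
  congr 1
  change f l (stdRep n g⁻¹ (stdRep n g (v k))) = _
  rw [Representation.inv_self_apply]

theorem traceless_le_comap_mixedRep (n : ℕ) (g : GL (Fin n) ℚ) :
    traceless n α β ≤ (traceless n α β).comap (mixedRep n α β g) := by
  intro x hx
  simp only [traceless, Submodule.mem_comap, Submodule.mem_iInf, LinearMap.mem_ker] at hx ⊢
  intro k l
  have h := LinearMap.congr_fun (contraction_mixedRep n k l g) x
  simp only [LinearMap.comp_apply] at h
  rw [h, hx, map_zero]

theorem contraction_mixedPermRep (n : ℕ) (k : α) (l : β) (s : Equiv.Perm α × Equiv.Perm β) :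
    contraction n k l ∘ₗ mixedPermRep n α β s =
      (TensorProduct.map
        (PiTensorProduct.reindex ℚ (fun _ => H n)
          (s.1.subtypeEquiv (p := fun a => ¬ a = s.1.symm k) (q := fun a => ¬ a = k)
            fun a => by rw [Equiv.eq_symm_apply])).toLinearMap
        (PiTensorProduct.reindex ℚ (fun _ => Module.Dual ℚ (H n))
          (s.2.subtypeEquiv (p := fun b => ¬ b = s.2.symm l) (q := fun b => ¬ b = l)
            fun b => by rw [Equiv.eq_symm_apply])).toLinearMap) ∘ₗ
      contraction n (s.1.symm k) (s.2.symm l) := by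
  refine TensorProduct.ext (PiTensorProduct.ext (MultilinearMap.ext fun v => ?_))
  refine PiTensorProduct.ext (MultilinearMap.ext fun f => ?_)
  have h1 : mixedPermRep n α β s (PiTensorProduct.tprod ℚ v ⊗ₜ[ℚ] PiTensorProduct.tprod ℚ f) =
        PiTensorProduct.tprod ℚ (fun a => v (s.1.symm a)) ⊗ₜ[ℚ]
          PiTensorProduct.tprod ℚ (fun b => f (s.2.symm b)) := by
    change TensorProduct.map (PiTensorProduct.reindex ℚ (fun _ => H n) s.1).toLinearMap
      (PiTensorProduct.reindex ℚ (fun _ => Module.Dual ℚ (H n)) s.2).toLinearMap _ = _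
    rw [TensorProduct.map_tmul, LinearEquiv.coe_coe, LinearEquiv.coe_coe,
      PiTensorProduct.reindex_tprod, PiTensorProduct.reindex_tprod]
  change contraction n k l (mixedPermRep n α β s (PiTensorProduct.tprod ℚ v ⊗ₜ[ℚ] PiTensorProduct.tprod ℚ f)) =
    TensorProduct.map _ _ (contraction n (s.1.symm k) (s.2.symm l)
      (PiTensorProduct.tprod ℚ v ⊗ₜ[ℚ] PiTensorProduct.tprod ℚ f))
  rw [h1, contraction_tprod, contraction_tprod, map_smul, TensorProduct.map_tmul,
    LinearEquiv.coe_coe, LinearEquiv.coe_coe,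
    PiTensorProduct.reindex_tprod, PiTensorProduct.reindex_tprod]
  rfl

theorem traceless_le_comap_mixedPermRep (n : ℕ) (s : Equiv.Perm α × Equiv.Perm β) :
    traceless n α β ≤ (traceless n α β).comap (mixedPermRep n α β s) := by
  intro x hx
  simp only [traceless, Submodule.mem_comap, Submodule.mem_iInf, LinearMap.mem_ker] at hx ⊢
  intro k l
  have h := LinearMap.congr_fun (contraction_mixedPermRep n k l s) x
  simp only [LinearMap.comp_apply] at h
  rw [h, hx, map_zero]

/-- `GL(n, ℚ)` acting on the traceless part. -/
def tracelessRep (n : ℕ) (α β : Type) [DecidableEq α] [DecidableEq β] :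
    Representation ℚ (GL (Fin n) ℚ) (traceless n α β) :=
  (mixedRep n α β).subrepresentation (traceless n α β) (traceless_le_comap_mixedRep n)

/-- `S_α × S_β` acting on the traceless part. -/
def tracelessPermRep (n : ℕ) (α β : Type) [DecidableEq α] [DecidableEq β] :
    Representation ℚ (Equiv.Perm α × Equiv.Perm β) (traceless n α β) :=
  (mixedPermRep n α β).subrepresentation (traceless n α β) (traceless_le_comap_mixedPermRep n)

end Bipartition

theorem mixedRep_comm (n : ℕ) (α β : Type) (g : GL (Fin n) ℚ) (s : Equiv.Perm α × Equiv.Perm β) :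
    mixedRep n α β g ∘ₗ mixedPermRep n α β s = mixedPermRep n α β s ∘ₗ mixedRep n α β g := by
  refine TensorProduct.ext (PiTensorProduct.ext (MultilinearMap.ext fun v => ?_))
  refine PiTensorProduct.ext (MultilinearMap.ext fun f => ?_)
  change TensorProduct.map (PiTensorProduct.map fun _ => stdRep n g)
      (PiTensorProduct.map fun _ => (stdRep n).dual g)
      (TensorProduct.map (PiTensorProduct.reindex ℚ (fun _ => H n) s.1).toLinearMap
        (PiTensorProduct.reindex ℚ (fun _ => Module.Dual ℚ (H n)) s.2).toLinearMap
        (PiTensorProduct.tprod ℚ v ⊗ₜ[ℚ] PiTensorProduct.tprod ℚ f)) =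
    TensorProduct.map (PiTensorProduct.reindex ℚ (fun _ => H n) s.1).toLinearMap
      (PiTensorProduct.reindex ℚ (fun _ => Module.Dual ℚ (H n)) s.2).toLinearMap
      (TensorProduct.map (PiTensorProduct.map fun _ => stdRep n g)
        (PiTensorProduct.map fun _ => (stdRep n).dual g)
        (PiTensorProduct.tprod ℚ v ⊗ₜ[ℚ] PiTensorProduct.tprod ℚ f))
  simp only [TensorProduct.map_tmul, LinearEquiv.coe_coe, PiTensorProduct.reindex_tprod,
    PiTensorProduct.map_tprod]

/-- The boxes of a Young diagram. -/
abbrev Cell (μ : YoungDiagram) : Type := {c : ℕ × ℕ // c ∈ μ.cells}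

/-- The Young symmetrizer `c_μ = b_μ a_μ` in the group algebra of the symmetric group on the boxes
of `μ`, where `a_μ` is the sum of the row-preserving permutations and `b_μ` the signed sum of the
column-preserving permutations. -/
def youngSymmetrizer (μ : YoungDiagram) : MonoidAlgebra ℚ (Equiv.Perm (Cell μ)) :=
  (∑ s : Equiv.Perm (Cell μ) with ∀ c, (s c).1.2 = c.1.2,
      ((Equiv.Perm.sign s : ℤ) : ℚ) • MonoidAlgebra.of ℚ _ s) *
    ∑ s : Equiv.Perm (Cell μ) with ∀ c, (s c).1.1 = c.1.1, MonoidAlgebra.of ℚ _ s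

/-- The Specht module `S^μ`, the left ideal generated by `c_μ`. -/
def specht (μ : YoungDiagram) : Submodule ℚ (MonoidAlgebra ℚ (Equiv.Perm (Cell μ))) :=
  LinearMap.range (LinearMap.mulRight ℚ (youngSymmetrizer μ))

/-- The symmetric group acting on `S^μ` by left multiplication. -/
def spechtRep (μ : YoungDiagram) : Representation ℚ (Equiv.Perm (Cell μ)) (specht μ) :=
  Representation.subrepresentation
    ((Algebra.lmul ℚ (MonoidAlgebra ℚ (Equiv.Perm (Cell μ)))).toMonoidHom.comp
      (MonoidAlgebra.of ℚ (Equiv.Perm (Cell μ)))) (specht μ) (by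
    rintro s _ ⟨x, rfl⟩
    exact ⟨MonoidAlgebra.of ℚ _ s * x, mul_assoc _ _ _⟩)

/-- `T ⊗ (S^{λ⁺} ⊗ S^{λ⁻})`, where `T` is the traceless part. -/
abbrev PreV (n : ℕ) (lp lm : YoungDiagram) : Type :=
  traceless n (Cell lp) (Cell lm) ⊗[ℚ] (specht lp ⊗[ℚ] specht lm)

instance (n : ℕ) (lp lm : YoungDiagram) : AddCommGroup (PreV n lp lm) :=
  Module.addCommMonoidToAddCommGroup ℚ

/-- The group `S_λ⁺ × S_λ⁻` acting diagonally on `T ⊗ (S^{λ⁺} ⊗ S^{λ⁻})`. -/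
def bipartitionPermRep (n : ℕ) (lp lm : YoungDiagram) :
    Representation ℚ (Equiv.Perm (Cell lp) × Equiv.Perm (Cell lm))
      (PreV n lp lm) :=
  (tracelessPermRep n (Cell lp) (Cell lm)).tprod
    (Representation.tprod ((spechtRep lp).comp (MonoidHom.fst _ _))
      ((spechtRep lm).comp (MonoidHom.snd _ _)))

/-- The `GL(n, ℚ)`-representation `V_{λ⁺, λ⁻} = T ⊗_{ℚ[S_λ⁺ × S_λ⁻]} (S^{λ⁺} ⊗ S^{λ⁻})`. The tensor
product over the group algebra is the space of coinvariants of the diagonal action on the tensor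
product over `ℚ`. -/
abbrev V (n : ℕ) (lp lm : YoungDiagram) : Type := (bipartitionPermRep n lp lm).Coinvariants

/-- `GL(n, ℚ)` acting on `V_{λ⁺, λ⁻}` through its action on the traceless part. -/
def VRep (n : ℕ) (lp lm : YoungDiagram) : Representation ℚ (GL (Fin n) ℚ) (V n lp lm) where
  toFun g := Representation.Coinvariants.map _ _
    { toLinearMap := TensorProduct.map (tracelessRep n (Cell lp) (Cell lm) g) LinearMap.id
      isIntertwining' := fun s => by
        refine TensorProduct.ext' fun x y => ?_
        have h := LinearMap.congr_fun (mixedRep_comm n _ _ g s) x.1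
        have h' : tracelessRep n (Cell lp) (Cell lm) g (tracelessPermRep n _ _ s x) =
            tracelessPermRep n _ _ s (tracelessRep n (Cell lp) (Cell lm) g x) := Subtype.ext h
        simp [bipartitionPermRep, h'] }
  map_one' := by
    refine Representation.Coinvariants.hom_ext (TensorProduct.ext' fun x y => ?_)
    simp
  map_mul' g h := by
    refine Representation.Coinvariants.hom_ext (TensorProduct.ext' fun x y => ?_)
    simp

/-- The Young diagram of the partition `1^p`: a single column with `p` boxes. -/
def column (p : ℕ) : YoungDiagram where
  cells := Finset.range p ×ˢ {0}
  isLowerSet := by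
    rintro ⟨a, b⟩ ⟨c, d⟩ h hab
    simp only [Prod.mk_le_mk, Finset.coe_product, Finset.coe_range, Finset.coe_singleton,
      Set.mem_prod, Set.mem_Iio, Set.mem_singleton_iff] at h hab ⊢
    omega

end AlbaneseIO

end

noncomputable section

open scoped TensorProduct CategoryTheory

namespace AlbaneseIO

/-! ### Equivariant multilinear operations on `Hom(H, ⋀ H)` -/

/-! The Johnson homomorphism sends `H_i(IO_n, ℚ)` to a subspace R of `⋀^i U^O`, which is also the
image of the Albanese homology. It therefore suffices to show that R is stable under `GL(n, ℚ)` and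
to find an equivariant map from `⋀^i U^O` to the target whose restriction to R is onto.

Stability (`extRep_UORep_mem_range`). Conjugation by `Out(F_n)` makes R stable under integral
transvections (`johnson_aut_conj`). The matrices act by rational functions of their entries, and a
polynomial curve that meets a subspace infinitely often lies in it, so R is stable under rational
transvections, hence under `SL(n, ℚ)`. Scalars act on `⋀^i U^O` by powers, and together with `SL(n,
ℚ)` they give `diag(s, 1, …, 1)` for infinitely many s; the same density argument then gives all s.

Projection (`projHom`). An element of `U^O` is lifted to the traceless part of U. An alternating map
`U^i → Hom(H, ⋀^{i+1} H)` is built by inserting one factor after another and correcting by a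
multiple of the trace part at each step.

Test class (`weightedWedge_mem_range`). The automorphisms conjugating every `x_j` with `j < k` by
`x_k` commute, so they give abelian cycles. Up to the factor `n - 1`, their traceless Johnson images
are `e_j ↦ a_{kj} e_j ∧ e_k` with explicit weights. The trace corrections are chosen so that the
projection takes the multiplicative form `e_j ↦ (∏_q a_{κ(q) j}) e_j ∧ e_κ`
(`multiInsertion_weightedWedge`).

Numerics. With 0-based indices take `κ = (1, …, i)` and put `c = n - 1 - i`. The coefficient is
`c(c+1)⋯(c+i-1)` at `j = 0` and `(-1)^i i!` at the c indices `j > i`. The trace of the value is thus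
`c(c+1)⋯(c+i-1) + (-1)^i c · i!` times `e_κ`. It is nonzero for `c ≥ 1` when i is even and for `c ≥
2` when i is odd, which is the stated range. Since `⋀^i H` is generated by any basis monomial, (1)
follows. For `c ≥ 2` the coefficients are moreover not all equal, and then the value generates all
of `Hom(H, ⋀^{i+1} H)` (`eq_top_of_stable_hom`), so (2) holds with `N = i + 3`.

The identification with the `V_{λ⁺, λ⁻}` uses that the Specht module of a column is the sign
representation, so that `V_{1^p, 1^q}` is the antisymmetric part of the traceless tensors. -/

/-- The exterior algebra of `H`. -/
abbrev Ext (n : ℕ) : Type := ExteriorAlgebra ℚ (H n)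

/-- `GL(n, ℚ)` acting on the exterior algebra of `H`. -/
def extAct (n : ℕ) (g : GL (Fin n) ℚ) : Ext n →ₐ[ℚ] Ext n := ExteriorAlgebra.map (stdRep n g)

theorem extAct_ι (n : ℕ) (g : GL (Fin n) ℚ) (h : H n) :
    extAct n g (ExteriorAlgebra.ι ℚ h) = ExteriorAlgebra.ι ℚ (stdRep n g h) :=
  ExteriorAlgebra.map_apply_ι _ _

/-- The alternating map `(a, b) ↦ a A(b) - b A(a)`. -/
def skewMul {n : ℕ} (A : H n →ₗ[ℚ] Ext n) : H n [⋀^Fin 2]→ₗ[ℚ] Ext n where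
  toMultilinearMap := MultilinearMap.mk' (fun v => ExteriorAlgebra.ι ℚ (v 0) * A (v 1) -
      ExteriorAlgebra.ι ℚ (v 1) * A (v 0))
    (fun v k x y => by
      fin_cases k <;> simp [add_mul, mul_add] <;> abel)
    (fun v k c x => by
      fin_cases k <;> simp [smul_sub])
  map_eq_zero_of_eq' := by
    intro v k l hv hkl
    have h : v 0 = v 1 := by
      fin_cases k <;> fin_cases l <;> simp_all
    simp [h]

/-- The linear map `a ∧ b ↦ a A(b) - b A(a)` on `⋀² H`, linear in `A`. -/
def deriv (n : ℕ) : (H n →ₗ[ℚ] Ext n) →ₗ[ℚ] (⋀[ℚ]^2 (H n) →ₗ[ℚ] Ext n) where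
  toFun A := exteriorPower.alternatingMapLinearEquiv (skewMul A)
  map_add' A B := by
    rw [← map_add]; congr 1; ext v; simp [skewMul, mul_add]; abel
  map_smul' c A := by
    rw [RingHom.id_apply, ← map_smul]; congr 1; ext v; simp [skewMul, smul_sub]

theorem deriv_wedge {n : ℕ} (A : H n →ₗ[ℚ] Ext n) (a b : H n) :
    deriv n A (wedge n a b) = ExteriorAlgebra.ι ℚ a * A b - ExteriorAlgebra.ι ℚ b * A a := by
  change exteriorPower.alternatingMapLinearEquiv (skewMul A) (exteriorPower.ιMulti ℚ 2 ![a, b]) = _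
  rw [exteriorPower.alternatingMapLinearEquiv_apply_ιMulti]
  rfl

theorem ext_wedge {n : ℕ} {W : Type*} [AddCommGroup W] [Module ℚ W]
    {f g : ⋀[ℚ]^2 (H n) →ₗ[ℚ] W} (h : ∀ a b, f (wedge n a b) = g (wedge n a b)) : f = g := by
  refine exteriorPower.linearMap_ext (AlternatingMap.ext fun v => ?_)
  have e : v = ![v 0, v 1] := by ext k; fin_cases k <;> rfl
  rw [e]
  exact h _ _

/-- The pairing `(u, A) ↦ (h ↦ δ_A (u h))` with `δ_A (a ∧ b) = a A(b) - b A(a)`. -/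
def insertion (n : ℕ) : U n →ₗ[ℚ] (H n →ₗ[ℚ] Ext n) →ₗ[ℚ] (H n →ₗ[ℚ] Ext n) :=
  LinearMap.mk₂ ℚ (fun u A => deriv n A ∘ₗ u)
    (fun u u' A => LinearMap.comp_add _ _ _)
    (fun c u A => LinearMap.comp_smul _ _ _)
    (fun u A B => by rw [map_add, LinearMap.add_comp])
    (fun c u A => by rw [map_smul, LinearMap.smul_comp])

/-- The alternating map `(u_0, …, u_r) ↦ ∑ p, (-1)^p A(u_0, …, û_p, …, u_r) ◁ u_p`. -/
def insertionSum {n r : ℕ} (A : U n [⋀^Fin r]→ₗ[ℚ] (H n →ₗ[ℚ] Ext n)) :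
    U n [⋀^Fin (r + 1)]→ₗ[ℚ] (H n →ₗ[ℚ] Ext n) :=
  AlternatingMap.alternatizeUncurryFin
    { toFun := fun u => (insertion n u).compAlternatingMap A
      map_add' := fun u v => by rw [map_add, LinearMap.add_compAlternatingMap]
      map_smul' := fun c u => by
        rw [map_smul, LinearMap.smul_compAlternatingMap, RingHom.id_apply] }

theorem insertionSum_apply {n r : ℕ} (A : U n [⋀^Fin r]→ₗ[ℚ] (H n →ₗ[ℚ] Ext n))
    (v : Fin (r + 1) → U n) (h : H n) :
    insertionSum A v h =
      ∑ p : Fin (r + 1), (-1 : ℤ) ^ (p : ℕ) • deriv n (A (p.removeNth v)) (v p h) := by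
  rw [insertionSum, AlternatingMap.alternatizeUncurryFin_apply, LinearMap.sum_apply]
  rfl

/-- The contraction `Hom(H, ⋀ H) → ⋀ H`. -/
def tr (n : ℕ) : (H n →ₗ[ℚ] Ext n) →ₗ[ℚ] Ext n :=
  ∑ j : Fin n, (CliffordAlgebra.contractLeft (Q := (0 : QuadraticForm ℚ (H n)))
    (LinearMap.proj j)) ∘ₗ LinearMap.applyₗ (Pi.single j 1 : H n)

theorem tr_apply {n : ℕ} (A : H n →ₗ[ℚ] Ext n) :
    tr n A = ∑ j : Fin n, CliffordAlgebra.contractLeft (Q := (0 : QuadraticForm ℚ (H n)))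
      (LinearMap.proj j) (A (Pi.single j 1)) := by
  simp [tr, LinearMap.sum_apply]

/-- The map `⋀ H → Hom(H, ⋀ H)`, `w ↦ (h ↦ h ∧ w)`. -/
def insertLeft (n : ℕ) : Ext n →ₗ[ℚ] (H n →ₗ[ℚ] Ext n) :=
  ((LinearMap.mul ℚ (Ext n)) ∘ₗ ExteriorAlgebra.ι ℚ).flip

theorem insertLeft_apply {n : ℕ} (w : Ext n) (h : H n) :
    insertLeft n w h = ExteriorAlgebra.ι ℚ h * w := rfl

/-- The equivariant alternating maps `U^r → Hom(H, ⋀^{r+1} H)` obtained by iterated insertion,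
corrected by a multiple of the trace part at each step. -/
def multiInsertion (n : ℕ) : (r : ℕ) → U n [⋀^Fin r]→ₗ[ℚ] (H n →ₗ[ℚ] Ext n)
  | 0 => AlternatingMap.constOfIsEmpty ℚ _ _ (ExteriorAlgebra.ι ℚ)
  -- The constants are dictated by the weighted family below: there the insertion sum has
  -- coefficient `(r + 2)∏ - S` and trace `(r + 1)(n + 1)S`, so the trace term cancels `-S` and the
  -- division by `r + 2` leaves the bare product.
  | r + 1 => (1 / ((r : ℚ) + 2)) •
      (LinearMap.id + (1 / (((r : ℚ) + 1) * (n + 1))) • (insertLeft n ∘ₗ tr n)).compAlternatingMap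
        (insertionSum (multiInsertion n r))

theorem multiInsertion_zero (n : ℕ) (v : Fin 0 → U n) :
    multiInsertion n 0 v = ExteriorAlgebra.ι ℚ := rfl

theorem multiInsertion_succ (n r : ℕ) (v : Fin (r + 1) → U n) (h : H n) :
    multiInsertion n (r + 1) v h = (1 / ((r : ℚ) + 2)) •
      (insertionSum (multiInsertion n r) v h + (1 / (((r : ℚ) + 1) * (n + 1))) •
        (ExteriorAlgebra.ι ℚ h * tr n (insertionSum (multiInsertion n r) v))) := rfl

/-! ### Equivariance -/

/-- Contraction is determined by its antiderivation rule, and g is multiplicative on the exterior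
algebra, so naturality reduces to `d (g m) = (d ∘ g) m` on vectors. -/
theorem extAct_contractLeft {n : ℕ} (g : GL (Fin n) ℚ) (d : Module.Dual ℚ (H n)) (x : Ext n) :
    CliffordAlgebra.contractLeft d (extAct n g x) =
      extAct n g (CliffordAlgebra.contractLeft (d ∘ₗ stdRep n g) x) := by
  induction x using CliffordAlgebra.left_induction with
  | algebraMap r =>
    rw [CliffordAlgebra.contractLeft_algebraMap, map_zero]
    exact (congrArg _ ((extAct n g).commutes r)).trans
      (CliffordAlgebra.contractLeft_algebraMap (Q := (0 : QuadraticForm ℚ (H n))) d r)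
  | add x y hx hy => simp only [map_add, hx, hy]
  | ι_mul x m hx =>
    have h : extAct n g (CliffordAlgebra.ι 0 m) = CliffordAlgebra.ι 0 (stdRep n g m) :=
      extAct_ι n g m
    rw [map_mul, h, CliffordAlgebra.contractLeft_ι_mul, CliffordAlgebra.contractLeft_ι_mul, hx,
      map_sub, map_smul, map_mul, h]
    rfl

/-- The element `∑ e_j ⊗ e_j^*` corresponds to the identity of H and is therefore invariant. This is
what makes the trace, written in a basis, equivariant. -/
theorem sum_bilinear_conj {n : ℕ} {W : Type*} [AddCommGroup W] [Module ℚ W]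
    (β : H n →ₗ[ℚ] Module.Dual ℚ (H n) →ₗ[ℚ] W) (g : GL (Fin n) ℚ) :
    ∑ j : Fin n, β (stdRep n g⁻¹ (Pi.single j 1)) (LinearMap.proj j ∘ₗ stdRep n g) =
      ∑ j : Fin n, β (Pi.single j 1) (LinearMap.proj j) := by
  have h1 : ∀ (g : GL (Fin n) ℚ) (j : Fin n), stdRep n g (Pi.single j 1) =
      ∑ k, g.1 k j • (Pi.single k 1 : H n) := by
    intro g j
    ext l
    simp [stdRep, Finset.sum_apply, Pi.single_apply]
  have h2 : ∀ j : Fin n, (LinearMap.proj j ∘ₗ stdRep n g : Module.Dual ℚ (H n)) =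
      ∑ l, g.1 j l • (LinearMap.proj l : Module.Dual ℚ (H n)) := by
    intro j
    ext l
    simp [stdRep, Pi.single_apply]
  simp only [h1, h2, map_sum, LinearMap.sum_apply, map_smul, LinearMap.smul_apply]
  have h3 : ∀ k l : Fin n, ∑ j, (g⁻¹).1 k j * g.1 j l = if k = l then 1 else 0 := by
    intro k l
    rw [← Matrix.mul_apply, ← Units.val_mul, inv_mul_cancel, Units.val_one, Matrix.one_apply]
  calc _ = ∑ k, ∑ l, (∑ j, (g⁻¹).1 k j * g.1 j l) •
        β (Pi.single k 1) (LinearMap.proj l : Module.Dual ℚ (H n)) := by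
        simp only [Finset.sum_smul, Finset.smul_sum, mul_smul]
        rw [Finset.sum_comm]
        rw [Finset.sum_congr rfl fun l _ => Finset.sum_comm]
        rw [Finset.sum_comm]
        refine Finset.sum_congr rfl fun k _ => Finset.sum_congr rfl fun l _ =>
          Finset.sum_congr rfl fun j _ => ?_
        rw [smul_comm]
    _ = _ := by simp only [h3, ite_smul, one_smul, zero_smul, Finset.sum_ite_eq,
        Finset.mem_univ, if_true]

/-- The action of `GL(n, ℚ)` on `Hom(H, ⋀ H)`. -/
def homExtAct (n : ℕ) (g : GL (Fin n) ℚ) (A : H n →ₗ[ℚ] Ext n) : H n →ₗ[ℚ] Ext n :=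
  (extAct n g).toLinearMap ∘ₗ A ∘ₗ stdRep n g⁻¹

theorem homExtAct_apply {n : ℕ} (g : GL (Fin n) ℚ) (A : H n →ₗ[ℚ] Ext n) (h : H n) :
    homExtAct n g A h = extAct n g (A (stdRep n g⁻¹ h)) := rfl

theorem tr_homExtAct {n : ℕ} (g : GL (Fin n) ℚ) (A : H n →ₗ[ℚ] Ext n) :
    tr n (homExtAct n g A) = extAct n g (tr n A) := by
  rw [tr_apply, tr_apply, map_sum]
  simp only [homExtAct_apply, extAct_contractLeft]
  exact sum_bilinear_conj (LinearMap.mk₂ ℚ (fun h d => extAct n g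
    (CliffordAlgebra.contractLeft (Q := (0 : QuadraticForm ℚ (H n))) d (A h)))
    (by intros; simp) (by intros; simp) (by intros; simp) (by intros; simp)) g

theorem deriv_homExtAct {n : ℕ} (g : GL (Fin n) ℚ) (A : H n →ₗ[ℚ] Ext n) (w : ⋀[ℚ]^2 (H n)) :
    deriv n (homExtAct n g A) (extRep 2 (stdRep n) g w) = extAct n g (deriv n A w) := by
  have h : deriv n (homExtAct n g A) ∘ₗ extRep 2 (stdRep n) g =
      (extAct n g).toLinearMap ∘ₗ deriv n A := by
    refine ext_wedge fun a b => ?_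
    simp only [LinearMap.comp_apply, extRep_wedge, deriv_wedge, homExtAct_apply,
      Representation.inv_self_apply, AlgHom.toLinearMap_apply, map_sub, map_mul, extAct_ι]
  exact LinearMap.congr_fun h w

theorem URep_apply {n : ℕ} (g : GL (Fin n) ℚ) (u : U n) (h : H n) :
    URep n g u h = extRep 2 (stdRep n) g (u (stdRep n g⁻¹ h)) := rfl

theorem insertionSum_equivariant {n r : ℕ} {A : U n [⋀^Fin r]→ₗ[ℚ] (H n →ₗ[ℚ] Ext n)}
    (hA : ∀ g v, A (fun p => URep n g (v p)) = homExtAct n g (A v)) (g : GL (Fin n) ℚ)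
    (v : Fin (r + 1) → U n) :
    insertionSum A (fun p => URep n g (v p)) = homExtAct n g (insertionSum A v) := by
  refine LinearMap.ext fun h => ?_
  rw [homExtAct_apply, insertionSum_apply, insertionSum_apply, map_sum]
  refine Finset.sum_congr rfl fun p _ => ?_
  have e : p.removeNth (fun p => URep n g (v p)) = fun q => URep n g (p.removeNth v q) := rfl
  rw [e, hA, URep_apply, deriv_homExtAct, map_zsmul]

theorem multiInsertion_equivariant {n : ℕ} (r : ℕ) (g : GL (Fin n) ℚ) (v : Fin r → U n) :
    multiInsertion n r (fun p => URep n g (v p)) = homExtAct n g (multiInsertion n r v) := by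
  induction r generalizing g with
  | zero =>
    refine LinearMap.ext fun h => ?_
    rw [homExtAct_apply, multiInsertion_zero, multiInsertion_zero, extAct_ι,
      Representation.self_inv_apply]
  | succ r ih =>
    refine LinearMap.ext fun h => ?_
    rw [homExtAct_apply, multiInsertion_succ, multiInsertion_succ,
      insertionSum_equivariant ih, tr_homExtAct, homExtAct_apply]
    simp only [map_smul, map_add, map_mul, extAct_ι, Representation.self_inv_apply]

end AlbaneseIO

end

noncomputable section

open scoped TensorProduct CategoryTheory

namespace AlbaneseIO

/-! ### Evaluation on a special family -/

/-- The weights `a_{kj}`: `n - 1 - k` for `j < k` and `-k` otherwise. -/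
def weight {n : ℕ} (k j : Fin n) : ℚ := if j < k then (n : ℚ) - 1 - (k : ℕ) else -((k : ℕ) : ℚ)

theorem weight_of_lt {n : ℕ} {k j : Fin n} (h : j < k) : weight k j = (n : ℚ) - 1 - (k : ℕ) :=
  if_pos h

theorem weight_of_le {n : ℕ} {k j : Fin n} (h : k ≤ j) : weight k j = -((k : ℕ) : ℚ) :=
  if_neg (not_lt.2 h)

/-- The combinatorial heart of the evaluation: one constant S measures both the failure of the
insertion sum to be a pure product and the sum of the products off K. Because the same S occurs
twice, a single trace correction can remove it. The induction adds a new maximum m: then `weight m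
k` is the same for all `k ∈ K`, and `∏_{k ∈ K} weight k j` is the same for all `j ≥ m`. -/
theorem exists_weight_identity {n : ℕ} (K : Finset (Fin n)) :
    ∃ S : ℚ, (∀ j ∉ K, ∑ k ∈ K, weight k j * ∏ l ∈ K.erase k, weight l k =
      ∏ k ∈ K, weight k j - S) ∧ ∑ j ∈ Kᶜ, ∏ k ∈ K, weight k j = n * S := by
  induction K using Finset.induction_on_max with
  | empty => exact ⟨1, by simp, by simp⟩
  | insert m K hK ih =>
    obtain ⟨S, hS1, hS2⟩ := ih
    have hm : m ∉ K := fun h => lt_irrefl _ (hK m h)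
    set e : ℚ := ∏ k ∈ K, -((k : ℕ) : ℚ) with he
    have hP : ∀ j, m ≤ j → ∏ k ∈ K, weight k j = e := fun j hj =>
      Finset.prod_congr rfl fun k hk => weight_of_le ((hK k hk).le.trans hj)
    -- Here e is the constant value of the old product at all `j ≥ m`. The new term `k = m`
    -- contributes `weight m j * e`, and each old term is multiplied by `n - 1 - m`; comparison with
    -- the new product forces this constant.
    refine ⟨((n : ℚ) - 1 - (m : ℕ)) * (S - e), fun j hj => ?_, ?_⟩
    · rw [Finset.mem_insert, not_or] at hj
      rw [Finset.sum_insert hm, Finset.erase_insert hm, hP m le_rfl, Finset.prod_insert hm]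
      have h1 : ∑ k ∈ K, weight k j * ∏ l ∈ (insert m K).erase k, weight l k =
          ((n : ℚ) - 1 - (m : ℕ)) * ∑ k ∈ K, weight k j * ∏ l ∈ K.erase k, weight l k := by
        rw [Finset.mul_sum]
        refine Finset.sum_congr rfl fun k hk => ?_
        rw [Finset.erase_insert_of_ne (hK k hk).ne',
          Finset.prod_insert (fun h => hm (Finset.mem_of_mem_erase h)), weight_of_lt (hK k hk)]
        ring
      rw [h1, hS1 j hj.2]
      rcases lt_or_gt_of_ne hj.1 with h | h
      · rw [weight_of_lt h]; ring
      · rw [weight_of_le h.le, hP j h.le]; ring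
    · have hK1 : Kᶜ = Kᶜ.filter (· < m) ∪ insert m (Finset.Ioi m) := by
        ext j
        simp only [Finset.mem_compl, Finset.mem_union, Finset.mem_filter, Finset.mem_insert,
          Finset.mem_Ioi]
        have := fun h => hK j h
        rcases lt_trichotomy j m with h | h | h
        · simp [h, h.ne, h.not_gt]
        · simp [h, hm]
        · have hj : j ∉ K := fun h' => (this h').not_gt h
          simp [h, hj]
      have hK2 : (insert m K)ᶜ = Kᶜ.filter (· < m) ∪ Finset.Ioi m := by
        ext j
        simp only [Finset.mem_compl, Finset.mem_union, Finset.mem_filter, Finset.mem_insert,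
          Finset.mem_Ioi, not_or]
        have := fun h => hK j h
        rcases lt_trichotomy j m with h | h | h
        · simp [h, h.ne, h.not_gt]
        · simp [h]
        · have hj : j ∉ K := fun h' => (this h').not_gt h
          simp [h, h.ne', hj]
      have hd1 : Disjoint (Kᶜ.filter (· < m)) (insert m (Finset.Ioi m)) := by
        rw [Finset.disjoint_left]
        intro j hj hj'
        simp only [Finset.mem_filter, Finset.mem_insert, Finset.mem_Ioi] at hj hj'
        rcases hj' with h | h
        · exact hj.2.ne h
        · exact hj.2.not_gt h
      have hd2 : Disjoint (Kᶜ.filter (· < m)) (Finset.Ioi m) :=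
        hd1.mono_right (Finset.subset_insert _ _)
      have hcard : ((Finset.Ioi m).card : ℚ) = (n : ℚ) - 1 - (m : ℕ) := by
        rw [Fin.card_Ioi]
        have := m.2
        rw [Nat.sub_sub, Nat.cast_sub (by omega)]
        push_cast; ring
      have hI : ∑ j ∈ Finset.Ioi m, ∏ k ∈ K, weight k j = ((n : ℚ) - 1 - (m : ℕ)) * e := by
        rw [Finset.sum_congr rfl fun j hj => hP j (Finset.mem_Ioi.1 hj).le, Finset.sum_const,
          nsmul_eq_mul, hcard]
      rw [hK1, Finset.sum_union hd1, Finset.sum_insert (by simp), hP m le_rfl, hI] at hS2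
      rw [hK2, Finset.sum_union hd2]
      have h1 : ∑ j ∈ Kᶜ.filter (· < m), ∏ k ∈ insert m K, weight k j =
          ((n : ℚ) - 1 - (m : ℕ)) * ∑ j ∈ Kᶜ.filter (· < m), ∏ k ∈ K, weight k j := by
        rw [Finset.mul_sum]
        refine Finset.sum_congr rfl fun j hj => ?_
        rw [Finset.prod_insert hm, weight_of_lt (Finset.mem_filter.1 hj).2]
      have h2 : ∑ j ∈ Finset.Ioi m, ∏ k ∈ insert m K, weight k j =
          -((m : ℕ) : ℚ) * (((n : ℚ) - 1 - (m : ℕ)) * e) := by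
        rw [← hI, Finset.mul_sum]
        refine Finset.sum_congr rfl fun j hj => ?_
        rw [Finset.prod_insert hm, weight_of_le (Finset.mem_Ioi.1 hj).le]
      rw [h1, h2]
      linear_combination ((n : ℚ) - 1 - (m : ℕ)) * hS2

/-! ### Monomials, their contractions and diagonal maps -/

/-- The monomial `e_{κ 0} ∧ ⋯ ∧ e_{κ (r-1)}` in the exterior algebra. -/
def mono {n r : ℕ} (κ : Fin r → Fin n) : Ext n :=
  ExteriorAlgebra.ιMulti ℚ r fun q => Pi.single (κ q) 1

/-- The basis vector `e_j` in the exterior algebra. -/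
def gen {n : ℕ} (j : Fin n) : Ext n := ExteriorAlgebra.ι ℚ (Pi.single j 1 : H n)

theorem gen_mul_gen {n : ℕ} (j k : Fin n) : gen j * gen k = -(gen k * gen j) :=
  eq_neg_of_add_eq_zero_left (ExteriorAlgebra.ι_add_mul_swap _ _)

theorem gen_mul_mono {n r : ℕ} (j : Fin n) (κ : Fin r → Fin n) :
    gen j * mono κ = mono (Fin.cons j κ : Fin (r + 1) → Fin n) := by
  simp only [mono, gen, ExteriorAlgebra.ιMulti_succ_apply]
  rfl

theorem mono_eq_zero {n r : ℕ} {κ : Fin r → Fin n} (h : ¬ Function.Injective κ) : mono κ = 0 :=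
  ExteriorAlgebra.ιMulti_eq_zero_of_not_inj fun h' => h fun a b hab => h' (by simp only [hab])

theorem gen_mul_mono_of_mem {n r : ℕ} {j : Fin n} {κ : Fin r → Fin n} (h : j ∈ Set.range κ) :
    gen j * mono κ = 0 := by
  rw [gen_mul_mono]
  refine mono_eq_zero fun h' => ?_
  obtain ⟨q, hq⟩ := h
  have := @h' 0 q.succ (by simpa using hq.symm)
  exact absurd this (Fin.succ_ne_zero q).symm

theorem gen_mul_mono_removeNth {n r : ℕ} (κ : Fin (r + 1) → Fin n) (p : Fin (r + 1)) :
    gen (κ p) * mono (p.removeNth κ) = (-1 : ℤ) ^ (p : ℕ) • mono κ := by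
  have h := AlternatingMap.neg_one_pow_smul_map_insertNth
    (ExteriorAlgebra.ιMulti ℚ (r + 1) (M := H n)) p (Pi.single (κ p) 1)
    (fun q => Pi.single (p.removeNth κ q) 1)
  have e : (p.insertNth (Pi.single (κ p) 1 : H n) (fun q => Pi.single (p.removeNth κ q) 1)) =
      fun q => (Pi.single (κ q) 1 : H n) := by
    exact Fin.insertNth_eq_iff.2 ⟨rfl, rfl⟩
  rw [e] at h
  rw [gen_mul_mono]
  refine Eq.trans ?_ h.symm
  rw [mono]
  congr 1
  funext q
  refine Fin.cases ?_ (fun q => ?_) q <;> rfl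

theorem contract_mono {n r : ℕ} {j : Fin n} {κ : Fin r → Fin n} (h : j ∉ Set.range κ) :
    CliffordAlgebra.contractLeft (Q := (0 : QuadraticForm ℚ (H n)))
      (LinearMap.proj j) (mono κ) = 0 := by
  induction r with
  | zero =>
    rw [mono, ExteriorAlgebra.ιMulti_zero_apply]
    exact CliffordAlgebra.contractLeft_one (Q := (0 : QuadraticForm ℚ (H n))) (LinearMap.proj j)
  | succ r ih =>
    have e : mono κ = gen (κ 0) * mono (fun q => κ q.succ) := by
      rw [gen_mul_mono]; congr 1; funext q; refine Fin.cases ?_ (fun q => ?_) q <;> rfl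
    rw [e]
    refine (CliffordAlgebra.contractLeft_ι_mul (Q := (0 : QuadraticForm ℚ (H n)))
      (LinearMap.proj j) (Pi.single (κ 0) 1) (mono fun q => κ q.succ)).trans ?_
    rw [ih (fun ⟨q, hq⟩ => h ⟨q.succ, hq⟩), mul_zero, sub_zero]
    have : (Pi.single (κ 0) 1 : H n) j = 0 := Pi.single_eq_of_ne (fun hj => h ⟨0, hj.symm⟩) _
    rw [LinearMap.proj_apply, this, zero_smul]

theorem contract_gen_mul_mono {n r : ℕ} {j : Fin n} {κ : Fin r → Fin n} (h : j ∉ Set.range κ) :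
    CliffordAlgebra.contractLeft (Q := (0 : QuadraticForm ℚ (H n)))
      (LinearMap.proj j) (gen j * mono κ) = mono κ := by
  refine (CliffordAlgebra.contractLeft_ι_mul (Q := (0 : QuadraticForm ℚ (H n))) _ _ _).trans ?_
  rw [contract_mono h, mul_zero, sub_zero, LinearMap.proj_apply, Pi.single_eq_same, one_smul]

/-- For `j` in the image of κ the value vanishes because `e_j` is repeated; for the other j
contracting `e_j` off the front returns the monomial. -/
theorem tr_eq_of_diagonal {n r : ℕ} {κ : Fin r → Fin n} {A : H n →ₗ[ℚ] Ext n} {c : Fin n → ℚ}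
    (hA : ∀ j, A (Pi.single j 1) = c j • (gen j * mono κ)) :
    tr n A = (∑ j ∈ (Finset.univ.image κ)ᶜ, c j) • mono κ := by
  rw [tr_apply, ← Finset.sum_compl_add_sum (Finset.univ.image κ), Finset.sum_smul,
    Finset.sum_eq_zero (s := Finset.univ.image κ), add_zero]
  · refine Finset.sum_congr rfl fun j hj => ?_
    rw [hA, map_smul, contract_gen_mul_mono (by simpa using hj)]
  · intro j hj
    rw [hA, gen_mul_mono_of_mem (by simpa using hj), smul_zero, map_zero]

/-- The element of `U` with `e_j ↦ a_{kj} e_j ∧ e_k`. -/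
def weightedWedge {n : ℕ} (k : Fin n) : U n :=
  (Pi.basisFun ℚ (Fin n)).constr ℚ fun j =>
    weight k j • wedge n (Pi.single j 1) (Pi.single k 1)

theorem weightedWedge_single {n : ℕ} (k j : Fin n) :
    weightedWedge k (Pi.single j 1) = weight k j • wedge n (Pi.single j 1) (Pi.single k 1) := by
  rw [weightedWedge, ← Pi.basisFun_apply ℚ (Fin n) j, Module.Basis.constr_basis,
    Pi.basisFun_apply ℚ (Fin n) j]

/-- Diagonal maps stay diagonal under insertion. The two terms of `deriv` on `e_j ∧ e_{κ p}` add up,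
since exchanging `e_j` and `e_{κ p}` costs a sign, and moving `e_{κ p}` back to position p costs
`(-1)^p`, which cancels the sign of the alternating sum. -/
theorem insertionSum_weightedWedge {n r : ℕ} {A : U n [⋀^Fin r]→ₗ[ℚ] (H n →ₗ[ℚ] Ext n)}
    {c : (Fin r → Fin n) → Fin n → ℚ}
    (hA : ∀ (κ : Fin r → Fin n) j, A (fun q => weightedWedge (κ q)) (Pi.single j 1) =
      c κ j • (gen j * mono κ)) (κ : Fin (r + 1) → Fin n) (j : Fin n) :
    insertionSum A (fun q => weightedWedge (κ q)) (Pi.single j 1) =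
      (∑ p, weight (κ p) j * (c (p.removeNth κ) j + c (p.removeNth κ) (κ p))) •
        (gen j * mono κ) := by
  rw [insertionSum_apply, Finset.sum_smul]
  refine Finset.sum_congr rfl fun p _ => ?_
  have e : p.removeNth (fun q => weightedWedge (κ q)) =
    fun q => (weightedWedge (p.removeNth κ q)) := rfl
  rw [weightedWedge_single, map_smul, deriv_wedge, e, hA, hA]
  change _ • weight (κ p) j • (gen j * c (p.removeNth κ) (κ p) • (gen (κ p) * mono (p.removeNth κ)) -
    gen (κ p) * c (p.removeNth κ) j • (gen j * mono (p.removeNth κ))) = _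
  rw [mul_smul_comm, mul_smul_comm, ← mul_assoc (gen (κ p)), gen_mul_gen (κ p) j, neg_mul,
    mul_assoc, gen_mul_mono_removeNth, mul_smul_comm]
  have h1 : (-1 : ℤ) ^ (p : ℕ) * (-1 : ℤ) ^ (p : ℕ) = 1 := by rw [← mul_pow]; simp
  have h2 : ∀ (x : Ext n), (-1 : ℤ) ^ (p : ℕ) • (-1 : ℤ) ^ (p : ℕ) • x = x := fun x => by
    rw [smul_smul, h1, one_smul]
  rw [smul_neg, sub_neg_eq_add, ← add_smul, smul_comm ((-1 : ℤ) ^ (p : ℕ)) (weight (κ p) j),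
    smul_comm ((-1 : ℤ) ^ (p : ℕ)) (_ + _ : ℚ), h2, smul_smul, add_comm]

/-- The induction hypothesis turns the coefficient of the insertion sum into the left side of the
weight identity plus `r + 1` copies of the full product. The trace correction then removes the
constant S. -/
theorem multiInsertion_weightedWedge {n r : ℕ} (κ : Fin r → Fin n) (j : Fin n) :
    multiInsertion n r (fun q => weightedWedge (κ q)) (Pi.single j 1) =
      (∏ q, weight (κ q) j) • (gen j * mono κ) := by
  induction r generalizing j with
  | zero =>
    rw [multiInsertion_zero, Finset.univ_eq_empty, Finset.prod_empty, one_smul, mono,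
      ExteriorAlgebra.ιMulti_zero_apply, mul_one]
    rfl
  | succ r ih =>
    by_cases hκ : Function.Injective κ
    · have hB := insertionSum_weightedWedge ih κ
      by_cases hj : j ∈ Set.range κ
      · rw [multiInsertion_succ, hB, tr_eq_of_diagonal hB, mul_smul_comm]
        change _ • (_ + _ • _ • (gen j * mono κ)) = _
        rw [gen_mul_mono_of_mem hj]
        simp only [smul_zero, add_zero]
      · obtain ⟨S, hS1, hS2⟩ := exists_weight_identity (Finset.univ.image κ)
        have himg : ∀ p : Fin (r + 1), (Finset.univ.image κ).erase (κ p) =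
            Finset.univ.image (fun q => κ (p.succAbove q)) := by
          intro p
          ext k
          simp only [Finset.mem_erase, Finset.mem_image, Finset.mem_univ, true_and]
          constructor
          · rintro ⟨h1, q, rfl⟩
            obtain ⟨q', rfl⟩ := Fin.exists_succAbove_eq (fun h : q = p => h1 (by rw [h]))
            exact ⟨q', rfl⟩
          · rintro ⟨q, rfl⟩
            exact ⟨fun h => Fin.succAbove_ne p q (hκ h), _, rfl⟩
        have hprod : ∀ j, ∏ k ∈ Finset.univ.image κ, weight k j = ∏ q, weight (κ q) j :=
          fun j => Finset.prod_image hκ.injOn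
        have hprod' : ∀ (p : Fin (r + 1)) j, ∏ k ∈ (Finset.univ.image κ).erase (κ p), weight k j =
            ∏ q, weight (p.removeNth κ q) j := fun p j => by
          rw [himg]
          exact Finset.prod_image (hκ.comp Fin.succAbove_right_injective).injOn
        -- The first summands give `r + 1` equal products; the second ones give one more product
        -- minus S.
        have hsum : ∀ j ∉ Set.range κ, ∑ p, weight (κ p) j *
            (∏ q, weight (p.removeNth κ q) j + ∏ q, weight (p.removeNth κ q) (κ p)) =
            ((r : ℚ) + 2) * ∏ q, weight (κ q) j - S := by
          intro j hj
          have h1 := hS1 j (by simpa using hj)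
          rw [Finset.sum_image hκ.injOn, hprod] at h1
          simp only [hprod'] at h1
          simp only [mul_add, Finset.sum_add_distrib, h1]
          have h2 : ∀ p, weight (κ p) j * ∏ q, weight (p.removeNth κ q) j =
              ∏ q, weight (κ q) j := fun p =>
            (Fin.prod_univ_succAbove (fun q => weight (κ q) j) p).symm
          simp only [h2, Finset.sum_const, Finset.card_univ, Fintype.card_fin, nsmul_eq_mul]
          push_cast; ring
        have hcard : (((Finset.univ.image κ)ᶜ.card : ℕ) : ℚ) = n - (r + 1) := by
          rw [Finset.card_compl, Finset.card_image_of_injective _ hκ, Fintype.card_fin,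
            Finset.card_univ, Fintype.card_fin, Nat.cast_sub]
          · push_cast; ring
          · simpa using Fintype.card_le_of_injective κ hκ
        -- Summing over the `n - (r + 1)` indices outside κ gives `(r + 2) n S - (n - r - 1) S = (r
        -- + 1)(n + 1) S`.
        have htr := tr_eq_of_diagonal hB
        rw [Finset.sum_congr rfl fun j hj => hsum j (by simpa using hj), Finset.sum_sub_distrib,
          ← Finset.mul_sum, Finset.sum_const, nsmul_eq_mul, hcard,
          ← Finset.sum_congr rfl fun j _ => hprod j, hS2] at htr
        rw [multiInsertion_succ, hB, htr, mul_smul_comm, hsum j hj]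
        change _ • (_ + _ • _ • (gen j * mono κ)) = _
        rw [smul_smul, ← add_smul, smul_smul]
        congr 1
        have h1 : (r : ℚ) + 2 ≠ 0 := by positivity
        have h2 : (r : ℚ) + 1 ≠ 0 := by positivity
        have h3 : (n : ℚ) + 1 ≠ 0 := by positivity
        field_simp
        ring
    · rw [mono_eq_zero hκ, mul_zero, smul_zero]
      have h := (multiInsertion n (r + 1)).map_eq_zero_of_not_injective
        (fun q => weightedWedge (κ q)) (fun h => hκ fun a b hab => h (by simp only [hab]))
      rw [h, LinearMap.zero_apply]

/-! ### Degrees -/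

theorem deriv_mem {n r : ℕ} {A : H n →ₗ[ℚ] Ext n} (hA : ∀ h, A h ∈ ⋀[ℚ]^r (H n))
    (w : ⋀[ℚ]^2 (H n)) : deriv n A w ∈ ⋀[ℚ]^(r + 1) (H n) := by
  have h : (deriv n A).range ≤ ⋀[ℚ]^(r + 1) (H n) := by
    rw [← Submodule.map_top, ← exteriorPower.ιMulti_span, Submodule.map_span_le]
    rintro _ ⟨v, rfl⟩
    have e : v = ![v 0, v 1] := by ext k; fin_cases k <;> rfl
    rw [e]
    change deriv n A (wedge n (v 0) (v 1)) ∈ _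
    rw [deriv_wedge]
    have h1 : ∀ a b, ExteriorAlgebra.ι ℚ a * A b ∈ ⋀[ℚ]^(r + 1) (H n) := fun a b => by
      rw [ExteriorAlgebra.exteriorPower, pow_succ']
      exact Submodule.mul_mem_mul ⟨a, rfl⟩ (hA b)
    exact Submodule.sub_mem _ (h1 _ _) (h1 _ _)
  exact h ⟨w, rfl⟩

theorem contract_mem {n r : ℕ} (d : Module.Dual ℚ (H n)) {x : Ext n}
    (hx : x ∈ ⋀[ℚ]^(r + 1) (H n)) :
    CliffordAlgebra.contractLeft (Q := (0 : QuadraticForm ℚ (H n))) d x ∈ ⋀[ℚ]^r (H n) := by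
  induction r generalizing x with
  | zero =>
    rw [ExteriorAlgebra.exteriorPower, zero_add, pow_one] at hx
    obtain ⟨a, rfl⟩ := hx
    rw [ExteriorAlgebra.exteriorPower, pow_zero, Submodule.mem_one]
    exact ⟨d a, (CliffordAlgebra.contractLeft_ι (Q := (0 : QuadraticForm ℚ (H n))) d a).symm⟩
  | succ r ih =>
    rw [ExteriorAlgebra.exteriorPower, pow_succ'] at hx
    induction hx using Submodule.mul_induction_on' with
    | mem_mul_mem a ha y hy =>
      obtain ⟨a, rfl⟩ := ha
      have h := CliffordAlgebra.contractLeft_ι_mul (Q := (0 : QuadraticForm ℚ (H n))) d a y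
      refine h.symm ▸ Submodule.sub_mem _ (Submodule.smul_mem _ _ hy) ?_
      rw [ExteriorAlgebra.exteriorPower, pow_succ']
      exact Submodule.mul_mem_mul ⟨a, rfl⟩ (ih hy)
    | add x _ y _ hx hy => rw [map_add]; exact Submodule.add_mem _ hx hy

theorem tr_mem {n r : ℕ} {A : H n →ₗ[ℚ] Ext n} (hA : ∀ h, A h ∈ ⋀[ℚ]^(r + 1) (H n)) :
    tr n A ∈ ⋀[ℚ]^r (H n) := by
  rw [tr_apply]
  exact Submodule.sum_mem _ fun j _ => contract_mem _ (hA _)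

theorem multiInsertion_mem {n r : ℕ} (v : Fin r → U n) (h : H n) :
    multiInsertion n r v h ∈ ⋀[ℚ]^(r + 1) (H n) := by
  induction r generalizing h with
  | zero =>
    rw [multiInsertion_zero, ExteriorAlgebra.exteriorPower, zero_add, pow_one]
    exact ⟨h, rfl⟩
  | succ r ih =>
    have hB : ∀ h, insertionSum (multiInsertion n r) v h ∈ ⋀[ℚ]^(r + 1 + 1) (H n) := fun h => by
      rw [insertionSum_apply]
      exact Submodule.sum_mem _ fun p _ => zsmul_mem (deriv_mem (fun h => ih _ h) _) _
    rw [multiInsertion_succ]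
    refine Submodule.smul_mem _ _ (Submodule.add_mem _ (hB h) (Submodule.smul_mem _ _ ?_))
    rw [ExteriorAlgebra.exteriorPower, pow_succ']
    exact Submodule.mul_mem_mul ⟨h, rfl⟩ (tr_mem hB)

end AlbaneseIO

end

noncomputable section

open scoped TensorProduct CategoryTheory

namespace AlbaneseIO

/-! ### Exterior powers inside the exterior algebra -/

theorem extRep_ιMulti {G V : Type*} [Group G] [AddCommGroup V] [Module ℚ V] {i : ℕ}
    (ρ : Representation ℚ G V) (g : G) (v : Fin i → V) :
    extRep i ρ g (exteriorPower.ιMulti ℚ i v) = exteriorPower.ιMulti ℚ i fun q => ρ g (v q) :=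
  exteriorPower.map_apply_ιMulti _ _

theorem coe_extRep {n r : ℕ} (g : GL (Fin n) ℚ) (x : ⋀[ℚ]^r (H n)) :
    (extRep r (stdRep n) g x : Ext n) = extAct n g x := by
  have h : (⋀[ℚ]^r (H n)).subtype ∘ₗ extRep r (stdRep n) g =
      (extAct n g).toLinearMap ∘ₗ (⋀[ℚ]^r (H n)).subtype := by
    refine exteriorPower.linearMap_ext (AlternatingMap.ext fun v => ?_)
    change ((exteriorPower.map r (stdRep n g) (exteriorPower.ιMulti ℚ r v) : ⋀[ℚ]^r (H n)) : Ext n) =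
      ExteriorAlgebra.map (stdRep n g) (ExteriorAlgebra.ιMulti ℚ r v)
    rw [exteriorPower.map_apply_ιMulti, ExteriorAlgebra.map_apply_ιMulti]
    rfl
  exact LinearMap.congr_fun h x

/-- A linear retraction of the exterior algebra onto an exterior power. -/
def extProj (n r : ℕ) : Ext n →ₗ[ℚ] ⋀[ℚ]^r (H n) :=
  ((⋀[ℚ]^r (H n)).subtype.exists_leftInverse_of_injective (Submodule.ker_subtype _)).choose

/-- The retraction is an arbitrary one and need not be equivariant; it is harmless because only its
values on the exterior power itself matter. -/
theorem coe_extProj {n r : ℕ} {x : Ext n} (hx : x ∈ ⋀[ℚ]^r (H n)) :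
    (extProj n r x : Ext n) = x :=
  congrArg Subtype.val (LinearMap.congr_fun
    ((⋀[ℚ]^r (H n)).subtype.exists_leftInverse_of_injective
      (Submodule.ker_subtype _)).choose_spec ⟨x, hx⟩)

/-- The inclusion `Hom(H, ⋀^r H) → Hom(H, ⋀ H)`. -/
def homIncl (n r : ℕ) : (H n →ₗ[ℚ] ⋀[ℚ]^r (H n)) →ₗ[ℚ] (H n →ₗ[ℚ] Ext n) :=
  LinearMap.compRight ℚ (⋀[ℚ]^r (H n)).subtype

theorem homIncl_apply {n r : ℕ} (A : H n →ₗ[ℚ] ⋀[ℚ]^r (H n)) (h : H n) :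
    homIncl n r A h = A h := rfl

theorem homIncl_homExtHRep {n r : ℕ} (g : GL (Fin n) ℚ) (A : H n →ₗ[ℚ] ⋀[ℚ]^r (H n)) :
    homIncl n r (homExtHRep n r g A) = homExtAct n g (homIncl n r A) :=
  LinearMap.ext fun _ => coe_extRep g _

/-- The contraction `Hom(H, ⋀^{r+1} H) → ⋀^r H`. -/
def trExt (n r : ℕ) : (H n →ₗ[ℚ] ⋀[ℚ]^(r + 1) (H n)) →ₗ[ℚ] ⋀[ℚ]^r (H n) :=
  extProj n r ∘ₗ tr n ∘ₗ homIncl n (r + 1)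

theorem coe_trExt {n r : ℕ} (A : H n →ₗ[ℚ] ⋀[ℚ]^(r + 1) (H n)) :
    (trExt n r A : Ext n) = tr n (homIncl n (r + 1) A) :=
  coe_extProj (tr_mem fun h => (A h).2)

theorem trExt_equivariant {n r : ℕ} (g : GL (Fin n) ℚ) (A : H n →ₗ[ℚ] ⋀[ℚ]^(r + 1) (H n)) :
    trExt n r (homExtHRep n (r + 1) g A) = extHRep n r g (trExt n r A) := by
  apply Subtype.ext
  rw [coe_trExt, homIncl_homExtHRep, tr_homExtAct, extHRep, coe_extRep, coe_trExt]

/-- The map `⋀^r H → Hom(H, ⋀^{r+1} H)`, `w ↦ (h ↦ h ∧ w)`. -/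
def insExt (n r : ℕ) : ⋀[ℚ]^r (H n) →ₗ[ℚ] (H n →ₗ[ℚ] ⋀[ℚ]^(r + 1) (H n)) :=
  LinearMap.compRight ℚ (extProj n (r + 1)) ∘ₗ insertLeft n ∘ₗ (⋀[ℚ]^r (H n)).subtype

theorem ι_mul_mem {n r : ℕ} (h : H n) {w : Ext n} (hw : w ∈ ⋀[ℚ]^r (H n)) :
    ExteriorAlgebra.ι ℚ h * w ∈ ⋀[ℚ]^(r + 1) (H n) := by
  rw [ExteriorAlgebra.exteriorPower, pow_succ']
  exact Submodule.mul_mem_mul ⟨h, rfl⟩ hw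

theorem coe_insExt {n r : ℕ} (w : ⋀[ℚ]^r (H n)) (h : H n) :
    (insExt n r w h : Ext n) = ExteriorAlgebra.ι ℚ h * w :=
  coe_extProj (ι_mul_mem h w.2)

theorem insExt_equivariant {n r : ℕ} (g : GL (Fin n) ℚ) (w : ⋀[ℚ]^r (H n)) :
    insExt n r (extHRep n r g w) = homExtHRep n (r + 1) g (insExt n r w) := by
  refine LinearMap.ext fun h => Subtype.ext ?_
  have e : (homExtHRep n (r + 1) g (insExt n r w) h : Ext n) =
      extAct n g (insExt n r w (stdRep n g⁻¹ h)) := coe_extRep g _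
  rw [e, coe_insExt, coe_insExt, extHRep, coe_extRep, map_mul, extAct_ι,
    Representation.self_inv_apply]

/-- The operator `∑ e_j ∧ (e_j^* ⌟ ·)` counts degree: it is a derivation that is the identity on
vectors. -/
theorem sum_gen_mul_contract {n r : ℕ} {w : Ext n} (hw : w ∈ ⋀[ℚ]^r (H n)) :
    ∑ j : Fin n, gen j * CliffordAlgebra.contractLeft (Q := (0 : QuadraticForm ℚ (H n)))
      (LinearMap.proj j) w = (r : ℚ) • w := by
  induction r generalizing w with
  | zero =>
    rw [ExteriorAlgebra.exteriorPower, pow_zero, Submodule.mem_one] at hw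
    obtain ⟨c, rfl⟩ := hw
    rw [Nat.cast_zero, zero_smul]
    refine Finset.sum_eq_zero fun j _ => ?_
    exact (congrArg (gen j * ·) (CliffordAlgebra.contractLeft_algebraMap
      (Q := (0 : QuadraticForm ℚ (H n))) (LinearMap.proj j) c)).trans (mul_zero _)
  | succ r ih =>
    rw [ExteriorAlgebra.exteriorPower, pow_succ'] at hw
    induction hw using Submodule.mul_induction_on' with
    | mem_mul_mem a ha y hy =>
      obtain ⟨a, rfl⟩ := ha
      have h : ∀ j : Fin n, gen j * CliffordAlgebra.contractLeft
          (Q := (0 : QuadraticForm ℚ (H n))) (LinearMap.proj j) (ExteriorAlgebra.ι ℚ a * y) =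
          a j • (gen j * y) + ExteriorAlgebra.ι ℚ a * (gen j * CliffordAlgebra.contractLeft
            (Q := (0 : QuadraticForm ℚ (H n))) (LinearMap.proj j) y) := fun j => by
        refine (congrArg (gen j * ·) (CliffordAlgebra.contractLeft_ι_mul
          (Q := (0 : QuadraticForm ℚ (H n))) (LinearMap.proj j) a y)).trans ?_
        have h2 : gen j * ExteriorAlgebra.ι ℚ a = -(ExteriorAlgebra.ι ℚ a * gen j) :=
          eq_neg_of_add_eq_zero_left (ExteriorAlgebra.ι_add_mul_swap _ _)
        have h3 : gen j * (CliffordAlgebra.ι (0 : QuadraticForm ℚ (H n)) a *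
            CliffordAlgebra.contractLeft (LinearMap.proj j) y) =
            -(ExteriorAlgebra.ι ℚ a * (gen j * CliffordAlgebra.contractLeft
            (Q := (0 : QuadraticForm ℚ (H n))) (LinearMap.proj j) y)) := by
          rw [← mul_assoc, ← mul_assoc, ← neg_mul]
          exact congrArg (· * _) h2
        change gen j * (a j • y - _) = _
        rw [mul_sub, h3, mul_smul_comm, sub_neg_eq_add]
      have h4 : ∑ j, a j • (gen j : Ext n) = ExteriorAlgebra.ι ℚ a := by
        simp only [gen, ← map_smul, ← map_sum]
        congr 1
        ext l
        simp [Finset.sum_apply, Pi.single_apply]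
      rw [Finset.sum_congr rfl fun j _ => h j, Finset.sum_add_distrib, ← Finset.mul_sum, ih hy]
      simp only [← smul_mul_assoc]
      rw [← Finset.sum_mul, h4, mul_smul_comm, Nat.cast_succ, add_smul, one_smul, add_comm,
        add_mul, smul_mul_assoc]
    | add x _ y _ hx hy => simp only [map_add, mul_add, Finset.sum_add_distrib, hx, hy, smul_add]

/-- Contracting `e_j ∧ w` with `e_j^*` gives `w - e_j ∧ (e_j^* ⌟ w)`; summing over j gives `n` minus
the degree. -/
theorem trExt_insExt {n r : ℕ} (w : ⋀[ℚ]^r (H n)) :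
    trExt n r (insExt n r w) = ((n : ℚ) - r) • w := by
  apply Subtype.ext
  rw [coe_trExt, tr_apply]
  have h : ∀ j : Fin n, CliffordAlgebra.contractLeft (Q := (0 : QuadraticForm ℚ (H n)))
      (LinearMap.proj j) (homIncl n (r + 1) (insExt n r w) (Pi.single j 1)) =
      (w : Ext n) - gen j * CliffordAlgebra.contractLeft (Q := (0 : QuadraticForm ℚ (H n)))
      (LinearMap.proj j) (w : Ext n) := fun j => by
    rw [homIncl_apply, coe_insExt]
    refine (CliffordAlgebra.contractLeft_ι_mul (Q := (0 : QuadraticForm ℚ (H n)))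
      (LinearMap.proj j) _ _).trans ?_
    rw [LinearMap.proj_apply, Pi.single_eq_same, one_smul]
    rfl
  rw [Finset.sum_congr rfl fun j _ => h j, Finset.sum_sub_distrib, sum_gen_mul_contract w.2,
    Finset.sum_const, Finset.card_univ, Fintype.card_fin, Submodule.coe_smul, sub_smul,
    Nat.cast_smul_eq_nsmul ℚ n]

/-! ### The traceless section of `U → U^O` -/

/-- The trace `U → H`. -/
def trU (n : ℕ) : U n →ₗ[ℚ] H n := ExteriorAlgebra.ιInv ∘ₗ tr n ∘ₗ homIncl n 2

theorem trU_of_tr_eq {n : ℕ} {u : U n} {h : H n} (hu : tr n (homIncl n 2 u) = ExteriorAlgebra.ι ℚ h) :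
    trU n u = h :=
  (congrArg ExteriorAlgebra.ιInv hu).trans (ExteriorAlgebra.ι_leftInverse h)

theorem ι_trU {n : ℕ} (u : U n) : ExteriorAlgebra.ι ℚ (trU n u) = tr n (homIncl n 2 u) := by
  have h : tr n (homIncl n 2 u) ∈ ⋀[ℚ]^1 (H n) := tr_mem fun h => (u h).2
  rw [ExteriorAlgebra.exteriorPower, pow_one] at h
  obtain ⟨a, ha⟩ := h
  rw [trU_of_tr_eq ha.symm, ha]

theorem trU_equivariant {n : ℕ} (g : GL (Fin n) ℚ) (u : U n) :
    trU n (URep n g u) = stdRep n g (trU n u) := by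
  refine trU_of_tr_eq ?_
  rw [← extAct_ι, ι_trU, ← tr_homExtAct]
  exact congrArg (tr n) (homIncl_homExtHRep g u)

theorem coe_wedge {n : ℕ} (a b : H n) :
    (wedge n a b : Ext n) = ExteriorAlgebra.ι ℚ a * ExteriorAlgebra.ι ℚ b := by
  rw [wedge_apply, exteriorPower.ιMulti_apply_coe]
  simp

theorem wedge_eq_neg_insExt {n : ℕ} (a : H n) :
    homIncl n 2 (wedge n a) = - insertLeft n (ExteriorAlgebra.ι ℚ a) := by
  refine LinearMap.ext fun b => ?_
  rw [homIncl_apply, coe_wedge, LinearMap.neg_apply, insertLeft_apply]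
  exact eq_neg_of_add_eq_zero_left (ExteriorAlgebra.ι_add_mul_swap _ _)

/-- The case `r = 1` of `trExt_insExt`, with a sign because `wedge n a` puts a on the left whereas
`insertLeft` puts it on the right. -/
theorem trU_wedge {n : ℕ} (a : H n) : trU n (wedge n a) = (1 - (n : ℚ)) • a := by
  refine trU_of_tr_eq ?_
  have ha : ExteriorAlgebra.ι ℚ a ∈ ⋀[ℚ]^1 (H n) := by
    rw [ExteriorAlgebra.exteriorPower, pow_one]; exact ⟨a, rfl⟩
  have h := congrArg Subtype.val (trExt_insExt (r := 1) (⟨_, ha⟩ : ⋀[ℚ]^1 (H n)))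
  rw [coe_trExt] at h
  have e : homIncl n 2 (insExt n 1 ⟨_, ha⟩) = insertLeft n (ExteriorAlgebra.ι ℚ a) :=
    LinearMap.ext fun b => coe_insExt _ _
  rw [e] at h
  rw [wedge_eq_neg_insExt, map_neg, h, map_smul, Submodule.coe_smul, ← neg_smul]
  congr 1
  push_cast; ring

theorem URep_wedge {n : ℕ} (g : GL (Fin n) ℚ) (a : H n) :
    URep n g (wedge n a) = wedge n (stdRep n g a) := by
  refine LinearMap.ext fun b => ?_
  rw [URep_apply, extRep_wedge, Representation.self_inv_apply]

/-- The equivariant section of `U → U^O` with traceless values. -/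
def tracelessSection (n : ℕ) (hn : 2 ≤ n) : UO n →ₗ[ℚ] U n :=
  (LinearMap.range (wedge n)).liftQ
    -- Since the trace of `wedge n a` is `(1 - n) a`, this is the projection of U along the embedded
    -- copy of H onto the traceless part.
    (LinearMap.id + (1 / ((n : ℚ) - 1)) • (wedge n ∘ₗ trU n)) (by
    rintro _ ⟨a, rfl⟩
    have h : (n : ℚ) - 1 ≠ 0 := by
      have : (2 : ℚ) ≤ n := by exact_mod_cast hn
      linarith
    rw [LinearMap.mem_ker]
    change wedge n a + (1 / ((n : ℚ) - 1)) • wedge n (trU n (wedge n a)) = 0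
    rw [trU_wedge, map_smul, smul_smul]
    nth_rewrite 1 [← one_smul ℚ (wedge n a)]
    rw [← add_smul]
    have : 1 + 1 / ((n : ℚ) - 1) * (1 - n) = 0 := by field_simp; ring
    rw [this, zero_smul])

theorem tracelessSection_mk {n : ℕ} (hn : 2 ≤ n) (u : U n) :
    tracelessSection n hn (Submodule.Quotient.mk u) =
      u + (1 / ((n : ℚ) - 1)) • wedge n (trU n u) := rfl

theorem UORep_mk {n : ℕ} (g : GL (Fin n) ℚ) (u : U n) :
    UORep n g (Submodule.Quotient.mk u) = Submodule.Quotient.mk (URep n g u) := rfl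

theorem tracelessSection_equivariant {n : ℕ} (hn : 2 ≤ n) (g : GL (Fin n) ℚ) (x : UO n) :
    tracelessSection n hn (UORep n g x) = URep n g (tracelessSection n hn x) := by
  obtain ⟨u, rfl⟩ := Submodule.Quotient.mk_surjective _ x
  rw [UORep_mk, tracelessSection_mk, tracelessSection_mk, map_add, map_smul, URep_wedge,
    trU_equivariant]

/-! ### The projections of `⋀^i U^O` -/

/-- The equivariant map `⋀^i U^O → Hom(H, ⋀ H)`. -/
def projAlg (n i : ℕ) (hn : 2 ≤ n) : ⋀[ℚ]^i (UO n) →ₗ[ℚ] (H n →ₗ[ℚ] Ext n) :=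
  exteriorPower.alternatingMapLinearEquiv
    ((multiInsertion n i).compLinearMap (tracelessSection n hn))

theorem projAlg_ιMulti {n i : ℕ} (hn : 2 ≤ n) (v : Fin i → UO n) :
    projAlg n i hn (exteriorPower.ιMulti ℚ i v) =
      multiInsertion n i (fun q => tracelessSection n hn (v q)) :=
  exteriorPower.alternatingMapLinearEquiv_apply_ιMulti _ _

theorem span_induction_ext {V : Type*} [AddCommGroup V] [Module ℚ V] {i : ℕ}
    {P : ⋀[ℚ]^i V → Prop} (hι : ∀ v, P (exteriorPower.ιMulti ℚ i v)) (h0 : P 0)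
    (hadd : ∀ x y, P x → P y → P (x + y)) (hsmul : ∀ (c : ℚ) x, P x → P (c • x))
    (x : ⋀[ℚ]^i V) : P x := by
  have hx : x ∈ Submodule.span ℚ (Set.range (exteriorPower.ιMulti ℚ i (M := V))) := by
    rw [exteriorPower.ιMulti_span]; trivial
  induction hx using Submodule.span_induction with
  | mem x hx => obtain ⟨v, rfl⟩ := hx; exact hι v
  | zero => exact h0
  | add x y _ _ hx hy => exact hadd x y hx hy
  | smul c x _ hx => exact hsmul c x hx

theorem projAlg_mem {n i : ℕ} (hn : 2 ≤ n) (x : ⋀[ℚ]^i (UO n)) (h : H n) :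
    projAlg n i hn x h ∈ ⋀[ℚ]^(i + 1) (H n) := by
  induction x using span_induction_ext with
  | hι v => rw [projAlg_ιMulti]; exact multiInsertion_mem _ _
  | h0 => rw [map_zero]; exact Submodule.zero_mem _
  | hadd x y hx hy => rw [map_add]; exact Submodule.add_mem _ hx hy
  | hsmul c x hx => rw [map_smul]; exact Submodule.smul_mem _ _ hx

theorem projAlg_extRep_ιMulti {n i : ℕ} (hn : 2 ≤ n) (g : GL (Fin n) ℚ) (v : Fin i → UO n) :
    projAlg n i hn (extRep i (UORep n) g (exteriorPower.ιMulti ℚ i v)) =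
      homExtAct n g (projAlg n i hn (exteriorPower.ιMulti ℚ i v)) := by
  have h1 : projAlg n i hn (extRep i (UORep n) g (exteriorPower.ιMulti ℚ i v)) =
      projAlg n i hn (exteriorPower.ιMulti ℚ i fun q => UORep n g (v q)) :=
    congrArg _ (extRep_ιMulti (UORep n) g v)
  have h2 := projAlg_ιMulti hn fun q => UORep n g (v q)
  have h3 : multiInsertion n i (fun q => tracelessSection n hn (UORep n g (v q))) =
      homExtAct n g (multiInsertion n i fun q => tracelessSection n hn (v q)) := by
    rw [← multiInsertion_equivariant i g fun q => tracelessSection n hn (v q)]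
    exact congrArg _ (funext fun q => tracelessSection_equivariant hn g (v q))
  exact h1.trans (h2.trans (h3.trans (congrArg _ (projAlg_ιMulti hn v).symm)))

theorem projAlg_equivariant {n i : ℕ} (hn : 2 ≤ n) (g : GL (Fin n) ℚ) (x : ⋀[ℚ]^i (UO n)) :
    projAlg n i hn (extRep i (UORep n) g x) = homExtAct n g (projAlg n i hn x) := by
  induction x using span_induction_ext with
  | hι v =>
    exact projAlg_extRep_ιMulti hn g v
  | h0 => refine LinearMap.ext fun h => ?_; simp [homExtAct_apply]
  | hadd x y hx hy =>
    refine LinearMap.ext fun h => ?_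
    simp only [map_add, hx, hy, homExtAct_apply, LinearMap.add_apply]
  | hsmul c x hx =>
    refine LinearMap.ext fun h => ?_
    simp only [map_smul, hx, homExtAct_apply, LinearMap.smul_apply]

/-- The equivariant map `⋀^i U^O → Hom(H, ⋀^{i+1} H)`. -/
def projHom (n i : ℕ) (hn : 2 ≤ n) : ⋀[ℚ]^i (UO n) →ₗ[ℚ] (H n →ₗ[ℚ] ⋀[ℚ]^(i + 1) (H n)) :=
  LinearMap.compRight ℚ (extProj n (i + 1)) ∘ₗ projAlg n i hn

theorem homIncl_projHom {n i : ℕ} (hn : 2 ≤ n) (x : ⋀[ℚ]^i (UO n)) :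
    homIncl n (i + 1) (projHom n i hn x) = projAlg n i hn x :=
  LinearMap.ext fun h => coe_extProj (projAlg_mem hn x h)

theorem homIncl_injective (n r : ℕ) : Function.Injective (homIncl n r) := fun _ _ h =>
  LinearMap.ext fun x => Subtype.ext (LinearMap.congr_fun h x)

theorem projHom_equivariant {n i : ℕ} (hn : 2 ≤ n) (g : GL (Fin n) ℚ) (x : ⋀[ℚ]^i (UO n)) :
    projHom n i hn (extRep i (UORep n) g x) = homExtHRep n (i + 1) g (projHom n i hn x) := by
  apply homIncl_injective
  exact (homIncl_projHom hn _).trans ((projAlg_equivariant hn g x).trans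
    ((congrArg (homExtAct n g) (homIncl_projHom hn x)).symm.trans
      (homIncl_homExtHRep g (projHom n i hn x)).symm))

/-- There are k indices below k with weight `n - 1 - k` and `n - 1 - k` indices above with weight
`-k`, so the trace cancels. This is read off from the weight identity for `K = {k}`, whose first
half forces `S = 0`. -/
theorem trU_weightedWedge {n : ℕ} (k : Fin n) : trU n (weightedWedge k) = 0 := by
  refine trU_of_tr_eq ?_
  have h : ∀ j, homIncl n 2 (weightedWedge k) (Pi.single j 1) =
      weight k j • (gen j * mono (fun _ : Fin 1 => k)) := fun j => by
    rw [homIncl_apply, weightedWedge_single, Submodule.coe_smul, coe_wedge, mono]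
    simp [gen]
  rw [tr_eq_of_diagonal h, map_zero]
  obtain ⟨S, hS1, hS2⟩ := exists_weight_identity ({k} : Finset (Fin n))
  have e : Finset.univ.image (fun _ : Fin 1 => k) = {k} := by ext; simp [eq_comm]
  simp only [Finset.prod_singleton, Finset.sum_singleton, Finset.erase_singleton,
    Finset.prod_empty, mul_one] at hS1 hS2
  rw [e, hS2]
  by_cases hk : ∃ j, j ∉ ({k} : Finset (Fin n))
  · obtain ⟨j, hj⟩ := hk
    have : S = 0 := by linarith [hS1 j hj]
    rw [this, mul_zero, zero_smul]
  -- If no index other than k exists, the first half says nothing, but the sum defining the trace is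
  -- empty.
  · push Not at hk
    have : ({k} : Finset (Fin n))ᶜ = ∅ := by
      ext j; simpa using hk j
    rw [this, Finset.sum_empty] at hS2
    rw [← hS2, zero_smul]

/-- As `weightedWedge` is traceless, the section returns it unchanged, and the evaluation of
`multiInsertion` applies. -/
theorem projHom_weightedWedge {n i : ℕ} (hn : 2 ≤ n) (κ : Fin i → Fin n) (j : Fin n) :
    (projHom n i hn (exteriorPower.ιMulti ℚ i fun q =>
      (Submodule.Quotient.mk (weightedWedge (κ q)) : UO n)) (Pi.single j 1) : Ext n) =
      (∏ q, weight (κ q) j) • (gen j * mono κ) := by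
  rw [← homIncl_apply, homIncl_projHom, projAlg_ιMulti]
  simp only [tracelessSection_mk, trU_weightedWedge, map_zero, smul_zero, add_zero]
  exact multiInsertion_weightedWedge κ j

end AlbaneseIO

end

noncomputable section

open scoped TensorProduct CategoryTheory

namespace AlbaneseIO

/-! ### The map from homology to the exterior power -/

section Homology

variable {G K V W : Type} [Group G] [Group K] [AddCommGroup V] [Module ℚ V]
  [AddCommGroup W] [Module ℚ W]

theorem wedgeChain_single (θ : G →* Multiplicative V) (i : ℕ) (x : Fin i → G) (b : ℚ) :
    wedgeChain θ i (Finsupp.single x b) =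
      b • exteriorPower.ιMulti ℚ i fun k => (θ (x k)).toAdd := by
  simp [wedgeChain]

theorem homologyToExt_π (θ : G →* Multiplicative V) (i : ℕ)
    (z : groupHomology.cycles (Rep.trivial ℚ G ℚ) i) :
    homologyToExt θ i (groupHomology.π (Rep.trivial ℚ G ℚ) i z) =
      wedgeChain θ i (groupHomology.iCycles (Rep.trivial ℚ G ℚ) i z) := by
  have h : (groupHomology.inhomogeneousChains (Rep.trivial ℚ G ℚ)).homologyπ i ≫
      ((groupHomology.inhomogeneousChains (Rep.trivial ℚ G ℚ)).homologyι i ≫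
      (groupHomology.inhomogeneousChains (Rep.trivial ℚ G ℚ)).descOpcycles
      (ModuleCat.ofHom (wedgeChain θ i)) (i + 1) (ChainComplex.prev ℕ i) (wedgeChain_d θ i)) =
      groupHomology.iCycles (Rep.trivial ℚ G ℚ) i ≫ ModuleCat.ofHom (wedgeChain θ i) := by
    rw [HomologicalComplex.homology_π_ι_assoc, HomologicalComplex.p_descOpcycles]
  exact congrArg (fun f => f.hom z) h

/-- The naturality holds already for inhomogeneous chains, where f acts entrywise on bars. -/
theorem homologyToExt_comp (f : G →* K) (θ : K →* Multiplicative V) (i : ℕ) (c : Hom G i) :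
    homologyToExt θ i (homologyMap f i c) = homologyToExt (θ.comp f) i c := by
  induction c using groupHomology_induction_on with
  | h z =>
    let φ : Rep.trivial ℚ G ℚ ⟶ Rep.res f (Rep.trivial ℚ K ℚ) :=
      Rep.ofHom ⟨LinearMap.id, fun _ => rfl⟩
    have h1 : homologyMap f i (groupHomology.π (Rep.trivial ℚ G ℚ) i z) =
        groupHomology.π (Rep.trivial ℚ K ℚ) i (groupHomology.cyclesMap f φ i z) :=
      congrArg (fun f => f.hom z) (groupHomology.π_map f φ i)
    have h2 : groupHomology.iCycles (Rep.trivial ℚ K ℚ) i (groupHomology.cyclesMap f φ i z) =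
        (groupHomology.chainsMap f φ).f i (groupHomology.iCycles (Rep.trivial ℚ G ℚ) i z) :=
      congrArg (fun f => f.hom z)
        (HomologicalComplex.cyclesMap_i (groupHomology.chainsMap f φ) i)
    have h3 : wedgeChain θ i ∘ₗ ((groupHomology.chainsMap f φ).f i).hom =
        wedgeChain (θ.comp f) i := by
      refine Finsupp.lhom_ext fun x a => ?_
      refine (congrArg (wedgeChain θ i) (groupHomology.chainsMap_f_single f φ i x a)).trans ?_
      rw [wedgeChain_single]
      exact (wedgeChain_single (θ.comp f) i x a).symm
    rw [h1, homologyToExt_π, homologyToExt_π, h2, ← h3]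
    rfl

theorem map_homologyToExt (θ : G →* Multiplicative V) (L : V →ₗ[ℚ] W) (i : ℕ) (c : Hom G i) :
    exteriorPower.map i L (homologyToExt θ i c) =
      homologyToExt ((AddMonoidHom.toMultiplicative L.toAddMonoidHom).comp θ) i c := by
  induction c using groupHomology_induction_on with
  | h z =>
    rw [homologyToExt_π, homologyToExt_π]
    have h : exteriorPower.map i L ∘ₗ wedgeChain θ i =
        wedgeChain ((AddMonoidHom.toMultiplicative L.toAddMonoidHom).comp θ) i := by
      refine Finsupp.lhom_ext fun x a => ?_
      rw [LinearMap.comp_apply, wedgeChain_single, wedgeChain_single, map_smul,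
        exteriorPower.map_apply_ιMulti]
      rfl
    exact LinearMap.congr_fun h _

/-! ### Abelian cycles of commuting tuples -/

/-- The antisymmetrized chain of a tuple of group elements. -/
def antisymmetrizedChain {i : ℕ} (g : Fin i → G) : (Fin i → G) →₀ ℚ :=
  ∑ s : Equiv.Perm (Fin i), ((Equiv.Perm.sign s : ℤ) : ℚ) • Finsupp.single (g ∘ s) 1

/-- The sign of each permutation cancels against the sign of the wedge, so all `i!` terms agree. -/
theorem wedgeChain_antisymmetrizedChain (θ : G →* Multiplicative V) {i : ℕ} (g : Fin i → G) :
    wedgeChain θ i (antisymmetrizedChain g) =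
      (i.factorial : ℚ) • exteriorPower.ιMulti ℚ i fun k => (θ (g k)).toAdd := by
  rw [antisymmetrizedChain, map_sum]
  have h : ∀ s : Equiv.Perm (Fin i),
      wedgeChain θ i (((Equiv.Perm.sign s : ℤ) : ℚ) • Finsupp.single (g ∘ s) 1) =
        exteriorPower.ιMulti ℚ i fun k => (θ (g k)).toAdd := fun s => by
    rw [map_smul, wedgeChain_single, one_smul]
    have := (exteriorPower.ιMulti ℚ i (M := V)).map_perm (fun k => (θ (g k)).toAdd) s
    change _ • exteriorPower.ιMulti ℚ i ((fun k => (θ (g k)).toAdd) ∘ s) = _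
    rw [this]
    rcases Int.units_eq_one_or (Equiv.Perm.sign s) with h | h <;> simp [h]
  rw [Finset.sum_congr rfl fun s _ => h s, Finset.sum_const, Finset.card_univ,
    Fintype.card_perm, Fintype.card_fin, Nat.cast_smul_eq_nsmul]

theorem contractNth_swap {m : ℕ} (g : Fin (m + 1) → G) (hg : ∀ a b, Commute (g a) (g b))
    (j : Fin m) :
    Fin.contractNth j.castSucc (· * ·) (g ∘ Equiv.swap j.castSucc j.succ) =
      Fin.contractNth j.castSucc (· * ·) g := by
  funext k
  rcases lt_trichotomy (k : ℕ) j with h | h | h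
  · rw [Fin.contractNth_apply_of_lt _ _ _ _ h, Fin.contractNth_apply_of_lt _ _ _ _ h,
      Function.comp_apply, Equiv.swap_apply_of_ne_of_ne]
    · exact fun e => h.ne (by simpa using congrArg Fin.val e)
    · intro e
      have := congrArg Fin.val e
      simp only [Fin.val_castSucc, Fin.val_succ] at this
      omega
  · have e : k = j := Fin.ext h
    subst e
    rw [Fin.contractNth_apply_of_eq _ _ _ _ rfl, Fin.contractNth_apply_of_eq _ _ _ _ rfl,
      Function.comp_apply, Function.comp_apply, Equiv.swap_apply_left, Equiv.swap_apply_right]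
    exact hg _ _
  · rw [Fin.contractNth_apply_of_gt _ _ _ _ h, Fin.contractNth_apply_of_gt _ _ _ _ h,
      Function.comp_apply, Equiv.swap_apply_of_ne_of_ne]
    · intro e
      have := congrArg Fin.val e
      simp only [Fin.val_castSucc, Fin.val_succ] at this
      omega
    · intro e
      have := congrArg Fin.val e
      simp only [Fin.val_succ] at this
      omega

/-- Inner faces cancel in pairs by commutativity, and the two outer faces cancel each other after a
cyclic rotation of the entries. -/
theorem d_antisymmetrizedChain {m : ℕ} (g : Fin (m + 1) → G) (hg : ∀ a b, Commute (g a) (g b)) :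
    groupHomology.inhomogeneousChains.d (Rep.trivial ℚ G ℚ) m (antisymmetrizedChain g) = 0 := by
  let d := (groupHomology.inhomogeneousChains.d (Rep.trivial ℚ G ℚ) m).hom
  have hd : ∀ s : Equiv.Perm (Fin (m + 1)),
      d (((Equiv.Perm.sign s : ℤ) : ℚ) • Finsupp.single (g ∘ s) (1 : ℚ)) =
      ((Equiv.Perm.sign s : ℤ) : ℚ) • (Finsupp.single (fun k : Fin m => g (s k.succ)) (1 : ℚ)) +
      ∑ j : Fin (m + 1), (-1 : ℚ) ^ ((j : ℕ) + 1) • (((Equiv.Perm.sign s : ℤ) : ℚ) •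
        Finsupp.single (Fin.contractNth j (· * ·) (g ∘ s)) (1 : ℚ)) := fun s => by
    rw [map_smul]
    refine (congrArg _ (groupHomology.inhomogeneousChains.d_single (A := Rep.trivial ℚ G ℚ)
      m (g ∘ s) (1 : ℚ))).trans ?_
    rw [smul_add, Finset.smul_sum]
    refine congrArg₂ _ rfl (Finset.sum_congr rfl fun j _ => ?_)
    exact smul_comm _ _ _
  change d (antisymmetrizedChain g) = 0
  rw [antisymmetrizedChain, map_sum, Finset.sum_congr rfl fun s _ => hd s,
    Finset.sum_add_distrib, Finset.sum_comm, Fin.sum_univ_castSucc]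
  simp only [← Finset.smul_sum]
  -- Precomposing s with the transposition of the two merged positions fixes the face and reverses
  -- the sign, so the sum equals its own negative.
  have hmid : ∀ j : Fin m, ∑ s : Equiv.Perm (Fin (m + 1)), ((Equiv.Perm.sign s : ℤ) : ℚ) •
      Finsupp.single (Fin.contractNth j.castSucc (· * ·) (g ∘ s)) (1 : ℚ) = 0 := fun j => by
    have hinv := Equiv.sum_comp (Equiv.mulRight (Equiv.swap j.castSucc j.succ))
      (fun s : Equiv.Perm (Fin (m + 1)) => ((Equiv.Perm.sign s : ℤ) : ℚ) •
        Finsupp.single (Fin.contractNth j.castSucc (· * ·) (g ∘ s)) (1 : ℚ))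
    have h : ∀ s : Equiv.Perm (Fin (m + 1)),
        ((Equiv.Perm.sign (Equiv.mulRight (Equiv.swap j.castSucc j.succ) s) : ℤ) : ℚ) •
        Finsupp.single (Fin.contractNth j.castSucc (· * ·)
          (g ∘ (Equiv.mulRight (Equiv.swap j.castSucc j.succ) s))) (1 : ℚ) =
        - (((Equiv.Perm.sign s : ℤ) : ℚ) •
        Finsupp.single (Fin.contractNth j.castSucc (· * ·) (g ∘ s)) (1 : ℚ)) := fun s => by
      have h1 : g ∘ (s * Equiv.swap j.castSucc j.succ : Equiv.Perm _) =
        (g ∘ s) ∘ Equiv.swap j.castSucc j.succ := rfl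
      rw [Equiv.coe_mulRight, h1, contractNth_swap (g ∘ s) (fun a b => hg _ _),
        Equiv.Perm.sign_mul, Equiv.Perm.sign_swap (Fin.castSucc_lt_succ).ne]
      simp
    rw [Finset.sum_congr rfl fun s _ => h s, Finset.sum_neg_distrib] at hinv
    exact self_eq_neg.1 hinv.symm
  -- Deleting the last entry of the rotated tuple is deleting the first entry of the original one;
  -- the rotation of `m + 1` letters has sign `(-1)^m`.
  have hlast : ∑ s : Equiv.Perm (Fin (m + 1)), ((Equiv.Perm.sign s : ℤ) : ℚ) •
      Finsupp.single (Fin.contractNth (Fin.last m) (· * ·) (g ∘ s)) (1 : ℚ) =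
      (-1 : ℚ) ^ m • ∑ s : Equiv.Perm (Fin (m + 1)), ((Equiv.Perm.sign s : ℤ) : ℚ) •
        (Finsupp.single (fun k : Fin m => g (s k.succ)) (1 : ℚ)) := by
    rw [← Equiv.sum_comp (Equiv.mulRight (finRotate (m + 1))), Finset.smul_sum]
    refine Finset.sum_congr rfl fun s _ => ?_
    have h1 : Fin.contractNth (Fin.last m) (· * ·)
        (g ∘ (Equiv.mulRight (finRotate (m + 1)) s)) = fun k : Fin m => g (s k.succ) := by
      funext k
      rw [Fin.contractNth_apply_of_lt _ _ _ _ k.2, Equiv.coe_mulRight, Function.comp_apply,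
        Equiv.Perm.mul_apply, finRotate_apply, Fin.coeSucc_eq_succ]
    rw [h1, Equiv.coe_mulRight, Equiv.Perm.sign_mul, sign_finRotate, smul_smul]
    congr 1
    push_cast
    ring
  simp only [hmid, smul_zero, Finset.sum_const_zero, zero_add, hlast, Fin.val_last, smul_smul]
  rw [← pow_add]
  have h2 : (-1 : ℚ) ^ (m + 1 + m) = -1 := by
    rw [show m + 1 + m = 2 * m + 1 by ring, pow_succ, pow_mul]; simp
  rw [h2, neg_one_smul, add_neg_cancel]

theorem exists_homologyToExt_eq (θ : G →* Multiplicative V) {m : ℕ} (g : Fin (m + 1) → G)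
    (hg : ∀ a b, Commute (g a) (g b)) :
    exteriorPower.ιMulti ℚ (m + 1) (fun k => (θ (g k)).toAdd) ∈
      LinearMap.range (homologyToExt θ (m + 1)) := by
  have hd : (groupHomology.inhomogeneousChains (Rep.trivial ℚ G ℚ)).d (m + 1) m
      (antisymmetrizedChain g) = 0 := by
    rw [groupHomology.inhomogeneousChains.d_def]
    exact d_antisymmetrizedChain g hg
  refine ⟨((m + 1).factorial : ℚ)⁻¹ • groupHomology.π (Rep.trivial ℚ G ℚ) (m + 1)
    (groupHomology.cyclesMk (A := Rep.trivial ℚ G ℚ) (m + 1) m (by simp)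
      (antisymmetrizedChain g) hd), ?_⟩
  rw [map_smul, homologyToExt_π, groupHomology.iCycles_mk, wedgeChain_antisymmetrizedChain,
    smul_smul, inv_mul_cancel₀ (by exact_mod_cast Nat.factorial_ne_zero _), one_smul]

theorem ιMulti_smul {i : ℕ} (c : ℚ) (v : Fin i → V) :
    exteriorPower.ιMulti ℚ i (fun q => c • v q) = c ^ i • exteriorPower.ιMulti ℚ i v := by
  have h := (exteriorPower.ιMulti ℚ i (M := V)).toMultilinearMap.map_smul_univ (fun _ => c) v
  rw [Finset.prod_const, Finset.card_univ, Fintype.card_fin] at h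
  exact h

/-- The scalar c is there because the traceless test vectors are `n - 1` times Johnson images. -/
theorem ιMulti_mem_range_homologyToExt (θ : G →* Multiplicative V) {i : ℕ} (hi : 1 ≤ i)
    (g : Fin i → G) (hg : ∀ a b, Commute (g a) (g b)) (c : ℚ) (v : Fin i → V)
    (hv : ∀ q, v q = c • (θ (g q)).toAdd) :
    exteriorPower.ιMulti ℚ i v ∈ LinearMap.range (homologyToExt θ i) := by
  obtain ⟨m, rfl⟩ : ∃ m, i = m + 1 := ⟨i - 1, by omega⟩
  rw [funext hv, ιMulti_smul]
  exact Submodule.smul_mem _ _ (exists_homologyToExt_eq θ g hg)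

theorem homologyToExt_homologyMap_eq_extRep {Γ : Type} [Group Γ] (ρ : Representation ℚ Γ V)
    (θ : G →* Multiplicative V) (f : G →* G) (γ : Γ)
    (h : ∀ a, θ (f a) = Multiplicative.ofAdd (ρ γ (θ a).toAdd)) (i : ℕ) (c : Hom G i) :
    homologyToExt θ i (homologyMap f i c) = extRep i ρ γ (homologyToExt θ i c) := by
  have h : θ.comp f = (AddMonoidHom.toMultiplicative (ρ γ).toAddMonoidHom).comp θ :=
    MonoidHom.ext h
  refine (homologyToExt_comp f θ i c).trans ?_
  refine Eq.trans ?_ (map_homologyToExt θ (ρ γ) i c).symm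
  rw [h]

end Homology

end AlbaneseIO

end

noncomputable section

open scoped TensorProduct CategoryTheory

namespace AlbaneseIO

/-! ### Automorphisms of free groups -/

/-- The endomorphism `x_j ↦ x_k^{-t} x_j x_k^t` for `j < k`, fixing the other generators. -/
def conjBelowHom {n : ℕ} (k : Fin n) (t : ℤ) : F n →* F n :=
  FreeGroup.lift fun j => if j < k then
    (FreeGroup.of k) ^ (-t) * FreeGroup.of j * (FreeGroup.of k) ^ t else FreeGroup.of j

theorem conjBelowHom_of_lt {n : ℕ} {j k : Fin n} (h : j < k) (t : ℤ) :
    conjBelowHom k t (FreeGroup.of j) =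
      (FreeGroup.of k) ^ (-t) * FreeGroup.of j * (FreeGroup.of k) ^ t := by
  rw [conjBelowHom, FreeGroup.lift_apply_of, if_pos h]

theorem conjBelowHom_of_le {n : ℕ} {j k : Fin n} (h : k ≤ j) (t : ℤ) :
    conjBelowHom k t (FreeGroup.of j) = FreeGroup.of j := by
  rw [conjBelowHom, FreeGroup.lift_apply_of, if_neg (not_lt.2 h)]

theorem conjBelowHom_comp {n : ℕ} (k : Fin n) (s t : ℤ) :
    (conjBelowHom k s).comp (conjBelowHom k t) = conjBelowHom k (s + t) := by
  refine FreeGroup.ext_hom _ _ fun j => ?_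
  rw [MonoidHom.comp_apply]
  rcases lt_or_ge j k with h | h
  · rw [conjBelowHom_of_lt h, conjBelowHom_of_lt h, map_mul, map_mul, map_zpow, map_zpow,
      conjBelowHom_of_le le_rfl, conjBelowHom_of_lt h]
    group
  · rw [conjBelowHom_of_le h, conjBelowHom_of_le h, conjBelowHom_of_le h]

theorem conjBelowHom_zero {n : ℕ} (k : Fin n) : conjBelowHom k 0 = MonoidHom.id (F n) := by
  refine FreeGroup.ext_hom _ _ fun j => ?_
  rcases lt_or_ge j k with h | h
  · rw [conjBelowHom_of_lt h]; simp
  · rw [conjBelowHom_of_le h]; rfl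

/-- The automorphism `x_j ↦ x_k⁻¹ x_j x_k` for `j < k`, fixing the other generators. -/
def conjBelow {n : ℕ} (k : Fin n) : MulAut (F n) :=
  MonoidHom.toMulEquiv (conjBelowHom k 1) (conjBelowHom k (-1))
    (by rw [conjBelowHom_comp, neg_add_cancel, conjBelowHom_zero])
    (by rw [conjBelowHom_comp, add_neg_cancel, conjBelowHom_zero])

theorem conjBelow_apply {n : ℕ} (k : Fin n) (x : F n) : conjBelow k x = conjBelowHom k 1 x := rfl

/-- For `k < l` the automorphism of index l conjugates by `x_l` everything that the one of index k
touches, including `x_k`, while the one of index k fixes `x_l`. Both composites send `x_j` with `j <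
k` to its conjugate by `x_k x_l`. -/
theorem conjBelow_commute {n : ℕ} (k l : Fin n) : Commute (conjBelow k) (conjBelow l) := by
  wlog hkl : k < l generalizing k l
  · rcases (not_lt.1 hkl).lt_or_eq with h | h
    · exact (this l k h).symm
    · rw [h]
  have h : (conjBelowHom k 1).comp (conjBelowHom l 1) =
      (conjBelowHom l 1).comp (conjBelowHom k 1) := by
    refine FreeGroup.ext_hom _ _ fun j => ?_
    rw [MonoidHom.comp_apply, MonoidHom.comp_apply]
    rcases lt_or_ge j l with h | h
    · rw [conjBelowHom_of_lt h, map_mul, map_mul, map_zpow, map_zpow, conjBelowHom_of_le hkl.le]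
      rcases lt_or_ge j k with h' | h'
      · rw [conjBelowHom_of_lt h', map_mul, map_mul, map_zpow, map_zpow, conjBelowHom_of_lt h,
          conjBelowHom_of_lt hkl]
        group
      · rw [conjBelowHom_of_le h', conjBelowHom_of_lt h]
    · rw [conjBelowHom_of_le h, conjBelowHom_of_le (hkl.le.trans h), conjBelowHom_of_le h]
  exact MulEquiv.ext fun x => DFunLike.congr_fun h x

theorem autToGL_conjBelow {n : ℕ} (k : Fin n) : autToGL n (conjBelow k) = 1 := by
  rw [autToGL_eq_one_iff]
  have h : (ab n).comp (conjBelowHom k 1) = ab n := by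
    refine FreeGroup.ext_hom _ _ fun j => ?_
    rw [MonoidHom.comp_apply]
    rcases lt_or_ge j k with h | h
    · rw [conjBelowHom_of_lt h]
      simp
    · rw [conjBelowHom_of_le h]
  exact fun x => DFunLike.congr_fun h x

theorem toH_inv (n : ℕ) (x : F n) : toH n x⁻¹ = - toH n x := by ext k; simp [toH]

theorem johnson_conjBelow_single {n : ℕ} (k j : Fin n) :
    johnson n (conjBelow k) (Pi.single j 1) =
      if j < k then wedge n (Pi.single j 1) (Pi.single k 1) else 0 := by
  have h : johnson n (conjBelow k) (Pi.single j 1) =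
      (nil2 n ((FreeGroup.of j)⁻¹ * conjBelow k (FreeGroup.of j))).deg2 := by
    rw [johnson, ← Pi.basisFun_apply, Module.Basis.constr_basis]
  rw [h, conjBelow_apply]
  split_ifs with hjk
  · rw [conjBelowHom_of_lt hjk]
    -- The element is the commutator of `x_j⁻¹` and `x_k⁻¹`; the two minus signs cancel in the
    -- wedge.
    have e : (FreeGroup.of j)⁻¹ * ((FreeGroup.of k) ^ (-1 : ℤ) * FreeGroup.of j *
        (FreeGroup.of k) ^ (1 : ℤ)) = (FreeGroup.of j)⁻¹ * (FreeGroup.of k)⁻¹ *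
        ((FreeGroup.of j)⁻¹)⁻¹ * ((FreeGroup.of k)⁻¹)⁻¹ := by group
    rw [e, nil2_commutator, toH_inv, toH_inv, toH_of, toH_of]
    simp
  · rw [conjBelowHom_of_le (not_lt.1 hjk), inv_mul_cancel, map_one]
    rfl

/-- This is the origin of the weights: k is the number of indices below k, and adding k times the
inner derivation of `e_k` makes `n - 1` times the Johnson image traceless without changing its class
in `U^O`. -/
theorem weightedWedge_eq {n : ℕ} (k : Fin n) :
    weightedWedge k = ((n : ℚ) - 1) • johnson n (conjBelow k) +
      ((k : ℕ) : ℚ) • wedge n (Pi.single k 1) := by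
  refine (Pi.basisFun ℚ (Fin n)).ext fun j => ?_
  rw [Pi.basisFun_apply, weightedWedge_single, LinearMap.add_apply, LinearMap.smul_apply,
    LinearMap.smul_apply, johnson_conjBelow_single, wedge_swap n (Pi.single k 1) (Pi.single j 1)]
  split_ifs with h
  · rw [weight_of_lt h]; module
  · rw [weight_of_le (not_lt.1 h)]; module

/-! ### Integral transvections from automorphisms of the free group -/

/-- The endomorphism `x_j ↦ x_j x_k^t`, fixing the other generators. -/
def transvHom {n : ℕ} (k j : Fin n) (t : ℤ) : F n →* F n :=
  FreeGroup.lift fun l => if l = j then FreeGroup.of j * (FreeGroup.of k) ^ t else FreeGroup.of l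

theorem transvHom_self {n : ℕ} (k j : Fin n) (t : ℤ) :
    transvHom k j t (FreeGroup.of j) = FreeGroup.of j * (FreeGroup.of k) ^ t := by
  rw [transvHom, FreeGroup.lift_apply_of, if_pos rfl]

theorem transvHom_of_ne {n : ℕ} {k j l : Fin n} (h : l ≠ j) (t : ℤ) :
    transvHom k j t (FreeGroup.of l) = FreeGroup.of l := by
  rw [transvHom, FreeGroup.lift_apply_of, if_neg h]

theorem transvHom_comp {n : ℕ} {k j : Fin n} (h : k ≠ j) (s t : ℤ) (hst : s + t = 0) :
    (transvHom k j s).comp (transvHom k j t) = MonoidHom.id (F n) := by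
  refine FreeGroup.ext_hom _ _ fun l => ?_
  rw [MonoidHom.comp_apply]
  by_cases hl : l = j
  · subst hl
    rw [transvHom_self, map_mul, map_zpow, transvHom_self, transvHom_of_ne h, mul_assoc, ← zpow_add,
      hst, zpow_zero, mul_one]
    rfl
  · rw [transvHom_of_ne hl, transvHom_of_ne hl]
    rfl

/-- The automorphism `x_j ↦ x_j x_k^t`, fixing the other generators. -/
def transvAut {n : ℕ} {k j : Fin n} (h : k ≠ j) (t : ℤ) : MulAut (F n) :=
  MonoidHom.toMulEquiv (transvHom k j t) (transvHom k j (-t))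
    (transvHom_comp h _ _ (neg_add_cancel t)) (transvHom_comp h _ _ (add_neg_cancel t))

/-- The homomorphism `Aut(F_n) → GL(n, ℚ)`. -/
def autToGLQ (n : ℕ) : MulAut (F n) →* GL (Fin n) ℚ :=
  (Matrix.GeneralLinearGroup.map (Int.castRingHom ℚ)).comp (autToGL n)

theorem coe_autToGLQ (n : ℕ) (ψ : MulAut (F n)) :
    (autToGLQ n ψ).1 = (autMatrix n ψ).map (Int.castRingHom ℚ) := rfl

theorem autToGLQ_transvAut {n : ℕ} {k j : Fin n} (h : k ≠ j) (t : ℤ) :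
    (autToGLQ n (transvAut h t)).1 = Matrix.transvection k j (t : ℚ) := by
  rw [coe_autToGLQ]
  ext a b
  rw [Matrix.map_apply, autMatrix, Matrix.of_apply]
  change ((((ab n (transvHom k j t (FreeGroup.of b))).toAdd a : ℤ)) : ℚ) = _
  rw [Matrix.transvection, Matrix.add_apply, Matrix.one_apply, Matrix.single_apply]
  by_cases hb : b = j
  · subst hb
    rw [transvHom_self]
    simp only [ab, map_mul, map_zpow, FreeGroup.lift_apply_of, toAdd_mul, toAdd_zpow, toAdd_ofAdd,
      Pi.add_apply, Pi.smul_apply, Pi.single_apply, smul_eq_mul, mul_ite, mul_one, mul_zero,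
      and_true, eq_comm (a := k)]
    push_cast
    rfl
  · rw [transvHom_of_ne hb]
    simp [ab, Pi.single_apply, Ne.symm hb]

/-! ### Conjugation equivariance of the Johnson homomorphism -/

theorem toH_aut (n : ℕ) (ψ : MulAut (F n)) (x : F n) :
    toH n (ψ x) = stdRep n (autToGLQ n ψ) (toH n x) := by
  ext k
  change (((ab n (ψ x)).toAdd k : ℤ) : ℚ) = (Matrix.toLin' (autToGLQ n ψ).1 (toH n x)) k
  rw [toAdd_ab_apply, Matrix.toLin'_apply, coe_autToGLQ]
  simp [Matrix.mulVec, dotProduct, toH]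

/-- The endomorphism `(a, w) ↦ (g a, ⋀² g w + c a)` of `H ⊕ ⋀² H`. -/
def Nil2.mapHom {n : ℕ} (g : GL (Fin n) ℚ) (c : U n) : Nil2 n →* Nil2 n where
  toFun x := ⟨stdRep n g x.deg1, extRep 2 (stdRep n) g x.deg2 + c x.deg1⟩
  map_one' := by
    apply Nil2.ext
    · exact map_zero _
    · change extRep 2 (stdRep n) g 0 + c 0 = 0
      rw [map_zero, map_zero, add_zero]
  map_mul' x y := by
    apply Nil2.ext
    · exact map_add _ _ _
    · simp only [Nil2.mul_deg2, Nil2.mul_deg1, map_add, map_smul, extRep_wedge]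
      abel

/-- An automorphism of the free group descends to the 2-step nilpotent quotient. Its action on `H`
and `⋀² H` is determined by the matrix, and c records the degree-two part of the images of the
generators. -/
theorem exists_nil2_aut (n : ℕ) (ψ : MulAut (F n)) :
    ∃ c : U n, ∀ x, nil2 n (ψ x) = Nil2.mapHom (autToGLQ n ψ) c (nil2 n x) := by
  refine ⟨(Pi.basisFun ℚ (Fin n)).constr ℚ fun j => (nil2 n (ψ (FreeGroup.of j))).deg2, ?_⟩
  set c : U n := (Pi.basisFun ℚ (Fin n)).constr ℚ fun j => (nil2 n (ψ (FreeGroup.of j))).deg2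
  have hc : ∀ j, c (Pi.single j 1) = (nil2 n (ψ (FreeGroup.of j))).deg2 := fun j => by
    rw [← Pi.basisFun_apply, Module.Basis.constr_basis]
  have h : (nil2 n).comp ψ.toMonoidHom = (Nil2.mapHom (autToGLQ n ψ) c).comp (nil2 n) := by
    refine FreeGroup.ext_hom _ _ fun j => ?_
    have h1 : nil2 n (FreeGroup.of j) = ⟨Pi.single j 1, 0⟩ := by
      rw [nil2, FreeGroup.lift_apply_of]
    change nil2 n (ψ (FreeGroup.of j)) = Nil2.mapHom (autToGLQ n ψ) c (nil2 n (FreeGroup.of j))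
    apply Nil2.ext
    · rw [nil2_deg1, toH_aut, toH_of, h1]
      rfl
    · rw [h1, ← hc]
      change _ = extRep 2 (stdRep n) (autToGLQ n ψ) 0 + c (Pi.single j 1)
      rw [map_zero, zero_add]
  exact fun x => DFunLike.congr_fun h x

/-- Evaluate at `ψ y`. The Johnson term of φ lies in degree two, where the induced map of ψ is just
`⋀² g`, so the correction c drops out. -/
theorem johnson_aut_conj (n : ℕ) (ψ φ : MulAut (F n)) (hφ : autToGL n φ = 1) :
    johnson n (ψ * φ * ψ⁻¹) = URep n (autToGLQ n ψ) (johnson n φ) := by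
  refine johnson_eq_of_forall n (by rw [map_mul, map_mul, hφ, mul_one, map_inv, mul_inv_cancel]) _
    fun x => ?_
  obtain ⟨c, hc⟩ := exists_nil2_aut n ψ
  obtain ⟨y, rfl⟩ := ψ.surjective x
  have e : (ψ * φ * ψ⁻¹) (ψ y) = ψ (φ y) := by
    rw [MulAut.mul_apply, MulAut.mul_apply, MulAut.inv_apply_self]
  rw [e, hc, nil2_apply n hφ, map_mul, ← hc, URep_apply, toH_aut, Representation.inv_self_apply]
  congr 1
  apply Nil2.ext
  · exact map_zero _
  · change _ + c 0 = _
    rw [map_zero, add_zero]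

theorem johnsonOut_conj (n : ℕ) (o : OutF n) (a : IOut n) :
    johnsonOut n (MulAut.conjNormal o a) =
      Multiplicative.ofAdd (UORep n (outToGLQ n o) (johnsonOut n a).toAdd) := by
  obtain ⟨ψ, rfl⟩ := QuotientGroup.mk_surjective o
  obtain ⟨a, ha⟩ := a
  obtain ⟨φ, rfl⟩ := QuotientGroup.mk_surjective a
  have h : ((ψ * φ * ψ⁻¹ : MulAut (F n)) : OutF n) ∈ IOut n :=
    (MulAut.conjNormal (ψ : OutF n) (⟨(φ : OutF n), ha⟩ : IOut n)).2
  have h1 : MulAut.conjNormal (ψ : OutF n) (⟨(φ : OutF n), ha⟩ : IOut n) =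
      ⟨((ψ * φ * ψ⁻¹ : MulAut (F n)) : OutF n), h⟩ := Subtype.ext (MulAut.conjNormal_apply _ _)
  refine (congrArg (johnsonOut n) h1).trans ((johnsonOut_mk n _ h).trans ?_)
  refine Eq.trans ?_ (congrArg (fun x => Multiplicative.ofAdd (UORep n (outToGLQ n ψ) x.toAdd))
    (johnsonOut_mk n φ ha)).symm
  exact congrArg (fun u => Multiplicative.ofAdd (Submodule.Quotient.mk u : UO n))
    (johnson_aut_conj n ψ φ (autToGL_of_mk ha))

theorem homologyToExt_conjAction (n i : ℕ) (o : OutF n) (c : Hom (IOut n) i) :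
    homologyToExt (johnsonOut n) i (conjAction n i o c) =
      extRep i (UORep n) (outToGLQ n o) (homologyToExt (johnsonOut n) i c) :=
  homologyToExt_homologyMap_eq_extRep (UORep n) (johnsonOut n) (MulAut.conjNormal o).toMonoidHom
    (outToGLQ n o) (johnsonOut_conj n o) i c

/-! ### The image of Albanese homology and its test class -/

theorem albaneseToExt_toAlbanese (n i : ℕ) (c : Hom (IOut n) i) :
    albaneseToExt n i (toAlbanese (IOut n) i c) = homologyToExt (johnsonOut n) i c := by
  refine (homologyToExt_comp (Abelianization.of (G := IOut n))
    (Abelianization.lift (johnsonOut n)) i c).trans ?_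
  congr 1

theorem range_albaneseToExt (n i : ℕ) :
    LinearMap.range (albaneseToExt n i) = LinearMap.range (homologyToExt (johnsonOut n) i) := by
  apply le_antisymm
  · rintro _ ⟨x, rfl⟩
    obtain ⟨c, rfl⟩ := LinearMap.surjective_rangeRestrict _ x
    exact ⟨c, (albaneseToExt_toAlbanese n i c).symm⟩
  · rintro _ ⟨c, rfl⟩
    exact ⟨_, albaneseToExt_toAlbanese n i c⟩

theorem mk_weightedWedge {n : ℕ} (k : Fin n) : (Submodule.Quotient.mk (weightedWedge k) : UO n) =
    ((n : ℚ) - 1) • (Submodule.Quotient.mk (johnson n (conjBelow k)) : UO n) := by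
  have hz : (Submodule.Quotient.mk (wedge n (Pi.single k 1)) : UO n) = 0 :=
    (Submodule.Quotient.mk_eq_zero (LinearMap.range (wedge n))).2 ⟨_, rfl⟩
  rw [weightedWedge_eq, Submodule.Quotient.mk_add, Submodule.Quotient.mk_smul,
    Submodule.Quotient.mk_smul, hz, smul_zero, add_zero]

/-- The test class is the image of the abelian cycle of the commuting classes of `conjBelow`,
rescaled. -/
theorem weightedWedge_mem_range {n i : ℕ} (hi : 1 ≤ i) (κ : Fin i → Fin n) :
    exteriorPower.ιMulti ℚ i (fun q => (Submodule.Quotient.mk (weightedWedge (κ q)) : UO n)) ∈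
      LinearMap.range (homologyToExt (johnsonOut n) i) := by
  have h1 : ∀ k : Fin n, ((conjBelow k : MulAut (F n)) : OutF n) ∈ IOut n :=
    fun k => autToGL_conjBelow k
  refine ιMulti_mem_range_homologyToExt (johnsonOut n) hi
    (fun q => (⟨_, h1 (κ q)⟩ : IOut n)) (fun a b => Subtype.ext ?_) ((n : ℚ) - 1) _ fun q => ?_
  · exact congrArg (QuotientGroup.mk : MulAut (F n) → OutF n) (conjBelow_commute (κ a) (κ b)).eq
  · exact (mk_weightedWedge (κ q)).trans (congrArg (fun x => ((n : ℚ) - 1) • x.toAdd)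
      (johnsonOut_mk n _ (h1 (κ q))).symm)

end AlbaneseIO

end

noncomputable section

open scoped TensorProduct CategoryTheory

namespace AlbaneseIO

/-! ### Polynomial curves in rational vector spaces -/

section PolyCurve

variable {V W X : Type} [AddCommGroup V] [Module ℚ V] [AddCommGroup W] [Module ℚ W]
  [AddCommGroup X] [Module ℚ X]

/-- The polynomial curves in a rational vector space. -/
def polyCurve (V : Type) [AddCommGroup V] [Module ℚ V] : Submodule ℚ (ℚ → V) :=
  Submodule.span ℚ {f | ∃ (k : ℕ) (v : V), f = fun s => s ^ k • v}

theorem const_mem_polyCurve (v : V) : (fun _ => v) ∈ polyCurve V :=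
  Submodule.subset_span ⟨0, v, by simp⟩

theorem smul_mem_polyCurve {f : ℚ → V} (k : ℕ) (hf : f ∈ polyCurve V) :
    (fun s => s ^ k • f s) ∈ polyCurve V := by
  induction hf using Submodule.span_induction with
  | mem f hf =>
    obtain ⟨l, v, rfl⟩ := hf
    exact Submodule.subset_span ⟨k + l, v, by simp only [pow_add, mul_smul]⟩
  | zero => simp only [Pi.zero_apply, smul_zero]; exact Submodule.zero_mem _
  | add f g _ _ hf hg => simp only [Pi.add_apply, smul_add]; exact Submodule.add_mem _ hf hg
  | smul c f _ hf =>
    have e : (fun s : ℚ => s ^ k • (c • f) s) = c • fun s => s ^ k • f s := by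
      funext s; exact smul_comm _ _ _
    rw [e]; exact Submodule.smul_mem _ _ hf

theorem apply_mem_polyCurve {A : ℚ → V →ₗ[ℚ] W} (hA : ∀ v, (fun s => A s v) ∈ polyCurve W)
    {f : ℚ → V} (hf : f ∈ polyCurve V) : (fun s => A s (f s)) ∈ polyCurve W := by
  induction hf using Submodule.span_induction with
  | mem f hf =>
    obtain ⟨l, v, rfl⟩ := hf
    simp only [map_smul]
    exact smul_mem_polyCurve l (hA v)
  | zero => simp only [Pi.zero_apply, map_zero]; exact Submodule.zero_mem _
  | add f g _ _ hf hg => simp only [Pi.add_apply, map_add]; exact Submodule.add_mem _ hf hg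
  | smul c f _ hf => simp only [Pi.smul_apply, map_smul]; exact Submodule.smul_mem _ _ hf

theorem map_mem_polyCurve (A : V →ₗ[ℚ] W) {f : ℚ → V} (hf : f ∈ polyCurve V) :
    (fun s => A (f s)) ∈ polyCurve W :=
  apply_mem_polyCurve (A := fun _ => A) (fun _ => const_mem_polyCurve _) hf

theorem bilin_mem_polyCurve (B : V →ₗ[ℚ] W →ₗ[ℚ] X) {f : ℚ → V} {g : ℚ → W}
    (hf : f ∈ polyCurve V) (hg : g ∈ polyCurve W) : (fun s => B (f s) (g s)) ∈ polyCurve X :=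
  apply_mem_polyCurve (A := fun s => B (f s)) (fun w => map_mem_polyCurve (B.flip w) hf) hg

theorem eq_eval_of_mem_polyCurve {f : ℚ → ℚ} (hf : f ∈ polyCurve ℚ) :
    ∃ p : Polynomial ℚ, f = fun s => p.eval s := by
  induction hf using Submodule.span_induction with
  | mem f hf =>
    obtain ⟨l, v, rfl⟩ := hf
    exact ⟨Polynomial.C v * Polynomial.X ^ l, by
      funext s
      rw [Polynomial.eval_mul, Polynomial.eval_C, Polynomial.eval_pow, Polynomial.eval_X,
        smul_eq_mul, mul_comm]⟩
  | zero => exact ⟨0, by funext s; simp⟩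
  | add f g _ _ hf hg =>
    obtain ⟨p, rfl⟩ := hf
    obtain ⟨q, rfl⟩ := hg
    exact ⟨p + q, by funext s; simp⟩
  | smul c f _ hf =>
    obtain ⟨p, rfl⟩ := hf
    exact ⟨Polynomial.C c * p, by funext s; simp⟩

/-- A polynomial curve that meets a subspace infinitely often lies in it. -/
theorem polyCurve_mem_of_infinite {f : ℚ → V} (hf : f ∈ polyCurve V) (N : Submodule ℚ V)
    (h : {s | f s ∈ N}.Infinite) (s : ℚ) : f s ∈ N := by
  -- Modulo N and after a linear functional, the curve is a rational polynomial with infinitely many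
  -- roots.
  rw [← Submodule.Quotient.mk_eq_zero, ← Module.forall_dual_apply_eq_zero_iff ℚ]
  intro φ
  obtain ⟨p, hp⟩ := eq_eval_of_mem_polyCurve (map_mem_polyCurve (φ ∘ₗ N.mkQ) hf)
  have hp' : ∀ s, φ (N.mkQ (f s)) = p.eval s := fun s => congrFun hp s
  have h0 : p = 0 := by
    refine Polynomial.eq_zero_of_infinite_isRoot p (h.mono fun s hs => ?_)
    change p.eval s = 0
    have h1 : N.mkQ (f s) = 0 := (Submodule.Quotient.mk_eq_zero N).2 hs
    rw [← hp', h1, map_zero]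
  exact (hp' s).trans (by rw [h0, Polynomial.eval_zero])

/-- The wedge is an iterated bilinear product inside the exterior algebra, where polynomiality is
immediate; a linear retraction brings the curve back to the exterior power. -/
theorem ιMulti_mem_polyCurve {i : ℕ} {f : ℚ → Fin i → V}
    (hf : ∀ q, (fun s => f s q) ∈ polyCurve V) :
    (fun s => exteriorPower.ιMulti ℚ i (f s)) ∈ polyCurve (⋀[ℚ]^i V) := by
  have h : (fun s => ExteriorAlgebra.ιMulti ℚ i (f s)) ∈ polyCurve (ExteriorAlgebra ℚ V) := by
    induction i with
    | zero =>
      simp only [ExteriorAlgebra.ιMulti_zero_apply]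
      exact const_mem_polyCurve _
    | succ i ih =>
      simp only [ExteriorAlgebra.ιMulti_succ_apply]
      exact bilin_mem_polyCurve (LinearMap.mul ℚ (ExteriorAlgebra ℚ V))
        (map_mem_polyCurve _ (hf 0)) (ih (f := fun s => Matrix.vecTail (f s)) fun q => hf q.succ)
  obtain ⟨r, hr⟩ := (⋀[ℚ]^i V).subtype.exists_leftInverse_of_injective (Submodule.ker_subtype _)
  have h2 := map_mem_polyCurve r h
  have e : (fun s => r (ExteriorAlgebra.ιMulti ℚ i (f s))) =
      fun s => exteriorPower.ιMulti ℚ i (f s) :=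
    funext fun s => LinearMap.congr_fun hr (exteriorPower.ιMulti ℚ i (f s))
  rwa [e] at h2

/-- If `d s • ρ (g s)` is given by polynomials for `s ∈ S`, then so is the action on the exterior
power, up to the factor `d s ^ i`. -/
theorem exists_polyCurve_extRep {G : Type*} [Group G] (ρ : Representation ℚ G V) (g : ℚ → G)
    (d : ℚ → ℚ) (S : Set ℚ)
    (h : ∀ v, ∃ f ∈ polyCurve V, ∀ s ∈ S, f s = d s • ρ (g s) v) (i : ℕ) (w : ⋀[ℚ]^i V) :
    ∃ f ∈ polyCurve (⋀[ℚ]^i V), ∀ s ∈ S, f s = d s ^ i • extRep i ρ (g s) w := by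
  induction w using span_induction_ext with
  | hι v =>
    choose f hf hfs using h
    refine ⟨fun s => exteriorPower.ιMulti ℚ i fun q => f (v q) s,
      ιMulti_mem_polyCurve fun q => hf (v q), fun s hs => ?_⟩
    have e : (fun q => f (v q) s) = fun q => d s • ρ (g s) (v q) :=
      funext fun q => hfs (v q) s hs
    change exteriorPower.ιMulti ℚ i (fun q => f (v q) s) = _
    rw [e, ιMulti_smul, extRep_ιMulti]
  | h0 => exact ⟨0, Submodule.zero_mem _, fun s _ => by simp⟩
  | hadd x y hx hy =>
    obtain ⟨f, hf, hf'⟩ := hx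
    obtain ⟨k, hk, hk'⟩ := hy
    exact ⟨f + k, Submodule.add_mem _ hf hk, fun s hs => by
      rw [Pi.add_apply, hf' s hs, hk' s hs, map_add, smul_add]⟩
  | hsmul c x hx =>
    obtain ⟨f, hf, hf'⟩ := hx
    exact ⟨c • f, Submodule.smul_mem _ _ hf, fun s hs => by
      rw [Pi.smul_apply, hf' s hs, map_smul, smul_comm]⟩

/-- A subspace of an exterior power that is stable under `g s` for infinitely many `s` in a
polynomial family is stable under all `g s`. -/
theorem extRep_mem_of_infinite {G : Type*} [Group G] (ρ : Representation ℚ G V) (g : ℚ → G)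
    (d : ℚ → ℚ) (S : Set ℚ) (hd : ∀ s ∈ S, d s ≠ 0)
    (h : ∀ v, ∃ f ∈ polyCurve V, ∀ s ∈ S, f s = d s • ρ (g s) v) {i : ℕ}
    (N : Submodule ℚ (⋀[ℚ]^i V)) {T : Set ℚ} (hT : T.Infinite) (hTS : T ⊆ S)
    (hN : ∀ s ∈ T, ∀ w ∈ N, extRep i ρ (g s) w ∈ N) {s : ℚ} (hs : s ∈ S) {w : ⋀[ℚ]^i V}
    (hw : w ∈ N) : extRep i ρ (g s) w ∈ N := by
  obtain ⟨f, hf, hf'⟩ := exists_polyCurve_extRep ρ g d S h i w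
  have h1 := polyCurve_mem_of_infinite hf N (hT.mono fun t ht => by
    change f t ∈ N
    rw [hf' t (hTS ht)]
    exact Submodule.smul_mem _ _ (hN t ht w hw)) s
  rw [hf' s hs] at h1
  exact (Submodule.smul_mem_iff _ (pow_ne_zero i (hd s hs))).1 h1

end PolyCurve

/-! ### Generation of `GL(n, ℚ)` -/

/-- The classical relation `h(a) = w(a) w(-1)` with `w(a) = e(a) f(-a⁻¹) e(a)` in `SL_2`. -/
theorem diag2n_eq_prod_transvection {n : ℕ} {i j : Fin n} (hij : i ≠ j) (a : ℚ) (ha : a ≠ 0) :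
    Matrix.SpecialLinearGroup.diag2n hij a ha =
      Matrix.SpecialLinearGroup.transvection hij a *
      Matrix.SpecialLinearGroup.transvection hij.symm (-a⁻¹) *
      Matrix.SpecialLinearGroup.transvection hij a *
      Matrix.SpecialLinearGroup.transvection hij (-1) *
      Matrix.SpecialLinearGroup.transvection hij.symm 1 *
      Matrix.SpecialLinearGroup.transvection hij (-1) := by
  apply Subtype.ext
  simp only [Matrix.SpecialLinearGroup.coe_mul, Matrix.SpecialLinearGroup.transvection_coe,
    Matrix.SpecialLinearGroup.diag2n_coe, mul_add, add_mul, mul_one, one_mul,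
    Matrix.single_mul_single_same, Matrix.single_mul_single_of_ne _ _ _ _ hij,
    Matrix.single_mul_single_of_ne _ _ _ _ hij.symm, add_zero,
    mul_neg, neg_mul, mul_inv_cancel₀ ha, inv_mul_cancel₀ ha, neg_neg]
  ext k l
  simp only [Matrix.diagonal_apply, Matrix.add_apply, Matrix.one_apply, Matrix.single_apply]
  grind

/-- A family of invertible matrices containing the transvections and the matrices
`diag(s, 1, …, 1)`, closed under products, is everything. -/
theorem gl_induction {n : ℕ} (hn : 2 ≤ n) (D : ℚ → GL (Fin n) ℚ)
    (hD : ∀ s ≠ 0, (D s).1.det = s)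
    (P : GL (Fin n) ℚ → Prop) (hmul : ∀ a b, P a → P b → P (a * b))
    (htr : ∀ (i j : Fin n) (hij : i ≠ j) (c : ℚ),
      P (Matrix.SpecialLinearGroup.toGL (Matrix.SpecialLinearGroup.transvection hij c)))
    (hdiag : (∀ g : Matrix.SpecialLinearGroup (Fin n) ℚ, P (Matrix.SpecialLinearGroup.toGL g)) →
      ∀ s ≠ 0, P (D s)) (g : GL (Fin n) ℚ) : P g := by
  have : Nontrivial (Fin n) := Fin.nontrivial_iff_two_le.2 hn
  have hSL : ∀ g : Matrix.SpecialLinearGroup (Fin n) ℚ,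
      P (Matrix.SpecialLinearGroup.toGL g) := fun g => by
    refine Matrix.SpecialLinearGroup.diagonal_transvection_induction'
      (fun g => P (Matrix.SpecialLinearGroup.toGL g)) g (fun i j hij c hc => ?_) htr
      (fun A B hA hB => by rw [map_mul]; exact hmul _ _ hA hB)
    rw [diag2n_eq_prod_transvection]
    simp only [map_mul]
    exact hmul _ _ (hmul _ _ (hmul _ _ (hmul _ _ (hmul _ _ (htr _ _ _ _) (htr _ _ _ _))
      (htr _ _ _ _)) (htr _ _ _ _)) (htr _ _ _ _)) (htr _ _ _ _)
  have hg : g.1.det ≠ 0 := ((Matrix.isUnit_iff_isUnit_det _).1 g.isUnit).ne_zero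
  have h1 : ((D g.1.det)⁻¹ * g).1.det = 1 := by
    have h2 : (D g.1.det).1.det * ((D g.1.det)⁻¹ * g).1.det = g.1.det := by
      rw [← Matrix.det_mul, ← Units.val_mul, mul_inv_cancel_left]
    rw [hD _ hg] at h2
    exact mul_left_cancel₀ hg (h2.trans (mul_one _).symm)
  -- Splitting off a matrix with the same determinant leaves an element of `SL(n, ℚ)`.
  have e : g = D g.1.det * Matrix.SpecialLinearGroup.toGL ⟨_, h1⟩ := by
    have e2 : Matrix.SpecialLinearGroup.toGL (⟨_, h1⟩ : Matrix.SpecialLinearGroup (Fin n) ℚ) =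
        (D g.1.det)⁻¹ * g := Units.ext rfl
    rw [e2, mul_inv_cancel_left]
  rw [e]
  exact hmul _ _ (hdiag hSL _ hg) (hSL _)

end AlbaneseIO

end

noncomputable section

open scoped TensorProduct CategoryTheory

namespace AlbaneseIO

/-! ### The image of `H_i(IO_n, ℚ)` in `⋀^i U^O` is stable under `GL(n, ℚ)` -/

theorem extRep_eq_smul {G V : Type} [Group G] [AddCommGroup V] [Module ℚ V]
    (ρ : Representation ℚ G V) (g : G) (c : ℚ) (h : ∀ v, ρ g v = c • v) (i : ℕ) (w : ⋀[ℚ]^i V) :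
    extRep i ρ g w = c ^ i • w := by
  induction w using span_induction_ext with
  | hι v => rw [extRep_ιMulti, funext fun q => h (v q), ιMulti_smul]
  | h0 => rw [map_zero, smul_zero]
  | hadd x y hx hy => rw [map_add, hx, hy, smul_add]
  | hsmul a x hx => rw [map_smul, hx, smul_comm]

theorem linear_mem_polyCurve {V : Type} [AddCommGroup V] [Module ℚ V] (v : V) :
    (fun s : ℚ => s • v) ∈ polyCurve V := by
  simpa using smul_mem_polyCurve 1 (const_mem_polyCurve v)

theorem map_ext_mem_polyCurve {V W : Type} [AddCommGroup V] [Module ℚ V] [AddCommGroup W]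
    [Module ℚ W] {A : ℚ → V →ₗ[ℚ] W} (hA : ∀ v, (fun s => A s v) ∈ polyCurve W) {i : ℕ}
    (w : ⋀[ℚ]^i V) : (fun s => exteriorPower.map i (A s) w) ∈ polyCurve (⋀[ℚ]^i W) := by
  induction w using span_induction_ext with
  | hι v =>
    simp only [exteriorPower.map_apply_ιMulti]
    exact ιMulti_mem_polyCurve fun q => hA (v q)
  | h0 => simp only [map_zero]; exact Submodule.zero_mem _
  | hadd x y hx hy => simp only [map_add]; exact Submodule.add_mem _ hx hy
  | hsmul c x hx => simp only [map_smul]; exact Submodule.smul_mem _ _ hx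

theorem hom_mem_polyCurve {n : ℕ} {F : ℚ → U n}
    (hF : ∀ l, (fun s => F s (Pi.single l 1)) ∈ polyCurve (⋀[ℚ]^2 (H n))) : F ∈ polyCurve (U n) := by
  have e : F = ∑ l, fun s => (LinearMap.smulRightₗ (LinearMap.proj l : Module.Dual ℚ (H n)))
      (F s (Pi.single l 1)) := by
    funext s
    rw [Finset.sum_apply]
    refine (Pi.basisFun ℚ (Fin n)).ext fun k => ?_
    rw [Pi.basisFun_apply, LinearMap.sum_apply, Finset.sum_eq_single k]
    · simp
    · intro l _ hl
      simp [Pi.single_eq_of_ne hl]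
    · simp
  rw [e]
  exact Submodule.sum_mem _ fun l _ => map_mem_polyCurve _ (hF l)

/-- On `Hom(H, ⋀² H)` the inverse matrix enters exactly once, so a single factor `d s` clears the
denominators. -/
theorem exists_polyCurve_UORep {n : ℕ} (g : ℚ → GL (Fin n) ℚ) (d : ℚ → ℚ) (S : Set ℚ)
    (P Q : ℚ → H n →ₗ[ℚ] H n) (hP : ∀ v, (fun s => P s v) ∈ polyCurve (H n))
    (hQ : ∀ v, (fun s => Q s v) ∈ polyCurve (H n)) (hP' : ∀ s ∈ S, P s = stdRep n (g s))
    (hQ' : ∀ s ∈ S, Q s = d s • stdRep n (g s)⁻¹) (v : UO n) :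
    ∃ f ∈ polyCurve (UO n), ∀ s ∈ S, f s = d s • UORep n (g s) v := by
  obtain ⟨u, rfl⟩ := Submodule.Quotient.mk_surjective _ v
  let F : ℚ → U n := fun s => exteriorPower.map 2 (P s) ∘ₗ u ∘ₗ Q s
  have hF : F ∈ polyCurve (U n) := hom_mem_polyCurve fun l =>
    apply_mem_polyCurve (A := fun s => exteriorPower.map 2 (P s))
      (fun w => map_ext_mem_polyCurve hP w) (map_mem_polyCurve u (hQ _))
  refine ⟨_, map_mem_polyCurve (LinearMap.range (wedge n)).mkQ hF, fun s hs => ?_⟩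
  have e : F s = d s • URep n (g s) u := by
    refine LinearMap.ext fun h => ?_
    change exteriorPower.map 2 (P s) (u (Q s h)) =
      d s • exteriorPower.map 2 (stdRep n (g s)) (u (stdRep n (g s)⁻¹ h))
    rw [hP' s hs, hQ' s hs, LinearMap.smul_apply, map_smul, map_smul]
  rw [e, map_smul]
  rfl

theorem stdRep_transvection {n : ℕ} {k j : Fin n} (h : k ≠ j) (c : ℚ) (v : H n) :
    stdRep n (Matrix.SpecialLinearGroup.toGL (Matrix.SpecialLinearGroup.transvection h c)) v =
      v + c • (v j • (Pi.single k 1 : H n)) := by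
  change (Matrix.transvection k j c).mulVec v = _
  ext l
  rw [Matrix.transvection, Matrix.add_mulVec, Matrix.one_mulVec, Matrix.single_mulVec]
  by_cases hl : l = k <;> simp [hl]

/-! ### Diagonal and scalar matrices -/

/-- The matrix `diag(1, …, s, …, 1)` for `s ≠ 0`. -/
def diagGL {n : ℕ} (j : Fin n) (s : ℚ) : GL (Fin n) ℚ :=
  if h : s ≠ 0 then
    Matrix.GeneralLinearGroup.mkOfDetNeZero (Matrix.diagonal (Function.update 1 j s)) (by
      rw [Matrix.det_diagonal, Finset.prod_update_of_mem (Finset.mem_univ _)]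
      simpa using h)
  else 1

theorem coe_diagGL {n : ℕ} (j : Fin n) {s : ℚ} (hs : s ≠ 0) :
    (diagGL j s).1 = Matrix.diagonal (Function.update 1 j s) := by
  rw [diagGL, dif_pos hs]
  rfl

theorem det_diagGL {n : ℕ} (j : Fin n) {s : ℚ} (hs : s ≠ 0) : (diagGL j s).1.det = s := by
  rw [coe_diagGL j hs, Matrix.det_diagonal, Finset.prod_update_of_mem (Finset.mem_univ _)]
  simp

theorem stdRep_diagGL {n : ℕ} (j : Fin n) {s : ℚ} (hs : s ≠ 0) (v : H n) :
    stdRep n (diagGL j s) v = v + (s - 1) • (v j • (Pi.single j 1 : H n)) := by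
  change (diagGL j s).1.mulVec v = _
  rw [coe_diagGL j hs]
  ext l
  rw [Matrix.mulVec_diagonal]
  by_cases hl : l = j
  · subst hl; simp; ring
  · simp [hl]

theorem diagGL_inv {n : ℕ} (j : Fin n) {s : ℚ} (hs : s ≠ 0) :
    (diagGL j s)⁻¹ = diagGL j s⁻¹ := by
  rw [inv_eq_iff_mul_eq_one]
  apply Units.ext
  rw [Units.val_mul, coe_diagGL j hs, coe_diagGL j (inv_ne_zero hs), Matrix.diagonal_mul_diagonal,
    Units.val_one, ← Matrix.diagonal_one]
  congr 1
  funext l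
  by_cases hl : l = j
  · subst hl; simp [hs]
  · simp [hl]

/-- The scalar matrix `c`. -/
def scalarGL (n : ℕ) (c : ℚˣ) : GL (Fin n) ℚ :=
  Units.map (Matrix.scalar (Fin n)).toMonoidHom c

theorem stdRep_scalarGL (n : ℕ) (c : ℚˣ) (v : H n) : stdRep n (scalarGL n c) v = (c : ℚ) • v := by
  change (Matrix.scalar (Fin n) (c : ℚ)).mulVec v = _
  ext l
  simp [Matrix.mulVec_diagonal]

theorem det_scalarGL (n : ℕ) (c : ℚˣ) : (scalarGL n c).1.det = (c : ℚ) ^ n := by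
  change (Matrix.scalar (Fin n) (c : ℚ)).det = _
  simp

/-- Two factors c come from `⋀² H` and one `c⁻¹` from the dual of H. -/
theorem UORep_scalarGL (n : ℕ) (c : ℚˣ) (v : UO n) :
    UORep n (scalarGL n c) v = (c : ℚ) • v := by
  obtain ⟨u, rfl⟩ := Submodule.Quotient.mk_surjective _ v
  have h : URep n (scalarGL n c) u = (c : ℚ) • u := by
    refine LinearMap.ext fun x => ?_
    rw [URep_apply, extRep_eq_smul (stdRep n) (scalarGL n c) c (stdRep_scalarGL n c)]
    have e : stdRep n (scalarGL n c)⁻¹ x = ((c⁻¹ : ℚˣ) : ℚ) • x := by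
      rw [← stdRep_scalarGL]
      congr 1
    rw [e, map_smul, smul_smul, LinearMap.smul_apply, pow_two, mul_assoc, Units.mul_inv, mul_one]
  rw [UORep_mk, h]
  rfl

theorem exists_polyCurve_transvection {n : ℕ} {k j : Fin n} (hkj : k ≠ j) (v : UO n) :
    ∃ f ∈ polyCurve (UO n), ∀ s ∈ (Set.univ : Set ℚ), f s = (1 : ℚ) • UORep n
      (Matrix.SpecialLinearGroup.toGL (Matrix.SpecialLinearGroup.transvection hkj s)) v := by
  have hT : ∀ (c : ℚ), (Matrix.SpecialLinearGroup.toGL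
      (Matrix.SpecialLinearGroup.transvection hkj c))⁻¹ =
      Matrix.SpecialLinearGroup.toGL (Matrix.SpecialLinearGroup.transvection hkj (-c)) := fun c => by
    rw [← map_inv, Matrix.SpecialLinearGroup.transvection_inv]
  refine exists_polyCurve_UORep
    (fun c => Matrix.SpecialLinearGroup.toGL (Matrix.SpecialLinearGroup.transvection hkj c))
    (fun _ => 1) Set.univ
    (fun c => stdRep n (Matrix.SpecialLinearGroup.toGL
      (Matrix.SpecialLinearGroup.transvection hkj c)))
    (fun c => stdRep n (Matrix.SpecialLinearGroup.toGL
      (Matrix.SpecialLinearGroup.transvection hkj (-c)))) (fun v => ?_) (fun v => ?_)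
    (fun _ _ => rfl) (fun s _ => by rw [one_smul, hT]) v
  · simp only [stdRep_transvection]
    exact Submodule.add_mem _ (const_mem_polyCurve v) (linear_mem_polyCurve _)
  · simp only [stdRep_transvection, neg_smul]
    exact Submodule.add_mem _ (const_mem_polyCurve v)
      (Submodule.neg_mem _ (linear_mem_polyCurve _))

theorem exists_polyCurve_diagGL {n : ℕ} (j : Fin n) (v : UO n) :
    ∃ f ∈ polyCurve (UO n), ∀ s ∈ {s : ℚ | s ≠ 0}, f s = s • UORep n (diagGL j s) v := by
  let p : H n →ₗ[ℚ] H n :=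
    (LinearMap.proj j : Module.Dual ℚ (H n)).smulRight (Pi.single j 1 : H n)
  have hp : ∀ v : H n, v j • (Pi.single j 1 : H n) = p v := fun v => rfl
  refine exists_polyCurve_UORep (diagGL j) (fun s => s) {s | s ≠ 0}
    (fun s => LinearMap.id + (s - 1) • p) (fun s => s • LinearMap.id + (1 - s) • p)
    (fun v => ?_) (fun v => ?_)
    (fun s hs => LinearMap.ext fun v => (stdRep_diagGL j hs v).symm)
    (fun s hs => LinearMap.ext fun v => ?_) v
  · simp only [LinearMap.add_apply, LinearMap.smul_apply, LinearMap.id_apply, sub_smul, one_smul]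
    exact Submodule.add_mem _ (const_mem_polyCurve v)
      (Submodule.sub_mem _ (linear_mem_polyCurve _) (const_mem_polyCurve _))
  · simp only [LinearMap.add_apply, LinearMap.smul_apply, LinearMap.id_apply, sub_smul, one_smul]
    exact Submodule.add_mem _ (linear_mem_polyCurve _)
      (Submodule.sub_mem _ (const_mem_polyCurve _) (linear_mem_polyCurve _))
  · have hs' : s ≠ 0 := hs
    rw [LinearMap.smul_apply, diagGL_inv j hs', stdRep_diagGL j (inv_ne_zero hs'), smul_add,
      smul_smul, mul_sub, mul_inv_cancel₀ hs', mul_one, hp]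
    rfl

/-- A diagonal matrix whose determinant is an n-th power is a scalar times an element of `SL(n, ℚ)`.
The base `d + 1` keeps the scalar nonzero. -/
theorem exists_diagGL_eq_scalarGL_mul {n : ℕ} (j : Fin n) (d : ℕ) :
    ∃ (c : ℚˣ) (A : Matrix.SpecialLinearGroup (Fin n) ℚ),
      diagGL j (((d : ℚ) + 1) ^ n) = scalarGL n c * Matrix.SpecialLinearGroup.toGL A := by
  have hd : (d : ℚ) + 1 ≠ 0 := by positivity
  let c : ℚˣ := Units.mk0 _ hd
  have h1 : ((scalarGL n c)⁻¹ * diagGL j (((d : ℚ) + 1) ^ n)).1.det = 1 := by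
    have h2 : (scalarGL n c).1.det *
        ((scalarGL n c)⁻¹ * diagGL j (((d : ℚ) + 1) ^ n)).1.det = ((d : ℚ) + 1) ^ n := by
      rw [← Matrix.det_mul, ← Units.val_mul, mul_inv_cancel_left,
        det_diagGL j (pow_ne_zero n hd)]
    rw [det_scalarGL] at h2
    exact mul_left_cancel₀ (pow_ne_zero n hd) (h2.trans (mul_one _).symm)
  refine ⟨c, ⟨_, h1⟩, ?_⟩
  have e2 : Matrix.SpecialLinearGroup.toGL
      (⟨_, h1⟩ : Matrix.SpecialLinearGroup (Fin n) ℚ) =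
      (scalarGL n c)⁻¹ * diagGL j (((d : ℚ) + 1) ^ n) := Units.ext rfl
  rw [e2, mul_inv_cancel_left]

/-- Stability under integral transvections spreads to the whole group by two density arguments:
along each transvection line, and along the torus `diag(s, 1, …, 1)`. -/
theorem extRep_mem_of_stable {n i : ℕ} (hn : 2 ≤ n) {V : Type} [AddCommGroup V] [Module ℚ V]
    (ρ : Representation ℚ (GL (Fin n) ℚ) V)
    (hρ : ∀ {k j : Fin n} (hkj : k ≠ j) (v : V), ∃ f ∈ polyCurve V, ∀ s ∈ (Set.univ : Set ℚ),
      f s = (1 : ℚ) • ρ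
        (Matrix.SpecialLinearGroup.toGL (Matrix.SpecialLinearGroup.transvection hkj s)) v)
    (hρ' : ∀ (j : Fin n) (v : V), ∃ f ∈ polyCurve V, ∀ s ∈ {s : ℚ | s ≠ 0},
      f s = s • ρ (diagGL j s) v)
    (hc : ∀ (c : ℚˣ) v, ρ (scalarGL n c) v = (c : ℚ) • v) (N : Submodule ℚ (⋀[ℚ]^i V))
    (hN : ∀ {k j : Fin n} (h : k ≠ j) (t : ℤ), ∀ w ∈ N,
      extRep i ρ (autToGLQ n (transvAut h t)) w ∈ N) (g : GL (Fin n) ℚ) :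
    ∀ w ∈ N, extRep i ρ g w ∈ N := by
  let j₀ : Fin n := ⟨0, by omega⟩
  have hmul : ∀ a b : GL (Fin n) ℚ, (∀ w ∈ N, extRep i ρ a w ∈ N) →
      (∀ w ∈ N, extRep i ρ b w ∈ N) → ∀ w ∈ N, extRep i ρ (a * b) w ∈ N := by
    intro a b ha hb w hw
    rw [map_mul]
    exact ha _ (hb _ hw)
  have htr : ∀ (k j : Fin n) (hkj : k ≠ j) (c : ℚ), ∀ w ∈ N, extRep i ρ
      (Matrix.SpecialLinearGroup.toGL (Matrix.SpecialLinearGroup.transvection hkj c)) w ∈ N := by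
    intro k j hkj c w hw
    have key := extRep_mem_of_infinite ρ
      (fun c => Matrix.SpecialLinearGroup.toGL (Matrix.SpecialLinearGroup.transvection hkj c))
      (fun _ => 1) Set.univ (fun _ _ => one_ne_zero) (hρ hkj) N
      -- The integers are infinitely many parameters, and at them the transvection comes from an
      -- automorphism of the free group.
      (T := Set.range fun t : ℤ => (t : ℚ))
      (Set.infinite_range_of_injective Int.cast_injective) (Set.subset_univ _)
    refine key ?_ (Set.mem_univ c) hw
    rintro _ ⟨t, rfl⟩ w hw
    have e : Matrix.SpecialLinearGroup.toGL
        (Matrix.SpecialLinearGroup.transvection hkj ((t : ℤ) : ℚ)) =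
        autToGLQ n (transvAut hkj t) := Units.ext (autToGLQ_transvAut hkj t).symm
    exact (congrArg (fun g => extRep i ρ g w ∈ N) e).mpr (hN hkj t w hw)
  refine gl_induction hn (diagGL j₀) (fun s hs => det_diagGL j₀ hs)
    (fun g => ∀ w ∈ N, extRep i ρ g w ∈ N) hmul htr
    (fun hSL s hs w hw => ?_) g
  have key := extRep_mem_of_infinite ρ (diagGL j₀) (fun s => s) {s | s ≠ 0} (fun _ h => h)
    (hρ' j₀) N
    -- At these parameters stability is already known: `SL(n, ℚ)` has been treated and scalars
    -- preserve every subspace.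
    (T := Set.range fun d : ℕ => ((d : ℚ) + 1) ^ n) (Set.infinite_range_of_injective (by
      intro a b hab
      have h1 := (pow_left_inj₀ (by positivity) (by positivity) (by omega : n ≠ 0)).1 hab
      exact_mod_cast add_right_cancel h1)) (by
      rintro _ ⟨d, rfl⟩
      change ((d : ℚ) + 1) ^ n ≠ 0
      positivity)
  refine key ?_ hs hw
  rintro _ ⟨d, rfl⟩ w hw
  obtain ⟨c, A, e⟩ := exists_diagGL_eq_scalarGL_mul j₀ d
  refine (congrArg (fun g => extRep i ρ g w ∈ N) e).mpr ?_
  refine hmul _ _ (fun w hw => ?_) (hSL _) w hw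
  have h3 := extRep_eq_smul ρ (scalarGL n c) c (hc c) i w
  exact (congrArg (fun z => z ∈ N) h3).mpr (Submodule.smul_mem N _ hw)

theorem extRep_UORep_mem_range {n i : ℕ} (hn : 2 ≤ n) (g : GL (Fin n) ℚ) (w : ⋀[ℚ]^i (UO n))
    (hw : w ∈ LinearMap.range (homologyToExt (johnsonOut n) i)) :
    extRep i (UORep n) g w ∈ LinearMap.range (homologyToExt (johnsonOut n) i) := by
  refine extRep_mem_of_stable hn (UORep n) exists_polyCurve_transvection exists_polyCurve_diagGL
    (UORep_scalarGL n) _ (fun h t w hw => ?_) g w hw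
  obtain ⟨c, rfl⟩ := hw
  exact ⟨_, homologyToExt_conjAction n i ((transvAut h t : MulAut (F n)) : OutF n) c⟩

end AlbaneseIO

end

noncomputable section

open scoped TensorProduct CategoryTheory

namespace AlbaneseIO

/-! ### Submodules of `⋀^r H` and `Hom(H, ⋀^r H)` stable under `GL(n, ℚ)` -/

/-- The permutation matrix with `e_j ↦ e_{σ j}`. -/
def permGL {n : ℕ} (σ : Equiv.Perm (Fin n)) : GL (Fin n) ℚ :=
  Matrix.GeneralLinearGroup.toLin.symm
    (LinearMap.GeneralLinearGroup.ofLinearEquiv (LinearEquiv.funCongrLeft ℚ ℚ σ.symm))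

theorem stdRep_permGL {n : ℕ} (σ : Equiv.Perm (Fin n)) (v : H n) :
    stdRep n (permGL σ) v = v ∘ σ.symm := by
  have h : Matrix.GeneralLinearGroup.toLin (permGL σ) =
      LinearMap.GeneralLinearGroup.ofLinearEquiv (LinearEquiv.funCongrLeft ℚ ℚ σ.symm) :=
    MulEquiv.apply_symm_apply _ _
  exact LinearMap.congr_fun (congrArg Units.val h) v

theorem stdRep_permGL_single {n : ℕ} (σ : Equiv.Perm (Fin n)) (j : Fin n) :
    stdRep n (permGL σ) (Pi.single j 1) = Pi.single (σ j) 1 := by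
  rw [stdRep_permGL]
  funext k
  simp [Pi.single_apply, Equiv.symm_apply_eq]

theorem permGL_inv {n : ℕ} (σ : Equiv.Perm (Fin n)) : (permGL σ)⁻¹ = permGL σ⁻¹ := by
  rw [permGL, ← map_inv]
  rfl

/-- The element `e_{κ 0} ∧ ⋯ ∧ e_{κ (r - 1)}` of `⋀^r H`. -/
def basisWedge {n r : ℕ} (κ : Fin r → Fin n) : ⋀[ℚ]^r (H n) :=
  exteriorPower.ιMulti ℚ r fun q => Pi.single (κ q) 1

theorem extHRep_permGL {n r : ℕ} (σ : Equiv.Perm (Fin n)) (κ : Fin r → Fin n) :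
    extHRep n r (permGL σ) (basisWedge κ) = basisWedge (σ ∘ κ) := by
  rw [extHRep, basisWedge, extRep_ιMulti]
  simp only [stdRep_permGL_single]
  rfl

theorem exists_perm_comp_eq {n r : ℕ} {κ μ : Fin r → Fin n} (hκ : Function.Injective κ)
    (hμ : Function.Injective μ) : ∃ σ : Equiv.Perm (Fin n), σ ∘ κ = μ := by
  have := Equiv.Perm.isMultiplyPretransitive (Fin n) r
  obtain ⟨σ, h⟩ := MulAction.exists_smul_eq (Equiv.Perm (Fin n))
    (⟨κ, hκ⟩ : Fin r ↪ Fin n) ⟨μ, hμ⟩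
  exact ⟨σ, funext fun q => DFunLike.congr_fun h q⟩

theorem eq_top_of_basisWedge_mem {n r : ℕ} (M : Submodule ℚ (⋀[ℚ]^r (H n)))
    (h : ∀ κ : Fin r → Fin n, Function.Injective κ → basisWedge κ ∈ M) : M = ⊤ := by
  have h0 : M.mkQ = 0 := by
    refine exteriorPower.linearMap_ext (Module.Basis.ext_alternating (Pi.basisFun ℚ (Fin n))
      fun κ hκ => ?_)
    simp only [Pi.basisFun_apply]
    exact (Submodule.Quotient.mk_eq_zero M).2 (h κ hκ)
  rw [← M.ker_mkQ, h0, LinearMap.ker_zero]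

/-- Permutation matrices already act transitively on the tuples of distinct basis vectors. -/
theorem eq_top_of_stable_ext {n r : ℕ} (M : Submodule ℚ (⋀[ℚ]^r (H n)))
    (hM : ∀ g, ∀ w ∈ M, extHRep n r g w ∈ M) {κ : Fin r → Fin n} (hκ : Function.Injective κ)
    (h : basisWedge κ ∈ M) : M = ⊤ := by
  refine eq_top_of_basisWedge_mem M fun μ hμ => ?_
  obtain ⟨σ, rfl⟩ := exists_perm_comp_eq hκ hμ
  rw [← extHRep_permGL]
  exact hM _ _ h

/-- The element `e_b^* ⊗ (e_{κ 0} ∧ ⋯ ∧ e_{κ (r - 1)})` of `Hom(H, ⋀^r H)`. -/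
def elementary {n r : ℕ} (b : Fin n) (κ : Fin r → Fin n) : H n →ₗ[ℚ] ⋀[ℚ]^r (H n) :=
  (LinearMap.proj b : Module.Dual ℚ (H n)).smulRight (basisWedge κ)

theorem elementary_apply {n r : ℕ} (b : Fin n) (κ : Fin r → Fin n) (h : H n) :
    elementary b κ h = h b • basisWedge κ := rfl

theorem homExtHRep_apply {n r : ℕ} (g : GL (Fin n) ℚ) (A : H n →ₗ[ℚ] ⋀[ℚ]^r (H n)) (h : H n) :
    homExtHRep n r g A h = extHRep n r g (A (stdRep n g⁻¹ h)) := rfl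

theorem homExtHRep_permGL {n r : ℕ} (σ : Equiv.Perm (Fin n)) (b : Fin n) (κ : Fin r → Fin n) :
    homExtHRep n r (permGL σ) (elementary b κ) = elementary (σ b) (σ ∘ κ) := by
  refine LinearMap.ext fun h => ?_
  rw [homExtHRep_apply, elementary_apply, elementary_apply, map_smul, extHRep_permGL, permGL_inv,
    stdRep_permGL]
  rfl

theorem eq_top_of_elementary_mem {n r : ℕ} (N : Submodule ℚ (H n →ₗ[ℚ] ⋀[ℚ]^r (H n)))
    (h : ∀ b (κ : Fin r → Fin n), Function.Injective κ → elementary b κ ∈ N) : N = ⊤ := by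
  refine eq_top_iff.2 fun A _ => ?_
  have e : A = ∑ b, (LinearMap.proj b : Module.Dual ℚ (H n)).smulRight (A (Pi.single b 1)) := by
    refine (Pi.basisFun ℚ (Fin n)).ext fun k => ?_
    rw [Pi.basisFun_apply, LinearMap.sum_apply, Finset.sum_eq_single k]
    · simp
    · intro l _ hl
      simp [Pi.single_eq_of_ne hl]
    · simp
  rw [e]
  refine Submodule.sum_mem _ fun b _ => ?_
  have hb : N.comap (LinearMap.smulRightₗ (LinearMap.proj b : Module.Dual ℚ (H n))) = ⊤ :=
    eq_top_of_basisWedge_mem _ fun κ hκ => h b κ hκ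
  exact Submodule.eq_top_iff'.1 hb _

theorem elementary_comp_perm {n r : ℕ} (b : Fin n) (κ : Fin r → Fin n) (σ : Equiv.Perm (Fin r)) :
    elementary b (κ ∘ σ) = ((Equiv.Perm.sign σ : ℤ) : ℚ) • elementary b κ := by
  refine LinearMap.ext fun h => ?_
  have e : basisWedge (κ ∘ σ) = ((Equiv.Perm.sign σ : ℤ) : ℚ) • basisWedge κ := by
    have h1 := (exteriorPower.ιMulti ℚ r (M := H n)).map_perm
      (fun q => (Pi.single (κ q) 1 : H n)) σ
    rw [Units.smul_def, ← Int.cast_smul_eq_zsmul ℚ] at h1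
    exact h1
  rw [LinearMap.smul_apply, elementary_apply, elementary_apply, e, smul_comm]

/-- The matrix with `e_t ↦ e_t + e_a`, applied to `e_a^* ⊗ e_a ∧ w - e_t^* ⊗ e_t ∧ w`. -/
theorem homExtHRep_transvection {n r : ℕ} {a t : Fin n} (hat : a ≠ t) {κ : Fin r → Fin n}
    (ht : t ∉ Set.range κ) :
    homExtHRep n (r + 1)
        (Matrix.SpecialLinearGroup.toGL (Matrix.SpecialLinearGroup.transvection hat 1))
        (elementary a (Fin.cons a κ : Fin (r + 1) → Fin n) +
          (-1 : ℚ) • elementary t (Fin.cons t κ : Fin (r + 1) → Fin n)) =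
      elementary a (Fin.cons a κ : Fin (r + 1) → Fin n) +
          (-1 : ℚ) • elementary t (Fin.cons t κ : Fin (r + 1) → Fin n) +
        (-2 : ℚ) • elementary t (Fin.cons a κ : Fin (r + 1) → Fin n) := by
  set g := Matrix.SpecialLinearGroup.toGL (Matrix.SpecialLinearGroup.transvection hat (1 : ℚ))
  have hg : ∀ v : H n, stdRep n g v = v + v t • (Pi.single a 1 : H n) := fun v => by
    rw [stdRep_transvection, one_smul]
  have hgi : ∀ v : H n, stdRep n g⁻¹ v = v + -(v t) • (Pi.single a 1 : H n) := fun v => by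
    have e : g⁻¹ = Matrix.SpecialLinearGroup.toGL
        (Matrix.SpecialLinearGroup.transvection hat (-1 : ℚ)) := by
      rw [← map_inv, Matrix.SpecialLinearGroup.transvection_inv]
    rw [e, stdRep_transvection, neg_one_smul, neg_smul]
  have hga : ∀ v : H n, stdRep n g⁻¹ v a = v a + -(v t) := fun v => by
    rw [hgi, Pi.add_apply, Pi.smul_apply, Pi.single_eq_same, smul_eq_mul, mul_one]
  have hgt : ∀ v : H n, stdRep n g⁻¹ v t = v t := fun v => by
    rw [hgi, Pi.add_apply, Pi.smul_apply, Pi.single_eq_of_ne hat.symm, smul_zero, add_zero]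
  have hκ : ∀ q, stdRep n g (Pi.single (κ q) 1) = Pi.single (κ q) 1 := fun q => by
    rw [hg, Pi.single_eq_of_ne (fun h => ht ⟨q, h.symm⟩), zero_smul, add_zero]
  have h1 : extHRep n (r + 1) g (basisWedge (Fin.cons a κ : Fin (r + 1) → Fin n)) =
      basisWedge (Fin.cons a κ : Fin (r + 1) → Fin n) := by
    rw [extHRep, basisWedge, extRep_ιMulti]
    congr 1
    funext q
    refine Fin.cases ?_ (fun q => ?_) q
    · rw [Fin.cons_zero, hg, Pi.single_eq_of_ne hat.symm, zero_smul, add_zero]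
    · rw [Fin.cons_succ, hκ]
  have h2 : extHRep n (r + 1) g (basisWedge (Fin.cons t κ : Fin (r + 1) → Fin n)) =
      basisWedge (Fin.cons t κ : Fin (r + 1) → Fin n) +
        basisWedge (Fin.cons a κ : Fin (r + 1) → Fin n) := by
    have h3 := (exteriorPower.ιMulti ℚ (r + 1) (M := H n)).map_update_add
      (fun q => (Pi.single ((Fin.cons t κ : Fin (r + 1) → Fin n) q) 1 : H n)) 0
      (Pi.single t 1) (Pi.single a 1)
    have e : ∀ x : H n, ∀ b : Fin n, Function.update
        (fun q => (Pi.single ((Fin.cons b κ : Fin (r + 1) → Fin n) q) 1 : H n)) 0 x =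
        Fin.cons x fun q => Pi.single (κ q) 1 := fun x b => by
      funext q
      refine Fin.cases ?_ (fun q => ?_) q
      · simp
      · simp
    have e' : ∀ b : Fin n, (fun q => (Pi.single ((Fin.cons b κ : Fin (r + 1) → Fin n) q) 1 : H n)) =
        Fin.cons (Pi.single b 1) fun q => Pi.single (κ q) 1 := fun b => by
      funext q
      refine Fin.cases ?_ (fun q => ?_) q
      · simp
      · simp
    rw [e, e, e] at h3
    rw [extHRep, basisWedge, basisWedge, extRep_ιMulti, e', e', ← h3]
    congr 1
    funext q
    refine Fin.cases ?_ (fun q => ?_) q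
    · rw [Fin.cons_zero, Fin.cons_zero, hg, Pi.single_eq_same, one_smul]
    · rw [Fin.cons_succ, Fin.cons_succ, hκ]
  refine LinearMap.ext fun h => ?_
  simp only [homExtHRep_apply, LinearMap.add_apply, LinearMap.smul_apply, elementary_apply,
    map_add, map_smul, h1, h2, hga, hgt]
  module

/-- The target has a traceless and a trace constituent. Two different coefficients make X visible in
the former and a nonzero coefficient sum in the latter; the proof extracts basis elements directly,
without complete reducibility. -/
theorem eq_top_of_stable_hom {n r : ℕ} (N : Submodule ℚ (H n →ₗ[ℚ] ⋀[ℚ]^(r + 1) (H n)))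
    (hN : ∀ g, ∀ A ∈ N, homExtHRep n (r + 1) g A ∈ N) {κ : Fin r → Fin n}
    (hκ : Function.Injective κ) {X : H n →ₗ[ℚ] ⋀[ℚ]^(r + 1) (H n)} (hX : X ∈ N) (v : Fin n → ℚ)
    (hv : ∀ j, X (Pi.single j 1) = v j • basisWedge (Fin.cons j κ : Fin (r + 1) → Fin n))
    {a t : Fin n} (hat : a ≠ t) (ha : a ∉ Set.range κ) (ht : t ∉ Set.range κ) (hvat : v a ≠ v t)
    (hsum : ∑ j ∈ (Finset.univ.image κ)ᶜ, v j ≠ 0) : N = ⊤ := by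
  have hneg : ∀ A ∈ N, ∀ B, A + B ∈ N → B ∈ N := fun A hA B hB => by
    have h := N.add_mem hB (N.smul_mem (-1) hA)
    have e : A + B + (-1 : ℚ) • A = B := LinearMap.ext fun h => by
      simp only [LinearMap.add_apply, LinearMap.smul_apply]; module
    rwa [e] at h
  have hX' : X = ∑ j ∈ (Finset.univ.image κ)ᶜ,
      v j • elementary j (Fin.cons j κ : Fin (r + 1) → Fin n) := by
    refine (Pi.basisFun ℚ (Fin n)).ext fun k => ?_
    rw [Pi.basisFun_apply, LinearMap.sum_apply, hv]
    by_cases hk : k ∈ Set.range κ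
    · obtain ⟨q, rfl⟩ := hk
      have h0 : basisWedge (Fin.cons (κ q) κ : Fin (r + 1) → Fin n) = 0 :=
        (exteriorPower.ιMulti ℚ (r + 1) (M := H n)).map_eq_zero_of_eq _ (i := 0) (j := q.succ)
          (by simp) (Fin.succ_ne_zero q).symm
      rw [h0, smul_zero]
      refine (Finset.sum_eq_zero fun l hl => ?_).symm
      have hl' : l ≠ κ q := fun e => by simp [e] at hl
      rw [LinearMap.smul_apply, elementary_apply, Pi.single_eq_of_ne hl', zero_smul, smul_zero]
    · rw [Finset.sum_eq_single k]
      · rw [LinearMap.smul_apply, elementary_apply, Pi.single_eq_same, one_smul]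
      · intro l _ hl
        rw [LinearMap.smul_apply, elementary_apply, Pi.single_eq_of_ne hl, zero_smul, smul_zero]
      · intro h
        exact absurd (by simpa using fun q hq => hk ⟨q, hq⟩) h
  -- The transposition of a and t fixes κ and changes X only in these two coefficients, so X minus
  -- its image is `v a - v t` times this difference.
  have hD : elementary a (Fin.cons a κ : Fin (r + 1) → Fin n) +
      (-1 : ℚ) • elementary t (Fin.cons t κ : Fin (r + 1) → Fin n) ∈ N := by
    have h1 := N.add_mem hX (N.smul_mem (-1) (hN (permGL (Equiv.swap a t)) X hX))
    have e : X + (-1 : ℚ) • homExtHRep n (r + 1) (permGL (Equiv.swap a t)) X =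
        (v a - v t) • (elementary a (Fin.cons a κ : Fin (r + 1) → Fin n) +
          (-1 : ℚ) • elementary t (Fin.cons t κ : Fin (r + 1) → Fin n)) := by
      have hsκ : ∀ q, Equiv.swap a t (κ q) = κ q := fun q =>
        Equiv.swap_apply_of_ne_of_ne (fun h => ha ⟨q, h⟩) (fun h => ht ⟨q, h⟩)
      refine (Pi.basisFun ℚ (Fin n)).ext fun k => ?_
      have hc : (Equiv.swap a t) ∘ (Fin.cons (Equiv.swap a t k) κ : Fin (r + 1) → Fin n) =
          Fin.cons k κ := by
        funext q
        refine Fin.cases ?_ (fun q => ?_) q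
        · simp
        · simp [hsκ]
      simp only [Pi.basisFun_apply, LinearMap.add_apply, LinearMap.smul_apply, homExtHRep_apply,
        permGL_inv, stdRep_permGL_single, Equiv.swap_inv, hv, map_smul, extHRep_permGL, hc,
        elementary_apply]
      by_cases hka : k = a
      · subst hka
        rw [Equiv.swap_apply_left, Pi.single_eq_same, Pi.single_eq_of_ne hat.symm]
        module
      by_cases hkt : k = t
      · subst hkt
        rw [Equiv.swap_apply_right, Pi.single_eq_same, Pi.single_eq_of_ne hat]
        module
      · rw [Equiv.swap_apply_of_ne_of_ne hka hkt, Pi.single_eq_of_ne (Ne.symm hka),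
          Pi.single_eq_of_ne (Ne.symm hkt)]
        module
    rw [e] at h1
    exact (Submodule.smul_mem_iff _ (sub_ne_zero.2 hvat)).1 h1
  -- The transvection `e_t ↦ e_t + e_a` changes the traceless difference by `-2` times an
  -- off-diagonal element.
  have hoff : elementary t (Fin.cons a κ : Fin (r + 1) → Fin n) ∈ N := by
    have h1 := hN (Matrix.SpecialLinearGroup.toGL (Matrix.SpecialLinearGroup.transvection hat 1))
      _ hD
    rw [homExtHRep_transvection hat ht] at h1
    exact (Submodule.smul_mem_iff _ (by norm_num : (-2 : ℚ) ≠ 0)).1 (hneg _ hD _ h1)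
  have hinj : ∀ {b : Fin n}, b ∉ Set.range κ →
      Function.Injective (Fin.cons b κ : Fin (r + 1) → Fin n) := fun hb =>
    Fin.cons_injective_iff.2 ⟨hb, hκ⟩
  have hinj2 : Function.Injective
      (Fin.cons t (Fin.cons a κ : Fin (r + 1) → Fin n) : Fin (r + 2) → Fin n) := by
    refine Fin.cons_injective_iff.2 ⟨?_, hinj ha⟩
    rintro ⟨q, hq⟩
    revert hq
    refine Fin.cases (fun h => hat (by simpa using h)) (fun q h => ht ⟨q, by simpa using h⟩) q
  -- Permuting the difference lets every diagonal term of X be replaced by the one at a, which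
  -- leaves `(∑ v j)` times it.
  have hdiag : elementary a (Fin.cons a κ : Fin (r + 1) → Fin n) ∈ N := by
    have hj : ∀ j ∈ (Finset.univ.image κ)ᶜ,
        elementary a (Fin.cons a κ : Fin (r + 1) → Fin n) +
        (-1 : ℚ) • elementary j (Fin.cons j κ : Fin (r + 1) → Fin n) ∈ N := by
      intro j hj
      have hj' : j ∉ Set.range κ := by
        rintro ⟨q, rfl⟩
        simp at hj
      by_cases haj : j = a
      · subst haj
        convert N.zero_mem
        refine LinearMap.ext fun h => ?_
        simp only [LinearMap.add_apply, LinearMap.smul_apply, LinearMap.zero_apply]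
        module
      · have hinj3 : Function.Injective
            (Fin.cons j (Fin.cons a κ : Fin (r + 1) → Fin n) : Fin (r + 2) → Fin n) := by
          refine Fin.cons_injective_iff.2 ⟨?_, hinj ha⟩
          rintro ⟨q, hq⟩
          revert hq
          refine Fin.cases (fun h => haj (by simpa using h.symm))
            (fun q h => hj' ⟨q, by simpa using h⟩) q
        obtain ⟨σ, hσ⟩ := exists_perm_comp_eq hinj2 hinj3
        have s1 : σ t = j := by simpa using congrFun hσ 0
        have s2 : σ a = a := by simpa using congrFun hσ (Fin.succ 0)
        have s3 : ∀ q, σ (κ q) = κ q := fun q => by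
          simpa using congrFun hσ (Fin.succ (Fin.succ q))
        have hc : ∀ b, σ ∘ (Fin.cons b κ : Fin (r + 1) → Fin n) = Fin.cons (σ b) κ := fun b => by
          funext q
          refine Fin.cases ?_ (fun q => ?_) q
          · simp
          · simp [s3]
        have h1 := hN (permGL σ) _ hD
        rw [map_add, map_smul, homExtHRep_permGL, homExtHRep_permGL, hc, hc, s1, s2] at h1
        exact h1
    have h1 := N.add_mem hX (Submodule.sum_mem N fun j hj' => N.smul_mem (v j) (hj j hj'))
    rw [hX', ← Finset.sum_add_distrib] at h1
    have e : ∀ j, v j • elementary j (Fin.cons j κ : Fin (r + 1) → Fin n) +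
        v j • (elementary a (Fin.cons a κ : Fin (r + 1) → Fin n) +
          (-1 : ℚ) • elementary j (Fin.cons j κ : Fin (r + 1) → Fin n)) =
        v j • elementary a (Fin.cons a κ : Fin (r + 1) → Fin n) := fun j =>
      LinearMap.ext fun h => by
        simp only [LinearMap.add_apply, LinearMap.smul_apply]; module
    rw [Finset.sum_congr rfl fun j _ => e j, ← Finset.sum_smul] at h1
    exact (Submodule.smul_mem_iff _ hsum).1 h1
  -- Every basis element is, up to sign, a permuted copy of the diagonal one if b occurs in μ, and
  -- of the off-diagonal one otherwise.
  refine eq_top_of_elementary_mem N fun b μ hμ => ?_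
  by_cases hb : b ∈ Set.range μ
  · obtain ⟨q, rfl⟩ := hb
    obtain ⟨σ, hσ⟩ := exists_perm_comp_eq (hinj ha) (hμ.comp (Equiv.swap 0 q).injective)
    have h1 := hN (permGL σ) _ hdiag
    have hs : σ a = μ q := by simpa using congrFun hσ 0
    rw [homExtHRep_permGL, hσ, hs, elementary_comp_perm] at h1
    exact (Submodule.smul_mem_iff _ (by
      rw [Int.cast_ne_zero]; exact Units.ne_zero _)).1 h1
  · obtain ⟨σ, hσ⟩ := exists_perm_comp_eq hinj2 (Fin.cons_injective_iff.2 ⟨hb, hμ⟩)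
    have h1 := hN (permGL σ) _ hoff
    have s1 : σ t = b := by simpa using congrFun hσ 0
    have s2 : σ ∘ (Fin.cons a κ : Fin (r + 1) → Fin n) = μ := by
      funext q
      simpa using congrFun hσ q.succ
    rwa [homExtHRep_permGL, s1, s2] at h1

end AlbaneseIO

end

noncomputable section

open scoped TensorProduct CategoryTheory

namespace AlbaneseIO

/-! ### The standard action and surjections from Albanese homology -/

/-- A representation on the image of `T` lifts to the source of `T`. -/
theorem exists_representation_of_range_stable {G A E : Type} [Group G] [AddCommGroup A]
    [Module ℚ A] [AddCommGroup E] [Module ℚ E] (T : A →ₗ[ℚ] E) (τ : Representation ℚ G E)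
    (hT : ∀ g, ∀ w ∈ LinearMap.range T, τ g w ∈ LinearMap.range T) :
    ∃ ρ : Representation ℚ G A, ∀ g x, T (ρ g x) = τ g (T x) := by
  obtain ⟨s, hs⟩ := T.rangeRestrict.exists_rightInverse_of_surjective T.range_rangeRestrict
  have hs' : ∀ y, T.rangeRestrict (s y) = y := fun y => LinearMap.congr_fun hs y
  let τ' : Representation ℚ G (LinearMap.range T) := τ.subrepresentation (LinearMap.range T) hT
  have key : ∀ g x, T.rangeRestrict (x - s (T.rangeRestrict x) + s (τ' g (T.rangeRestrict x))) =
      τ' g (T.rangeRestrict x) := fun g x => by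
    rw [map_add, map_sub, hs', hs', sub_self, zero_add]
  let ρ : Representation ℚ G A :=
    -- A linear section s splits the source as kernel plus image. The group acts trivially on the
    -- kernel and through τ on the complement, so injectivity of T is not needed.
    { toFun g := LinearMap.id - s ∘ₗ T.rangeRestrict + s ∘ₗ τ' g ∘ₗ T.rangeRestrict
      map_one' := LinearMap.ext fun x => by
        change x - s (T.rangeRestrict x) + s (τ' 1 (T.rangeRestrict x)) = x
        rw [map_one, Module.End.one_apply, sub_add_cancel]
      map_mul' g h := LinearMap.ext fun x => by
        change x - s (T.rangeRestrict x) + s (τ' (g * h) (T.rangeRestrict x)) =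
          (x - s (T.rangeRestrict x) + s (τ' h (T.rangeRestrict x))) -
            s (T.rangeRestrict (x - s (T.rangeRestrict x) + s (τ' h (T.rangeRestrict x)))) +
            s (τ' g (T.rangeRestrict (x - s (T.rangeRestrict x) + s (τ' h (T.rangeRestrict x)))))
        rw [key, map_mul, Module.End.mul_apply, add_sub_cancel_right] }
  exact ⟨ρ, fun g x => congrArg Subtype.val (key g x)⟩

theorem exists_intertwiningMap_of_range_stable {G A E M : Type} [Group G] [AddCommGroup A]
    [Module ℚ A] [AddCommGroup E] [Module ℚ E] [AddCommMonoid M] [Module ℚ M] (T : A →ₗ[ℚ] E)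
    (τ : Representation ℚ G E) (σ : Representation ℚ G M) (P : E →ₗ[ℚ] M)
    (hT : ∀ g, ∀ w ∈ LinearMap.range T, τ g w ∈ LinearMap.range T)
    (hP : ∀ g x, P (τ g x) = σ g (P x)) (htop : (LinearMap.range T).map P = ⊤) :
    ∃ ρ : Representation ℚ G A, (∀ g x, T (ρ g x) = τ g (T x)) ∧
      ∃ f : ρ.IntertwiningMap σ, Function.Surjective f ∧ ∀ x, f x = P (T x) := by
  obtain ⟨ρ, hρ⟩ := exists_representation_of_range_stable T τ hT
  let f : ρ.IntertwiningMap σ := (P ∘ₗ T).intertwiningMap_of_isIntertwiningMap ρ σ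
    fun g v => (congrArg P (hρ g v)).trans (hP g _)
  refine ⟨ρ, hρ, f, fun m => ?_, fun _ => rfl⟩
  have hm : m ∈ (LinearMap.range T).map P := htop ▸ trivial
  obtain ⟨_, ⟨x, rfl⟩, rfl⟩ := hm
  exact ⟨x, rfl⟩

/-- Everything is transported from the exterior power: the surjection is P after the Johnson map,
and the compatibility with conjugation follows from equivariance of both. -/
theorem surjectsOnto_of_map_range_eq_top {n i : ℕ} (hn : 2 ≤ n) {M : Type} [AddCommMonoid M]
    [Module ℚ M] (σ : Representation ℚ (GL (Fin n) ℚ) M) (P : ⋀[ℚ]^i (UO n) →ₗ[ℚ] M)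
    (hP : ∀ g x, P (extRep i (UORep n) g x) = σ g (P x))
    (htop : (LinearMap.range (homologyToExt (johnsonOut n) i)).map P = ⊤) :
    SurjectsOnto n i σ := by
  have hr := range_albaneseToExt n i
  have hT : ∀ g, ∀ w ∈ LinearMap.range (albaneseToExt n i),
      extRep i (UORep n) g w ∈ LinearMap.range (albaneseToExt n i) := fun g w hw =>
    hr.symm.le (extRep_UORep_mem_range hn g w (hr.le hw))
  obtain ⟨ρ, hρ, f, hf, hfP⟩ := exists_intertwiningMap_of_range_stable (albaneseToExt n i)
    (extRep i (UORep n)) σ P hT hP ((congrArg (Submodule.map P) hr).trans htop)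
  have hfc : ∀ c, f (toAlbanese (IOut n) i c) = P (homologyToExt (johnsonOut n) i c) := fun c =>
    (hfP _).trans (congrArg P (albaneseToExt_toAlbanese n i c))
  refine ⟨ρ, hρ, f, hf, fun o c => ?_⟩
  exact ((hfc _).trans (congrArg P (homologyToExt_conjAction n i o c))).trans
    ((hP _ _).trans (congrArg (σ (outToGLQ n o)) (hfc c)).symm)

theorem SurjectsOnto.nontrivial {n i : ℕ} {M : Type} [AddCommMonoid M] [Module ℚ M]
    [Nontrivial M] {σ : Representation ℚ (GL (Fin n) ℚ) M} (h : SurjectsOnto n i σ) :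
    Nontrivial (albanese (IOut n) i) := by
  obtain ⟨ρ, _, f, hf, _⟩ := h
  exact hf.nontrivial

/-! ### The numerical conditions -/

/-- The indices `1, …, i`. -/
def initialIndex {n i : ℕ} (h : i + 2 ≤ n) (q : Fin i) : Fin n := ⟨q + 1, by omega⟩

theorem initialIndex_injective {n i : ℕ} (h : i + 2 ≤ n) :
    Function.Injective (initialIndex h) := fun a b hab => by
  have := congrArg Fin.val hab
  simp only [initialIndex] at this
  exact Fin.ext (by omega)

/-- The coefficient of `e_j^* ⊗ e_j ∧ e_1 ∧ ⋯ ∧ e_i`. -/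
def coefficient {n i : ℕ} (h : i + 2 ≤ n) (j : Fin n) : ℚ := ∏ q, weight (initialIndex h q) j

/-- Index 0 lies below all of `1, …, i`, so the weights are `n - 2, …, n - 1 - i`; the product is
reindexed in increasing order. -/
theorem coefficient_zero {n i : ℕ} (h : i + 2 ≤ n) :
    coefficient h ⟨0, by omega⟩ = ∏ q ∈ Finset.range i, (((n - 1 - i : ℕ) : ℚ) + q) := by
  rw [coefficient, ← Finset.prod_range_reflect, ← Fin.prod_univ_eq_prod_range
    (fun q => (((n - 1 - i : ℕ) : ℚ) + ((i - 1 - q : ℕ) : ℚ)))]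
  refine Finset.prod_congr rfl fun q _ => ?_
  rw [weight_of_lt (k := initialIndex h q) (Fin.lt_def.2 (Nat.succ_pos _))]
  have hq := q.2
  have e : ((n - 1 - i : ℕ) : ℚ) + ((i - 1 - q : ℕ) : ℚ) + 1 + ((q : ℕ) + 1) = n := by
    exact_mod_cast (by omega : n - 1 - i + (i - 1 - q) + 1 + (q + 1) = n)
  simp only [initialIndex]
  push_cast
  linarith

theorem coefficient_of_lt {n i : ℕ} (h : i + 2 ≤ n) {j : Fin n} (hj : i < j) :
    coefficient h j = (-1) ^ i * (i.factorial : ℚ) := by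
  rw [coefficient, Finset.prod_congr rfl fun q _ =>
    weight_of_le (k := initialIndex h q) (j := j) (Fin.le_def.2 (by simp only [initialIndex]; omega))]
  rw [Finset.prod_neg, Finset.card_univ, Fintype.card_fin]
  congr 1
  rw [← Finset.prod_range_add_one_eq_factorial, Nat.cast_prod]
  exact Fin.prod_univ_eq_prod_range (fun q => ((q + 1 : ℕ) : ℚ)) i

/-- The complement of `{1, …, i}` consists of 0 and the `n - 1 - i` indices above i. -/
theorem sum_coefficient {n i : ℕ} (h : i + 2 ≤ n) :
    ∑ j ∈ (Finset.univ.image (initialIndex h))ᶜ, coefficient h j =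
      ∏ q ∈ Finset.range i, (((n - 1 - i : ℕ) : ℚ) + q) +
        ((n - 1 - i : ℕ) : ℚ) * ((-1) ^ i * (i.factorial : ℚ)) := by
  have h0 : (⟨0, by omega⟩ : Fin n) ∈ (Finset.univ.image (initialIndex h))ᶜ := by
    simp [initialIndex]
  rw [← Finset.add_sum_erase _ _ h0, coefficient_zero, Finset.sum_congr rfl (g := fun _ =>
    (-1) ^ i * (i.factorial : ℚ)) fun j hj => coefficient_of_lt h ?_, Finset.sum_const,
    Finset.card_erase_of_mem h0, Finset.card_compl,
    Finset.card_image_of_injective _ (initialIndex_injective h), Finset.card_univ,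
    Fintype.card_fin, Fintype.card_fin, nsmul_eq_mul, Nat.sub_right_comm]
  rw [Finset.mem_erase, Finset.mem_compl] at hj
  by_contra hlt
  have hj0 : (j : ℕ) ≠ 0 := fun e => hj.1 (Fin.ext e)
  refine hj.2 (Finset.mem_image.2 ⟨⟨j - 1, by omega⟩, Finset.mem_univ _, Fin.ext ?_⟩)
  simp only [initialIndex]
  omega

/-- At `c = 1` both sides equal `i!`, which is why the odd case of the theorem needs one more unit
of n. -/
theorem mul_factorial_lt_prod {c : ℚ} (hc : 2 ≤ c) {i : ℕ} (hi : 2 ≤ i) :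
    c * (i.factorial : ℚ) < ∏ q ∈ Finset.range i, (c + q) := by
  induction i, hi using Nat.le_induction with
  | base =>
    simp [Finset.prod_range_succ]
    nlinarith
  | succ i hi ih =>
    rw [Finset.prod_range_succ, Nat.factorial_succ]
    push_cast
    have h1 : (0 : ℚ) < c * i.factorial := by positivity
    have h2 : (i : ℚ) + 1 ≤ c + i := by linarith
    have h3 : (0 : ℚ) < c + i := by positivity
    calc c * (((i : ℚ) + 1) * i.factorial) = (c * i.factorial) * (i + 1) := by ring
      _ ≤ (c * i.factorial) * (c + i) := by gcongr
      _ < _ := by gcongr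

theorem sum_coefficient_ne_zero {n i : ℕ} (hi : 2 ≤ i) (h : i + 2 ≤ n)
    (h' : Even i ∨ i + 3 ≤ n) :
    ∑ j ∈ (Finset.univ.image (initialIndex h))ᶜ, coefficient h j ≠ 0 := by
  rw [sum_coefficient]
  have hc : (1 : ℚ) ≤ ((n - 1 - i : ℕ) : ℚ) := by exact_mod_cast (by omega : 1 ≤ n - 1 - i)
  have hf : (0 : ℚ) < i.factorial := by positivity
  rcases Nat.even_or_odd i with he | ho
  · rw [he.neg_one_pow, one_mul]
    have : 0 < ∏ q ∈ Finset.range i, (((n - 1 - i : ℕ) : ℚ) + q) :=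
      Finset.prod_pos fun q _ => by positivity
    positivity
  · have hn : i + 3 ≤ n := h'.resolve_left (Nat.not_even_iff_odd.2 ho)
    have hc2 : (2 : ℚ) ≤ ((n - 1 - i : ℕ) : ℚ) := by exact_mod_cast (by omega : 2 ≤ n - 1 - i)
    have := mul_factorial_lt_prod hc2 hi
    rw [ho.neg_one_pow]
    linarith

/-- The first coefficient exceeds `2 · i!`, the second is `± i!`. For `n = i + 2` and even i the two
would coincide and the test class would see only the trace part. -/
theorem coefficient_ne {n i : ℕ} (hi : 2 ≤ i) (h : i + 2 ≤ n) (h' : i + 3 ≤ n) :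
    coefficient h ⟨0, by omega⟩ ≠ coefficient h ⟨i + 1, by omega⟩ := by
  rw [coefficient_zero, coefficient_of_lt h (Nat.lt_succ_self i)]
  have hc2 : (2 : ℚ) ≤ ((n - 1 - i : ℕ) : ℚ) := by exact_mod_cast (by omega : 2 ≤ n - 1 - i)
  have h1 := mul_factorial_lt_prod hc2 hi
  have hf : (0 : ℚ) < i.factorial := by positivity
  rcases neg_one_pow_eq_or ℚ i with e | e <;> rw [e] <;> nlinarith

/-! ### The two surjections -/

/-- The class in `⋀^i U^O` of an abelian cycle. -/
def cycleClass {n i : ℕ} (h : i + 2 ≤ n) : ⋀[ℚ]^i (UO n) :=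
  exteriorPower.ιMulti ℚ i fun q => Submodule.Quotient.mk (weightedWedge (initialIndex h q))

theorem projHom_cycleClass {n i : ℕ} (h : i + 2 ≤ n) (j : Fin n) :
    projHom n i (by omega) (cycleClass h) (Pi.single j 1) =
      coefficient h j • basisWedge (Fin.cons j (initialIndex h) : Fin (i + 1) → Fin n) := by
  apply Subtype.ext
  refine (projHom_weightedWedge (by omega) (initialIndex h) j).trans ?_
  rw [gen_mul_mono]
  rfl

theorem trExt_projHom_cycleClass {n i : ℕ} (h : i + 2 ≤ n) :
    trExt n i (projHom n i (by omega) (cycleClass h)) =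
      (∑ j ∈ (Finset.univ.image (initialIndex h))ᶜ, coefficient h j) •
        basisWedge (initialIndex h) := by
  apply Subtype.ext
  rw [coe_trExt]
  exact tr_eq_of_diagonal fun j => projHom_weightedWedge (by omega) (initialIndex h) j

/-- Only the trace of the projected test class is used here: a nonzero multiple of one basis
monomial. -/
theorem surjectsOnto_extHRep {n i : ℕ} (hi : 2 ≤ i) (h : i + 2 ≤ n) (h' : Even i ∨ i + 3 ≤ n) :
    SurjectsOnto n i (extHRep n i) := by
  have hn : 2 ≤ n := by omega
  have hP : ∀ g x, (trExt n i ∘ₗ projHom n i hn) (extRep i (UORep n) g x) =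
      extHRep n i g ((trExt n i ∘ₗ projHom n i hn) x) := fun g x =>
    (congrArg (trExt n i) (projHom_equivariant hn g x)).trans (trExt_equivariant g _)
  refine surjectsOnto_of_map_range_eq_top hn _ (trExt n i ∘ₗ projHom n i hn) hP ?_
  refine eq_top_of_stable_ext _ ?_ (initialIndex_injective h) ?_
  · rintro g _ ⟨w, hw, rfl⟩
    exact ⟨_, extRep_UORep_mem_range hn g w hw, hP g w⟩
  · refine (Submodule.smul_mem_iff _ (sum_coefficient_ne_zero hi h h')).1 ?_
    exact ⟨cycleClass h, weightedWedge_mem_range (by omega) _, trExt_projHom_cycleClass h⟩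

theorem surjectsOnto_homExtHRep {n i : ℕ} (hi : 2 ≤ i) (h : i + 3 ≤ n) :
    SurjectsOnto n i (homExtHRep n (i + 1)) := by
  have hn : 2 ≤ n := by omega
  have h2 : i + 2 ≤ n := by omega
  refine surjectsOnto_of_map_range_eq_top hn _ (projHom n i hn) (projHom_equivariant hn) ?_
  refine eq_top_of_stable_hom _ ?_ (initialIndex_injective h2)
    ⟨cycleClass h2, weightedWedge_mem_range (by omega) _, rfl⟩ (coefficient h2)
    (projHom_cycleClass h2) (a := ⟨0, by omega⟩) (t := ⟨i + 1, by omega⟩) ?_ ?_ ?_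
    (coefficient_ne hi h2 h) (sum_coefficient_ne_zero hi h2 (Or.inr h))
  · rintro g _ ⟨w, hw, rfl⟩
    exact ⟨_, extRep_UORep_mem_range hn g w hw, projHom_equivariant hn g w⟩
  · exact fun e => by simpa using congrArg Fin.val e
  · rintro ⟨q, hq⟩
    simpa [initialIndex] using congrArg Fin.val hq
  · rintro ⟨q, hq⟩
    have := congrArg Fin.val hq
    simp only [initialIndex] at this
    omega

end AlbaneseIO

end

noncomputable section

open scoped TensorProduct CategoryTheory

namespace AlbaneseIO

/-! ### The Specht module of a column -/

/-- The rational sign character. -/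
def signQ (α : Type) [Fintype α] [DecidableEq α] : Equiv.Perm α →* ℚ :=
  (Int.castRingHom ℚ).toMonoidHom.comp ((Units.coeHom ℤ).comp Equiv.Perm.sign)

theorem signQ_apply {α : Type} [Fintype α] [DecidableEq α] (s : Equiv.Perm α) :
    signQ α s = ((Equiv.Perm.sign s : ℤ) : ℚ) := rfl

theorem signQ_mul_self {α : Type} [Fintype α] [DecidableEq α] (s : Equiv.Perm α) :
    signQ α s * signQ α s = 1 := by
  rw [signQ_apply]
  rcases Int.units_eq_one_or (Equiv.Perm.sign s) with h | h <;> rw [h] <;> norm_num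

theorem column_snd {p : ℕ} (c : Cell (column p)) : c.1.2 = 0 := by
  have h : c.1 ∈ Finset.range p ×ˢ ({0} : Finset ℕ) := c.2
  simpa using (Finset.mem_product.1 h).2

/-- In a single column every permutation preserves columns and only the identity preserves rows. -/
theorem youngSymmetrizer_column (p : ℕ) : youngSymmetrizer (column p) =
    ∑ s : Equiv.Perm (Cell (column p)), signQ _ s • MonoidAlgebra.of ℚ _ s := by
  have h1 : (Finset.univ.filter fun s : Equiv.Perm (Cell (column p)) =>
      ∀ c, (s c).1.2 = c.1.2) = Finset.univ :=
    Finset.filter_true_of_mem fun s _ c => (column_snd _).trans (column_snd _).symm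
  have h2 : (Finset.univ.filter fun s : Equiv.Perm (Cell (column p)) =>
      ∀ c, (s c).1.1 = c.1.1) = {1} := by
    ext s
    simp only [Finset.mem_filter, Finset.mem_univ, true_and, Finset.mem_singleton]
    refine ⟨fun h => Equiv.ext fun c => Subtype.ext (Prod.ext (h c) ?_), fun h c => by rw [h]; rfl⟩
    exact (column_snd _).trans (column_snd _).symm
  rw [youngSymmetrizer, h1, h2, Finset.sum_singleton, map_one, mul_one]
  rfl

/-- The sign character of the group algebra. -/
def signAlg (α : Type) [Fintype α] [DecidableEq α] : MonoidAlgebra ℚ (Equiv.Perm α) →ₐ[ℚ] ℚ :=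
  MonoidAlgebra.lift ℚ ℚ (Equiv.Perm α) (signQ α)

theorem signAlg_of {α : Type} [Fintype α] [DecidableEq α] (s : Equiv.Perm α) :
    signAlg α (MonoidAlgebra.of ℚ _ s) = signQ α s :=
  MonoidAlgebra.lift_of _ _

theorem mul_youngSymmetrizer_column {p : ℕ} (x : MonoidAlgebra ℚ (Equiv.Perm (Cell (column p)))) :
    x * youngSymmetrizer (column p) = signAlg _ x • youngSymmetrizer (column p) := by
  induction x using MonoidAlgebra.induction_on with
  | of s =>
    rw [signAlg_of, youngSymmetrizer_column, Finset.mul_sum, Finset.smul_sum]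
    refine Fintype.sum_equiv (Equiv.mulLeft s) _ _ fun t => ?_
    rw [Equiv.coe_mulLeft, mul_smul_comm, ← map_mul, smul_smul, map_mul (signQ _), ← mul_assoc,
      signQ_mul_self, one_mul]
  | add x y hx hy => rw [add_mul, hx, hy, map_add, add_smul]
  | smul r x hx => rw [smul_mul_assoc, hx, map_smul, smul_smul, smul_eq_mul]

theorem signAlg_youngSymmetrizer_column (p : ℕ) : signAlg _ (youngSymmetrizer (column p)) =
    Fintype.card (Equiv.Perm (Cell (column p))) := by
  rw [youngSymmetrizer_column, map_sum, Finset.sum_congr rfl fun s _ => by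
    rw [map_smul, signAlg_of, smul_eq_mul, signQ_mul_self]]
  simp

/-- The generator of the Specht module of a column. -/
def spechtGen (p : ℕ) : specht (column p) := ⟨youngSymmetrizer (column p), 1, one_mul _⟩

/-- The coordinate on the Specht module of a column. -/
def spechtCoord (p : ℕ) : specht (column p) →ₗ[ℚ] ℚ :=
  (Fintype.card (Equiv.Perm (Cell (column p))) : ℚ)⁻¹ •
    ((signAlg (Cell (column p))).toLinearMap ∘ₗ (specht (column p)).subtype)

theorem spechtCoord_apply {p : ℕ} (y : specht (column p)) : spechtCoord p y =
    (Fintype.card (Equiv.Perm (Cell (column p))) : ℚ)⁻¹ * signAlg _ y.1 := rfl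

theorem spechtCoord_spechtGen (p : ℕ) : spechtCoord p (spechtGen p) = 1 := by
  rw [spechtCoord_apply, spechtGen, signAlg_youngSymmetrizer_column, inv_mul_cancel₀]
  exact_mod_cast Fintype.card_ne_zero

/-- The Specht module of a column is a line, because multiplying the symmetrizer by x only scales it
by the sign character of x. The coordinate divides by the group order since the symmetrizer is not
normalized. -/
theorem eq_spechtCoord_smul {p : ℕ} (y : specht (column p)) :
    y = spechtCoord p y • spechtGen p := by
  obtain ⟨_, x, rfl⟩ := y
  have hc : (Fintype.card (Equiv.Perm (Cell (column p))) : ℚ) ≠ 0 := by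
    exact_mod_cast Fintype.card_ne_zero
  apply Subtype.ext
  change x * youngSymmetrizer (column p) =
    ((Fintype.card (Equiv.Perm (Cell (column p))) : ℚ)⁻¹ *
      signAlg _ (x * youngSymmetrizer (column p))) • youngSymmetrizer (column p)
  rw [map_mul, signAlg_youngSymmetrizer_column,
    mul_youngSymmetrizer_column, mul_comm (signAlg _ x), inv_mul_cancel_left₀ hc]

theorem spechtCoord_spechtRep {p : ℕ} (s : Equiv.Perm (Cell (column p))) (y : specht (column p)) :
    spechtCoord p (spechtRep (column p) s y) = signQ _ s * spechtCoord p y := by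
  rw [spechtCoord_apply, spechtCoord_apply]
  change _ * signAlg _ (MonoidAlgebra.of ℚ _ s * y.1) = _
  rw [map_mul, signAlg_of, mul_left_comm]

theorem spechtRep_spechtGen {p : ℕ} (s : Equiv.Perm (Cell (column p))) :
    spechtRep (column p) s (spechtGen p) = signQ _ s • spechtGen p := by
  rw [eq_spechtCoord_smul (spechtRep (column p) s (spechtGen p)), spechtCoord_spechtRep,
    spechtCoord_spechtGen, mul_one]

/-! ### Maps out of `V_{1^p, 1^q}` -/

section

variable {n p q : ℕ} {W : Type} [AddCommMonoid W] [Module ℚ W]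

/-- The map `T ⊗ (S ⊗ S) → W` induced by a map `T → W`. -/
def preVLift (φ : traceless n (Cell (column p)) (Cell (column q)) →ₗ[ℚ] W) :
    PreV n (column p) (column q) →ₗ[ℚ] W :=
  (TensorProduct.rid ℚ W).toLinearMap ∘ₗ TensorProduct.map φ
    ((TensorProduct.lid ℚ ℚ).toLinearMap ∘ₗ TensorProduct.map (spechtCoord p) (spechtCoord q))

theorem preVLift_tmul (φ : traceless n (Cell (column p)) (Cell (column q)) →ₗ[ℚ] W)
    (x : traceless n (Cell (column p)) (Cell (column q))) (y : specht (column p))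
    (z : specht (column q)) :
    preVLift φ (x ⊗ₜ[ℚ] (y ⊗ₜ[ℚ] z)) = (spechtCoord p y * spechtCoord q z) • φ x := by
  simp [preVLift]

theorem exists_tmul_spechtGen (w : PreV n (column p) (column q)) :
    ∃ x, w = x ⊗ₜ[ℚ] (spechtGen p ⊗ₜ[ℚ] spechtGen q) := by
  induction w using TensorProduct.induction_on with
  | zero => exact ⟨0, (TensorProduct.zero_tmul _ _).symm⟩
  | add a b ha hb =>
    obtain ⟨x, rfl⟩ := ha
    obtain ⟨y, rfl⟩ := hb
    exact ⟨x + y, (TensorProduct.add_tmul _ _ _).symm⟩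
  | tmul x t =>
    induction t using TensorProduct.induction_on with
    | zero => exact ⟨0, by rw [TensorProduct.tmul_zero, TensorProduct.zero_tmul]⟩
    | add a b ha hb =>
      obtain ⟨x1, h1⟩ := ha
      obtain ⟨x2, h2⟩ := hb
      exact ⟨x1 + x2, by rw [TensorProduct.tmul_add, h1, h2, TensorProduct.add_tmul]⟩
    | tmul y z =>
      refine ⟨(spechtCoord p y * spechtCoord q z) • x, ?_⟩
      conv_lhs => rw [eq_spechtCoord_smul y, eq_spechtCoord_smul z]
      rw [TensorProduct.smul_tmul_smul, TensorProduct.tmul_smul, TensorProduct.smul_tmul']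

theorem bipartitionPermRep_tmul (s : Equiv.Perm (Cell (column p)) × Equiv.Perm (Cell (column q)))
    (x : traceless n (Cell (column p)) (Cell (column q))) (y : specht (column p))
    (z : specht (column q)) :
    bipartitionPermRep n (column p) (column q) s (x ⊗ₜ[ℚ] (y ⊗ₜ[ℚ] z)) =
      tracelessPermRep n _ _ s x ⊗ₜ[ℚ]
        (spechtRep (column p) s.1 y ⊗ₜ[ℚ] spechtRep (column q) s.2 z) := rfl

/-- An antisymmetric equivariant map on the traceless part, which is injective on antisymmetric
tensors, induces an injection on `V_{1^p, 1^q}`. -/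
theorem exists_intertwiningMap_VRep (σ : Representation ℚ (GL (Fin n) ℚ) W)
    (φ : traceless n (Cell (column p)) (Cell (column q)) →ₗ[ℚ] W)
    (hperm : ∀ s x, φ (tracelessPermRep n _ _ s x) = (signQ _ s.1 * signQ _ s.2) • φ x)
    (hker : ∀ x, φ x = 0 →
      ∑ s : Equiv.Perm (Cell (column p)) × Equiv.Perm (Cell (column q)),
        (signQ _ s.1 * signQ _ s.2) • tracelessPermRep n _ _ s x = 0)
    (hσ : ∀ g x, φ (tracelessRep n _ _ g x) = σ g (φ x)) :
    ∃ B : (VRep n (column p) (column q)).IntertwiningMap σ, Function.Injective B ∧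
      LinearMap.range B.toLinearMap = LinearMap.range φ := by
  let _ : AddCommGroup W := Module.addCommMonoidToAddCommGroup ℚ
  let B₀ : V n (column p) (column q) →ₗ[ℚ] W :=
    Representation.Coinvariants.lift (bipartitionPermRep n (column p) (column q)) (preVLift φ)
      fun s => by
        refine TensorProduct.ext' fun x t => ?_
        induction t using TensorProduct.induction_on with
        | zero => rw [TensorProduct.tmul_zero, map_zero, map_zero]
        | add a b ha hb => rw [TensorProduct.tmul_add, map_add, map_add, ha, hb]
        | tmul y z =>
          rw [LinearMap.comp_apply, bipartitionPermRep_tmul, preVLift_tmul, preVLift_tmul,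
            spechtCoord_spechtRep, spechtCoord_spechtRep, hperm, smul_smul]
          congr 1
          linear_combination (spechtCoord p y * spechtCoord q z) *
            (signQ _ s.2 * signQ _ s.2 * signQ_mul_self s.1 + signQ_mul_self s.2)
  have hB₀ : ∀ w, B₀ (Representation.Coinvariants.mk _ w) = preVLift φ w := fun w => rfl
  have hgen : ∀ x, preVLift φ (x ⊗ₜ[ℚ] (spechtGen p ⊗ₜ[ℚ] spechtGen q)) = φ x := fun x => by
    rw [preVLift_tmul, spechtCoord_spechtGen, spechtCoord_spechtGen, mul_one, one_smul]
  have hmk : ∀ v : V n (column p) (column q), ∃ x, v = Representation.Coinvariants.mk _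
      (x ⊗ₜ[ℚ] (spechtGen p ⊗ₜ[ℚ] spechtGen q)) := fun v => by
    obtain ⟨w, rfl⟩ := Representation.Coinvariants.mk_surjective _ v
    obtain ⟨x, rfl⟩ := exists_tmul_spechtGen w
    exact ⟨x, rfl⟩
  have hequiv : ∀ g v, B₀ (VRep n (column p) (column q) g v) = σ g (B₀ v) := fun g v => by
    obtain ⟨x, rfl⟩ := hmk v
    have e : VRep n (column p) (column q) g (Representation.Coinvariants.mk _
        (x ⊗ₜ[ℚ] (spechtGen p ⊗ₜ[ℚ] spechtGen q))) = Representation.Coinvariants.mk _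
        (tracelessRep n _ _ g x ⊗ₜ[ℚ] (spechtGen p ⊗ₜ[ℚ] spechtGen q)) := rfl
    rw [e, hB₀, hB₀, hgen, hgen, hσ]
  refine ⟨B₀.intertwiningMap_of_isIntertwiningMap _ _ hequiv, ?_, ?_⟩
  · refine (injective_iff_map_eq_zero B₀).2 fun v hv => ?_
    obtain ⟨x, rfl⟩ := hmk v
    rw [hB₀, hgen] at hv
    let M := (Representation.Coinvariants.mk (bipartitionPermRep n (column p) (column q))) ∘ₗ
      (TensorProduct.mk ℚ _ _).flip (spechtGen p ⊗ₜ[ℚ] spechtGen q)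
    -- In the coinvariants every signed permutation of x has the same class. Hence the
    -- antisymmetrization of x, which vanishes by hypothesis, represents the group order times the
    -- class of x.
    have hM : ∀ s, M ((signQ _ s.1 * signQ _ s.2) • tracelessPermRep n _ _ s x) = M x := fun s => by
      have h1 := Representation.Coinvariants.mk_self_apply
        (bipartitionPermRep n (column p) (column q)) s (x ⊗ₜ[ℚ] (spechtGen p ⊗ₜ[ℚ] spechtGen q))
      rw [bipartitionPermRep_tmul, spechtRep_spechtGen, spechtRep_spechtGen,
        TensorProduct.smul_tmul_smul, TensorProduct.tmul_smul, TensorProduct.smul_tmul'] at h1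
      exact h1
    have h2 := congrArg M (hker x hv)
    rw [map_sum, map_zero, Finset.sum_congr rfl fun s _ => hM s, Finset.sum_const,
      Finset.card_univ, ← Nat.cast_smul_eq_nsmul ℚ] at h2
    exact (smul_eq_zero.1 h2).resolve_left (by exact_mod_cast Fintype.card_ne_zero)
  · ext w
    constructor
    · rintro ⟨v, rfl⟩
      obtain ⟨x, rfl⟩ := hmk v
      exact ⟨x, (hgen x).symm⟩
    · rintro ⟨x, rfl⟩
      exact ⟨Representation.Coinvariants.mk _ (x ⊗ₜ[ℚ] (spechtGen p ⊗ₜ[ℚ] spechtGen q)), hgen x⟩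

end

end AlbaneseIO

end

noncomputable section

open scoped TensorProduct CategoryTheory

namespace AlbaneseIO

/-! ### Antisymmetrization -/

section

variable {n p : ℕ} {α β : Type}

/-- The projection `H^{⊗ α} → ⋀^p H` for an enumeration of `α`. -/
def wedgeTensor (n : ℕ) (e : Fin p ≃ α) : (⨂[ℚ] _ : α, H n) →ₗ[ℚ] ⋀[ℚ]^p (H n) :=
  PiTensorProduct.lift ((exteriorPower.ιMulti ℚ p (M := H n)).domDomCongr e).toMultilinearMap

theorem wedgeTensor_tprod (e : Fin p ≃ α) (v : α → H n) :
    wedgeTensor n e (PiTensorProduct.tprod ℚ v) = exteriorPower.ιMulti ℚ p (v ∘ e) :=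
  PiTensorProduct.lift.tprod v

/-- The antisymmetrization `⋀^p H → H^{⊗ α}`. -/
def antisymTensor [Fintype α] [DecidableEq α] (n : ℕ) (e : Fin p ≃ α) : ⋀[ℚ]^p (H n) →ₗ[ℚ] (⨂[ℚ] _ : α, H n) :=
  exteriorPower.alternatingMapLinearEquiv
    ((MultilinearMap.alternatization (PiTensorProduct.tprod ℚ)).domDomCongr e.symm)

theorem permRep_tprod (s : Equiv.Perm α) (v : α → H n) :
    permRep (H n) α s (PiTensorProduct.tprod ℚ v) = PiTensorProduct.tprod ℚ (v ∘ s.symm) :=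
  PiTensorProduct.reindex_tprod s v

/-- This shows that a tensor with zero wedge has zero antisymmetrization, which gives injectivity on
`V_{1^p, 1^q}`. -/
theorem antisymTensor_wedgeTensor [Fintype α] [DecidableEq α] (e : Fin p ≃ α) (x : ⨂[ℚ] _ : α, H n) :
    antisymTensor n e (wedgeTensor n e x) =
      ∑ s : Equiv.Perm α, signQ α s • permRep (H n) α s x := by
  have h : antisymTensor n e ∘ₗ wedgeTensor n e =
      ∑ s : Equiv.Perm α, signQ α s • permRep (H n) α s := by
    refine PiTensorProduct.ext (MultilinearMap.ext fun v => ?_)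
    change antisymTensor n e (wedgeTensor n e (PiTensorProduct.tprod ℚ v)) =
      (∑ s : Equiv.Perm α, signQ α s • permRep (H n) α s) (PiTensorProduct.tprod ℚ v)
    rw [wedgeTensor_tprod, antisymTensor, exteriorPower.alternatingMapLinearEquiv_apply_ιMulti,
      AlternatingMap.domDomCongr_apply, MultilinearMap.alternatization_apply, LinearMap.sum_apply]
    refine Fintype.sum_equiv (Equiv.inv _) _ _ fun s => ?_
    rw [LinearMap.smul_apply, permRep_tprod, signQ_apply, Equiv.inv_apply, Equiv.Perm.sign_inv,
      Units.smul_def, Int.cast_smul_eq_zsmul, MultilinearMap.domDomCongr_apply]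
    congr 2
    funext a
    simp only [Function.comp_apply, Equiv.apply_symm_apply]
    rfl
  rw [← LinearMap.comp_apply, h, LinearMap.sum_apply]
  rfl

theorem wedgeTensor_permRep [Fintype α] [DecidableEq α] (e : Fin p ≃ α)
    (s : Equiv.Perm α) (x : ⨂[ℚ] _ : α, H n) :
    wedgeTensor n e (permRep (H n) α s x) = signQ α s • wedgeTensor n e x := by
  have h : wedgeTensor n e ∘ₗ permRep (H n) α s = signQ α s • wedgeTensor n e := by
    refine PiTensorProduct.ext (MultilinearMap.ext fun v => ?_)
    change wedgeTensor n e (permRep (H n) α s (PiTensorProduct.tprod ℚ v)) =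
      signQ α s • wedgeTensor n e (PiTensorProduct.tprod ℚ v)
    rw [permRep_tprod, wedgeTensor_tprod, wedgeTensor_tprod]
    have h1 := ((exteriorPower.ιMulti ℚ p (M := H n)).domDomCongr e).map_perm v s.symm
    rw [Equiv.Perm.sign_symm, Units.smul_def, ← Int.cast_smul_eq_zsmul ℚ] at h1
    exact h1
  exact LinearMap.congr_fun h x

theorem wedgeTensor_piRep (e : Fin p ≃ α) (g : GL (Fin n) ℚ) (x : ⨂[ℚ] _ : α, H n) :
    wedgeTensor n e (piRep α (stdRep n) g x) = extHRep n p g (wedgeTensor n e x) := by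
  have h : wedgeTensor n e ∘ₗ piRep α (stdRep n) g = extHRep n p g ∘ₗ wedgeTensor n e := by
    refine PiTensorProduct.ext (MultilinearMap.ext fun v => ?_)
    change wedgeTensor n e (PiTensorProduct.map _ (PiTensorProduct.tprod ℚ v)) =
      extRep p (stdRep n) g (wedgeTensor n e (PiTensorProduct.tprod ℚ v))
    rw [PiTensorProduct.map_tprod, wedgeTensor_tprod, wedgeTensor_tprod, extRep_ιMulti]
    rfl
  exact LinearMap.congr_fun h x

/-- The map `H^{⊗ α} ⊗ (H^*)^{⊗ β} → ⋀^p H ⊗ (H^*)^{⊗ β}`. -/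
def wedgeMixed (n : ℕ) (e : Fin p ≃ α) (β : Type) :
    Mixed n α β →ₗ[ℚ] ⋀[ℚ]^p (H n) ⊗[ℚ] (⨂[ℚ] _ : β, Module.Dual ℚ (H n)) :=
  TensorProduct.map (wedgeTensor n e) LinearMap.id

theorem permRep_of_subsingleton [Subsingleton β] (s : Equiv.Perm β)
    (f : ⨂[ℚ] _ : β, Module.Dual ℚ (H n)) : permRep (Module.Dual ℚ (H n)) β s f = f := by
  have hs : s = 1 := Subsingleton.elim _ _
  rw [hs, map_one, Module.End.one_apply]

theorem wedgeMixed_mixedPermRep [Fintype α] [DecidableEq α] [Fintype β] [DecidableEq β]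
    [Subsingleton β] (e : Fin p ≃ α)
    (s : Equiv.Perm α × Equiv.Perm β) (x : Mixed n α β) :
    wedgeMixed n e β (mixedPermRep n α β s x) =
      (signQ α s.1 * signQ β s.2) • wedgeMixed n e β x := by
  have hs : s.2 = 1 := Subsingleton.elim _ _
  rw [hs, map_one, mul_one]
  induction x using TensorProduct.induction_on with
  | zero => rw [map_zero, map_zero, smul_zero]
  | add x y hx hy => rw [map_add, map_add, map_add, smul_add, hx, hy]
  | tmul x f =>
    change wedgeTensor n e (permRep (H n) α s.1 x) ⊗ₜ[ℚ] permRep (Module.Dual ℚ (H n)) β s.2 f =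
      signQ α s.1 • (wedgeTensor n e x ⊗ₜ[ℚ] f)
    rw [permRep_of_subsingleton, wedgeTensor_permRep, TensorProduct.smul_tmul']

theorem antisym_wedgeMixed [Fintype α] [DecidableEq α] [Fintype β] [DecidableEq β]
    [Subsingleton β] (e : Fin p ≃ α) (x : Mixed n α β) :
    TensorProduct.map (antisymTensor n e) LinearMap.id (wedgeMixed n e β x) =
      ∑ s : Equiv.Perm α × Equiv.Perm β, (signQ α s.1 * signQ β s.2) • mixedPermRep n α β s x := by
  induction x using TensorProduct.induction_on with
  | zero => simp
  | add x y hx hy => simp only [map_add, smul_add, Finset.sum_add_distrib, hx, hy]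
  | tmul x f =>
    have e1 : TensorProduct.map (antisymTensor n e) LinearMap.id (wedgeMixed n e β (x ⊗ₜ[ℚ] f)) =
      antisymTensor n e (wedgeTensor n e x) ⊗ₜ[ℚ] f := rfl
    rw [e1, antisymTensor_wedgeTensor, TensorProduct.sum_tmul, Fintype.sum_prod_type]
    refine Finset.sum_congr rfl fun s _ => ?_
    rw [Fintype.sum_unique]
    change _ = (signQ α s * signQ β default) •
      (permRep (H n) α s x ⊗ₜ[ℚ] permRep (Module.Dual ℚ (H n)) β default f)
    have hd : (default : Equiv.Perm β) = 1 := Subsingleton.elim _ _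
    rw [permRep_of_subsingleton, hd, map_one, mul_one, TensorProduct.smul_tmul']

end

/-- The enumeration of the cells of a column. -/
def cellEquiv (p : ℕ) : Fin p ≃ Cell (column p) where
  toFun q := ⟨(q, 0), Finset.mem_product.2 ⟨Finset.mem_range.2 q.2, Finset.mem_singleton_self _⟩⟩
  invFun c := ⟨c.1.1, Finset.mem_range.1 (Finset.mem_product.1
    (show c.1 ∈ Finset.range p ×ˢ ({0} : Finset ℕ) from c.2)).1⟩
  left_inv _ := rfl
  right_inv c := Subtype.ext (Prod.ext rfl (column_snd c).symm)

/-- Maps on `⋀^p H ⊗ (H^*)^{⊗ q}` for `q ≤ 1` restrict to maps of `V_{1^p, 1^q}`. -/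
theorem exists_intertwiningMap_of_wedgeMixed {n p q : ℕ} [Subsingleton (Cell (column q))]
    {W : Type} [AddCommMonoid W] [Module ℚ W] (σ : Representation ℚ (GL (Fin n) ℚ) W)
    (ω : ⋀[ℚ]^p (H n) ⊗[ℚ] (⨂[ℚ] _ : Cell (column q), Module.Dual ℚ (H n)) →ₗ[ℚ] W)
    (hω : Function.Injective ω)
    (hσ : ∀ g w f, ω (extHRep n p g w ⊗ₜ[ℚ] piRep _ (stdRep n).dual g f) = σ g (ω (w ⊗ₜ[ℚ] f))) :
    ∃ B : (VRep n (column p) (column q)).IntertwiningMap σ, Function.Injective B ∧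
      LinearMap.range B.toLinearMap =
        (traceless n _ _).map (ω ∘ₗ wedgeMixed n (cellEquiv p) (Cell (column q))) := by
  have h := exists_intertwiningMap_VRep σ
    ((ω ∘ₗ wedgeMixed n (cellEquiv p) (Cell (column q))) ∘ₗ Submodule.subtype _)
    (fun s x => ?_) (fun x hx => ?_) (fun g x => ?_)
  · obtain ⟨B, hB, hr⟩ := h
    refine ⟨B, hB, hr.trans ?_⟩
    rw [LinearMap.range_comp, Submodule.range_subtype]
  · refine (congrArg ω (wedgeMixed_mixedPermRep (cellEquiv p) s x.1)).trans ?_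
    rw [map_smul]
    rfl
  · have h1 : wedgeMixed n (cellEquiv p) (Cell (column q)) x.1 = 0 := hω (hx.trans (map_zero ω).symm)
    have h2 := antisym_wedgeMixed (cellEquiv p) x.1
    rw [h1, map_zero] at h2
    apply Subtype.ext
    rw [Submodule.coe_sum]
    exact h2.symm
  · have h1 : ∀ y : Mixed n (Cell (column p)) (Cell (column q)),
        ω (wedgeMixed n (cellEquiv p) _ (mixedRep n _ _ g y)) =
          σ g (ω (wedgeMixed n (cellEquiv p) _ y)) := fun y => by
      induction y using TensorProduct.induction_on with
      | zero => simp only [map_zero]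
      | add x y hx hy => simp only [map_add, hx, hy]
      | tmul x f =>
        refine Eq.trans ?_ (hσ g _ _)
        rw [← wedgeTensor_piRep]
        rfl
    exact h1 x.1

end AlbaneseIO

end

noncomputable section

open scoped TensorProduct CategoryTheory

namespace AlbaneseIO

/-! ### `V_{1^p, 0} ≅ ⋀^p H` -/

instance isEmpty_cell_column_zero : IsEmpty (Cell (column 0)) := (cellEquiv 0).symm.isEmpty

instance subsingleton_cell_column_one : Subsingleton (Cell (column 1)) :=
  (cellEquiv 1).symm.subsingleton

theorem exists_intertwiningMap_column_zero (n p : ℕ) :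
    ∃ B : (VRep n (column p) (column 0)).IntertwiningMap (extHRep n p),
      Function.Bijective B := by
  let ε := PiTensorProduct.isEmptyEquiv (R := ℚ) (s := fun _ => Module.Dual ℚ (H n))
    (Cell (column 0))
  let ω : ⋀[ℚ]^p (H n) ⊗[ℚ] (⨂[ℚ] _ : Cell (column 0), Module.Dual ℚ (H n)) ≃ₗ[ℚ]
      ⋀[ℚ]^p (H n) :=
    (TensorProduct.congr (LinearEquiv.refl ℚ _) ε) ≪≫ₗ TensorProduct.rid ℚ _
  have hω : ∀ w f, ω (w ⊗ₜ[ℚ] f) = ε f • w := fun w f => rfl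
  have hε : ∀ g f, ε (piRep _ (stdRep n).dual g f) = ε f := fun g f => by
    have h : ε.toLinearMap ∘ₗ piRep _ (stdRep n).dual g = ε.toLinearMap := by
      refine PiTensorProduct.ext (MultilinearMap.ext fun v => ?_)
      change ε (PiTensorProduct.map _ (PiTensorProduct.tprod ℚ v)) = ε (PiTensorProduct.tprod ℚ v)
      rw [PiTensorProduct.map_tprod, PiTensorProduct.isEmptyEquiv_apply_tprod,
        PiTensorProduct.isEmptyEquiv_apply_tprod]
    exact LinearMap.congr_fun h f
  obtain ⟨B, hB, hr⟩ := exists_intertwiningMap_of_wedgeMixed (extHRep n p) ω.toLinearMap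
    ω.injective (fun g w f => by
      change ω _ = extHRep n p g (ω _)
      rw [hω, hω, hε, map_smul])
  refine ⟨B, hB, ?_⟩
  have htop : LinearMap.range B.toLinearMap = ⊤ := by
    rw [hr]
    -- Without dual factors there are no contractions.
    have hT : traceless n (Cell (column p)) (Cell (column 0)) = ⊤ := by
      rw [traceless]
      simp
    rw [hT, eq_top_iff]
    intro w _
    induction w using span_induction_ext with
    | hι v =>
      refine ⟨PiTensorProduct.tprod ℚ (v ∘ (cellEquiv p).symm) ⊗ₜ[ℚ]
        PiTensorProduct.tprod ℚ isEmptyElim, trivial, ?_⟩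
      change ω (wedgeTensor n (cellEquiv p) _ ⊗ₜ[ℚ] PiTensorProduct.tprod ℚ isEmptyElim) = _
      rw [hω, wedgeTensor_tprod, PiTensorProduct.isEmptyEquiv_apply_tprod, one_smul,
        Function.comp_assoc, Equiv.symm_comp_self, Function.comp_id]
    | h0 => exact Submodule.zero_mem _
    | hadd x y hx hy => exact Submodule.add_mem _ (hx trivial) (hy trivial)
    | hsmul c x hx => exact Submodule.smul_mem _ _ (hx trivial)
  exact LinearMap.range_eq_top.1 htop

theorem nonempty_equiv_extHRep (n p : ℕ) :
    Nonempty ((extHRep n p).Equiv (VRep n (column p) (column 0))) := by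
  obtain ⟨B, hB⟩ := exists_intertwiningMap_column_zero n p
  exact ⟨(B.ofBijective hB).symm⟩

/-! ### `V_{1^{r+1}, 1} ⊕ V_{1^r, 0} ≅ Hom(H, ⋀^{r+1} H)` -/

/-- The isomorphism `⋀^p H ⊗ H^* ≅ Hom(H, ⋀^p H)`. -/
def tensorHomEquiv (n p : ℕ) {β : Type} [Subsingleton β] (b : β) :
    ⋀[ℚ]^p (H n) ⊗[ℚ] (⨂[ℚ] _ : β, Module.Dual ℚ (H n)) ≃ₗ[ℚ] (H n →ₗ[ℚ] ⋀[ℚ]^p (H n)) :=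
  (TensorProduct.congr (LinearEquiv.refl ℚ _) (PiTensorProduct.subsingletonEquiv b)) ≪≫ₗ
    TensorProduct.comm ℚ _ _ ≪≫ₗ dualTensorHomEquiv ℚ (H n) (⋀[ℚ]^p (H n))

theorem tensorHomEquiv_tmul {n p : ℕ} {β : Type} [Subsingleton β] (b : β) (w : ⋀[ℚ]^p (H n))
    (f : ⨂[ℚ] _ : β, Module.Dual ℚ (H n)) (h : H n) :
    tensorHomEquiv n p b (w ⊗ₜ[ℚ] f) h = (PiTensorProduct.subsingletonEquiv b f) h • w := by
  simp [tensorHomEquiv, dualTensorHomEquiv]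

theorem tensorHomEquiv_equivariant {n p : ℕ} {β : Type} [Subsingleton β] (b : β)
    (g : GL (Fin n) ℚ) (w : ⋀[ℚ]^p (H n)) (f : ⨂[ℚ] _ : β, Module.Dual ℚ (H n)) :
    tensorHomEquiv n p b (extHRep n p g w ⊗ₜ[ℚ] piRep _ (stdRep n).dual g f) =
      homExtHRep n p g (tensorHomEquiv n p b (w ⊗ₜ[ℚ] f)) := by
  let ε : (⨂[ℚ] _ : β, Module.Dual ℚ (H n)) ≃ₗ[ℚ] Module.Dual ℚ (H n) :=
    PiTensorProduct.subsingletonEquiv b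
  have e : ε (piRep _ (stdRep n).dual g f) = (stdRep n).dual g (ε f) := by
    have h : ε.toLinearMap ∘ₗ piRep _ (stdRep n).dual g =
        (stdRep n).dual g ∘ₗ ε.toLinearMap := by
      refine PiTensorProduct.ext (MultilinearMap.ext fun v => ?_)
      change ε (PiTensorProduct.map _ (PiTensorProduct.tprod ℚ v)) =
        (stdRep n).dual g (ε (PiTensorProduct.tprod ℚ v))
      rw [PiTensorProduct.map_tprod, PiTensorProduct.subsingletonEquiv_apply_tprod,
        PiTensorProduct.subsingletonEquiv_apply_tprod]
    exact LinearMap.congr_fun h f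
  refine LinearMap.ext fun h => ?_
  rw [homExtHRep_apply, tensorHomEquiv_tmul, tensorHomEquiv_tmul, e, map_smul]
  rfl

theorem contractLeft_ιMulti {n r : ℕ} (f : Module.Dual ℚ (H n)) (v : Fin (r + 1) → H n) :
    CliffordAlgebra.contractLeft (Q := (0 : QuadraticForm ℚ (H n))) f
        (ExteriorAlgebra.ιMulti ℚ (r + 1) v) =
      ∑ q : Fin (r + 1), ((-1 : ℚ) ^ (q : ℕ) * f (v q)) •
        ExteriorAlgebra.ιMulti ℚ r (v ∘ q.succAbove) := by
  induction r with
  | zero =>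
    rw [ExteriorAlgebra.ιMulti_succ_apply, ExteriorAlgebra.ιMulti_zero_apply, mul_one]
    rw [Fin.sum_univ_succ, Fin.sum_univ_zero, add_zero, ExteriorAlgebra.ιMulti_zero_apply,
      Fin.val_zero, pow_zero, one_mul]
    exact (CliffordAlgebra.contractLeft_ι _ f (v 0)).trans (Algebra.algebraMap_eq_smul_one _)
  | succ r ih =>
    rw [ExteriorAlgebra.ιMulti_succ_apply, Fin.sum_univ_succ]
    refine (CliffordAlgebra.contractLeft_ι_mul f (v 0) _).trans ?_
    rw [ih, sub_eq_add_neg]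
    congr 1
    · rw [Fin.val_zero, pow_zero, one_mul]
      rfl
    · rw [Finset.mul_sum, ← Finset.sum_neg_distrib]
      refine Finset.sum_congr rfl fun q _ => ?_
      have e : ExteriorAlgebra.ιMulti ℚ (r + 1) (v ∘ q.succ.succAbove) =
          ExteriorAlgebra.ι ℚ (v 0) *
            ExteriorAlgebra.ιMulti ℚ r (Matrix.vecTail v ∘ q.succAbove) := by
        rw [ExteriorAlgebra.ιMulti_succ_apply]
        congr 2
        funext k
        simp [Matrix.vecTail]
      rw [e, mul_smul_comm, Fin.val_succ, pow_succ, mul_neg_one, neg_mul, neg_smul]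
      rfl

theorem tr_smulRight {n : ℕ} (f : Module.Dual ℚ (H n)) (w : Ext n) :
    tr n (f.smulRight w) =
      CliffordAlgebra.contractLeft (Q := (0 : QuadraticForm ℚ (H n))) f w := by
  rw [tr_apply]
  have e : f = ∑ j, f (Pi.single j 1) • (LinearMap.proj j : Module.Dual ℚ (H n)) := by
    refine (Pi.basisFun ℚ (Fin n)).ext fun k => ?_
    rw [Pi.basisFun_apply, LinearMap.sum_apply, Finset.sum_eq_single k]
    · simp
    · intro l _ hl
      simp [Pi.single_eq_of_ne hl]
    · simp
  conv_rhs => rw [e, map_sum, LinearMap.sum_apply]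
  refine Finset.sum_congr rfl fun j _ => ?_
  rw [LinearMap.smulRight_apply, map_smul, map_smul, LinearMap.smul_apply]

section

variable {n r : ℕ} {α β : Type} [Subsingleton β]

theorem isEmpty_compl (b : β) : IsEmpty {b' : β // ¬ b' = b} :=
  ⟨fun c => c.2 (Subsingleton.elim _ _)⟩

/-- The wedge product of the factors of a tensor remaining after a contraction. -/
def wedgeRest (n : ℕ) (e : Fin (r + 1) ≃ α) (q : Fin (r + 1)) (b : β) :
    Mixed n {a : α // ¬ a = e q} {b' : β // ¬ b' = b} →ₗ[ℚ] ⋀[ℚ]^r (H n) :=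
  have := isEmpty_compl b
  (TensorProduct.rid ℚ _).toLinearMap ∘ₗ TensorProduct.map
    (wedgeTensor n ((finSuccAboveEquiv q).trans (e.subtypeEquiv fun a => by
      rw [e.apply_eq_iff_eq])))
    (PiTensorProduct.isEmptyEquiv (R := ℚ) (s := fun _ => Module.Dual ℚ (H n))
      {b' : β // ¬ b' = b}).toLinearMap

theorem wedgeRest_tprod (e : Fin (r + 1) ≃ α) (q : Fin (r + 1)) (b : β) (v : α → H n)
    (f : {b' : β // ¬ b' = b} → Module.Dual ℚ (H n)) :
    wedgeRest n e q b ((PiTensorProduct.tprod ℚ fun a : {a : α // ¬ a = e q} => v a) ⊗ₜ[ℚ]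
      PiTensorProduct.tprod ℚ f) = exteriorPower.ιMulti ℚ r ((v ∘ e) ∘ q.succAbove) := by
  have := isEmpty_compl b
  rw [wedgeRest, LinearMap.comp_apply, TensorProduct.map_tmul, wedgeTensor_tprod]
  refine (TensorProduct.rid_tmul _ _).trans ?_
  rw [LinearEquiv.coe_coe, PiTensorProduct.isEmptyEquiv_apply_tprod, one_smul]
  rfl

/-- Contracting a wedge product expands as an alternating sum over its factors, so the trace after
antisymmetrization is built from the contractions before it. Traceless tensors therefore map to
trace zero. -/
theorem trExt_wedgeMixed [DecidableEq α] [DecidableEq β] (e : Fin (r + 1) ≃ α) (b : β) (x : Mixed n α β) :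
    trExt n r (tensorHomEquiv n (r + 1) b (wedgeMixed n e β x)) =
      ∑ q : Fin (r + 1), (-1 : ℚ) ^ (q : ℕ) • wedgeRest n e q b (contraction n (e q) b x) := by
  have h : trExt n r ∘ₗ (tensorHomEquiv n (r + 1) b).toLinearMap ∘ₗ wedgeMixed n e β =
      ∑ q : Fin (r + 1), (-1 : ℚ) ^ (q : ℕ) • (wedgeRest n e q b ∘ₗ contraction n (e q) b) := by
    refine TensorProduct.ext (PiTensorProduct.ext (MultilinearMap.ext fun v => ?_))
    refine PiTensorProduct.ext (MultilinearMap.ext fun f => ?_)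
    change trExt n r (tensorHomEquiv n (r + 1) b
        (wedgeTensor n e (PiTensorProduct.tprod ℚ v) ⊗ₜ[ℚ] PiTensorProduct.tprod ℚ f)) =
      (∑ q : Fin (r + 1), (-1 : ℚ) ^ (q : ℕ) • (wedgeRest n e q b ∘ₗ contraction n (e q) b))
        (PiTensorProduct.tprod ℚ v ⊗ₜ[ℚ] PiTensorProduct.tprod ℚ f)
    have hA : homIncl n (r + 1) (tensorHomEquiv n (r + 1) b
        (wedgeTensor n e (PiTensorProduct.tprod ℚ v) ⊗ₜ[ℚ] PiTensorProduct.tprod ℚ f)) =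
        (f b).smulRight (ExteriorAlgebra.ιMulti ℚ (r + 1) (v ∘ e)) := by
      refine LinearMap.ext fun h => ?_
      rw [homIncl_apply, tensorHomEquiv_tmul, PiTensorProduct.subsingletonEquiv_apply_tprod,
        wedgeTensor_tprod]
      rfl
    apply Subtype.ext
    rw [coe_trExt, hA, tr_smulRight, contractLeft_ιMulti, LinearMap.sum_apply, Submodule.coe_sum]
    refine Finset.sum_congr rfl fun q _ => ?_
    rw [LinearMap.smul_apply, LinearMap.comp_apply, contraction_tprod, map_smul, wedgeRest_tprod,
      smul_smul]
    rfl
  refine (LinearMap.congr_fun h x).trans ?_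
  rw [LinearMap.sum_apply]
  rfl

theorem trExt_of_mem_traceless [DecidableEq α] [DecidableEq β] (e : Fin (r + 1) ≃ α) (b : β) {x : Mixed n α β}
    (hx : x ∈ traceless n α β) :
    trExt n r (tensorHomEquiv n (r + 1) b (wedgeMixed n e β x)) = 0 := by
  simp only [traceless, Submodule.mem_iInf, LinearMap.mem_ker] at hx
  rw [trExt_wedgeMixed]
  exact Finset.sum_eq_zero fun q _ => by rw [hx, map_zero, smul_zero]

/-- The tensor `e_a ⊗ e_{κ 0} ⊗ ⋯ ⊗ e_{κ (r - 1)} ⊗ e_a^*`. -/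
def diagonalTensor (e : Fin (r + 1) ≃ α) (β : Type) (κ : Fin r → Fin n) (a : Fin n) :
    Mixed n α β :=
  (PiTensorProduct.tprod ℚ fun c =>
      (Pi.single ((Fin.cons a κ : Fin (r + 1) → Fin n) (e.symm c)) 1 : H n)) ⊗ₜ[ℚ]
    PiTensorProduct.tprod ℚ fun _ => LinearMap.proj a

theorem tensorHomEquiv_diagonalTensor (e : Fin (r + 1) ≃ α) (b : β) (κ : Fin r → Fin n)
    (a : Fin n) : tensorHomEquiv n (r + 1) b (wedgeMixed n e β (diagonalTensor e β κ a)) =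
      elementary a (Fin.cons a κ : Fin (r + 1) → Fin n) := by
  refine LinearMap.ext fun h => ?_
  refine (tensorHomEquiv_tmul b (wedgeTensor n e (PiTensorProduct.tprod ℚ _))
    (PiTensorProduct.tprod ℚ _) h).trans ?_
  rw [PiTensorProduct.subsingletonEquiv_apply_tprod, wedgeTensor_tprod, elementary_apply,
    basisWedge]
  congr 2
  funext q
  simp

/-- Contracting the first slot gives the same tensor for a and for t; contracting any other slot
gives zero because a and t do not occur in κ. -/
theorem diagonalTensor_sub_mem_traceless [DecidableEq α] [DecidableEq β] (e : Fin (r + 1) ≃ α)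
    {κ : Fin r → Fin n} {a t : Fin n}
    (ha : a ∉ Set.range κ) (ht : t ∉ Set.range κ) :
    diagonalTensor e β κ a - diagonalTensor e β κ t ∈ traceless n α β := by
  simp only [traceless, Submodule.mem_iInf, LinearMap.mem_ker]
  intro k b
  have := isEmpty_compl b
  obtain ⟨q, rfl⟩ := e.surjective k
  rw [map_sub, sub_eq_zero, diagonalTensor, diagonalTensor, contraction_tprod, contraction_tprod]
  refine Fin.cases ?_ (fun q => ?_) q
  · have h1 : ∀ a : Fin n, (fun c : {c : α // ¬ c = e 0} =>
        (Pi.single ((Fin.cons a κ : Fin (r + 1) → Fin n) (e.symm c)) 1 : H n)) =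
        fun c => Fin.cases (motive := fun _ => H n) 0 (fun q => Pi.single (κ q) 1)
          (e.symm c.1) := fun a => by
      funext c
      obtain ⟨c, hc⟩ := c
      obtain ⟨q, rfl⟩ := e.surjective c
      revert hc
      refine Fin.cases (fun h => absurd rfl h) (fun q _ => ?_) q
      simp
    rw [h1 a, h1 t]
    congr 1
    · simp
    · congr 2
      funext c
      exact isEmptyElim c
  · have h2 : ∀ a : Fin n, a ∉ Set.range κ → (LinearMap.proj a : Module.Dual ℚ (H n))
        (Pi.single ((Fin.cons a κ : Fin (r + 1) → Fin n) (e.symm (e q.succ))) 1) = 0 :=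
      fun a ha => by
        rw [e.symm_apply_apply, Fin.cons_succ, LinearMap.proj_apply,
          Pi.single_eq_of_ne (fun h => ha ⟨q, h.symm⟩)]
    rw [h2 a ha, h2 t ht, zero_smul, zero_smul]

end

/-- The two summands are the image of traceless tensors and the maps `h ↦ h ∧ w`. The trace kills
the first and is multiplication by `n - r` on the second, which gives injectivity. Surjectivity
needs no dimension count: the image is stable and contains an element generating everything. -/
theorem nonempty_equiv_homExtHRep {n r : ℕ} (h : r + 2 ≤ n) :
    Nonempty ((homExtHRep n (r + 1)).Equiv
      ((VRep n (column (r + 1)) (column 1)).prod (VRep n (column r) (column 0)))) := by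
  let b : Cell (column 1) := cellEquiv 1 0
  obtain ⟨B₁, hB₁, hr₁⟩ := exists_intertwiningMap_of_wedgeMixed (p := r + 1) (q := 1)
    (homExtHRep n (r + 1)) (tensorHomEquiv n (r + 1) b).toLinearMap
    (tensorHomEquiv n (r + 1) b).injective (tensorHomEquiv_equivariant b)
  obtain ⟨B₂, hB₂⟩ := exists_intertwiningMap_column_zero n r
  have htr : ∀ v, trExt n r (B₁ v) = 0 := fun v => by
    have hv : B₁.toLinearMap v ∈ LinearMap.range B₁.toLinearMap := ⟨v, rfl⟩
    rw [hr₁] at hv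
    obtain ⟨x, hx, he⟩ := hv
    exact (congrArg (trExt n r) he).symm.trans (trExt_of_mem_traceless (cellEquiv (r + 1)) b hx)
  let L : V n (column (r + 1)) (column 1) × V n (column r) (column 0) →ₗ[ℚ]
      (H n →ₗ[ℚ] ⋀[ℚ]^(r + 1) (H n)) :=
    B₁.toLinearMap.coprod (insExt n r ∘ₗ B₂.toLinearMap)
  have hL : ∀ v, L v = B₁ v.1 + insExt n r (B₂ v.2) := fun v => rfl
  have hequiv : ∀ g v, L (((VRep n (column (r + 1)) (column 1)).prod
      (VRep n (column r) (column 0))) g v) = homExtHRep n (r + 1) g (L v) := fun g v => by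
    rw [hL, hL, map_add, ← insExt_equivariant, ← B₁.isIntertwining, ← B₂.isIntertwining]
    rfl
  have hinj : Function.Injective L := by
    refine (injective_iff_map_eq_zero L).2 fun v hv => ?_
    rw [hL] at hv
    have h1 := congrArg (trExt n r) hv
    rw [map_add, htr, zero_add, trExt_insExt, map_zero] at h1
    have hnr : (n : ℚ) - r ≠ 0 := sub_ne_zero.2 (by exact_mod_cast (by omega : n ≠ r))
    have h2 : B₂ v.2 = 0 := (smul_eq_zero.1 h1).resolve_left hnr
    rw [h2, map_zero, add_zero] at hv
    exact Prod.ext (hB₁ (hv.trans (map_zero B₁.toLinearMap).symm))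
      (hB₂.1 (h2.trans (map_zero B₂.toLinearMap).symm))
  have hsurj : LinearMap.range L = ⊤ := by
    have ha : (⟨0, by omega⟩ : Fin n) ∉ Set.range (initialIndex h) := by
      rintro ⟨q, hq⟩
      simpa [initialIndex] using congrArg Fin.val hq
    have ht : (⟨r + 1, by omega⟩ : Fin n) ∉ Set.range (initialIndex h) := by
      rintro ⟨q, hq⟩
      have := congrArg Fin.val hq
      simp only [initialIndex] at this
      omega
    have hat : (⟨0, by omega⟩ : Fin n) ≠ ⟨r + 1, by omega⟩ :=
      fun e => by simpa using congrArg Fin.val e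
    generalize (⟨0, by omega⟩ : Fin n) = a at ha hat
    generalize (⟨r + 1, by omega⟩ : Fin n) = t at ht hat
    generalize hκ : initialIndex h = κ at ha ht
    have hκinj : Function.Injective κ := hκ ▸ initialIndex_injective h
    obtain ⟨y, hy⟩ : tensorHomEquiv n (r + 1) b (wedgeMixed n (cellEquiv (r + 1)) _
        (diagonalTensor (cellEquiv (r + 1)) _ κ a - diagonalTensor (cellEquiv (r + 1)) _ κ t)) ∈
        LinearMap.range B₁.toLinearMap := by
      rw [hr₁]
      exact ⟨_, diagonalTensor_sub_mem_traceless _ ha ht, rfl⟩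
    obtain ⟨z, hz⟩ := hB₂.2 (basisWedge κ)
    have hy' : B₁ y + elementary t (Fin.cons t κ : Fin (r + 1) → Fin n) =
        elementary a (Fin.cons a κ : Fin (r + 1) → Fin n) := by
      rw [← tensorHomEquiv_diagonalTensor (cellEquiv (r + 1)) b,
        ← tensorHomEquiv_diagonalTensor (cellEquiv (r + 1)) b]
      refine (congrArg (· + _) hy).trans ?_
      rw [← map_add, ← map_add, sub_add_cancel]
    -- Adding the traceless difference at a and t to the pure trace element gives the coefficient 2
    -- at a, 0 at t and 1 elsewhere: two distinct values, with sum `n - r` over the complement of κ.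
    have hv : ∀ j, L (y, z) (Pi.single j 1) =
        ((1 + (Pi.single a 1 : H n) j - (Pi.single t 1 : H n) j) : ℚ) •
          basisWedge (Fin.cons j κ : Fin (r + 1) → Fin n) := fun j => by
      have h1 := LinearMap.congr_fun hy' (Pi.single j 1)
      have h2 : insExt n r (basisWedge κ) (Pi.single j 1) =
          basisWedge (Fin.cons j κ : Fin (r + 1) → Fin n) := by
        apply Subtype.ext
        rw [coe_insExt]
        exact gen_mul_mono j κ
      rw [LinearMap.add_apply, elementary_apply, elementary_apply] at h1
      rw [hL, LinearMap.add_apply, hz, h2, eq_sub_of_add_eq h1]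
      by_cases hja : j = a
      · subst hja
        rw [Pi.single_eq_same, Pi.single_eq_of_ne hat.symm, Pi.single_eq_of_ne hat]
        module
      by_cases hjt : j = t
      · subst hjt
        rw [Pi.single_eq_same, Pi.single_eq_of_ne hat, Pi.single_eq_of_ne hat.symm]
        module
      · rw [Pi.single_eq_of_ne hja, Pi.single_eq_of_ne hjt, Pi.single_eq_of_ne (Ne.symm hja),
          Pi.single_eq_of_ne (Ne.symm hjt)]
        module
    refine eq_top_of_stable_hom _ ?_ hκinj ⟨(y, z), rfl⟩ _ hv hat ha ht ?_ ?_
    · rintro g _ ⟨v, rfl⟩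
      exact ⟨_, hequiv g v⟩
    · rw [Pi.single_eq_same, Pi.single_eq_same, Pi.single_eq_of_ne hat, Pi.single_eq_of_ne hat.symm]
      norm_num
    · have ha' : a ∈ (Finset.univ.image κ)ᶜ := by simpa using fun q hq => ha ⟨q, hq⟩
      have ht' : t ∈ (Finset.univ.image κ)ᶜ := by simpa using fun q hq => ht ⟨q, hq⟩
      rw [Finset.sum_sub_distrib, Finset.sum_add_distrib, Finset.sum_pi_single',
        Finset.sum_pi_single',
        if_pos ha', if_pos ht', add_sub_cancel_right, Finset.sum_const, Finset.card_compl,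
        Finset.card_image_of_injective _ hκinj, Finset.card_univ, Fintype.card_fin,
        Fintype.card_fin, nsmul_eq_mul, mul_one]
      exact_mod_cast (by omega : n - r ≠ 0)
  exact ⟨((L.intertwiningMap_of_isIntertwiningMap _ _ hequiv).ofBijective
    ⟨hinj, LinearMap.range_eq_top.1 hsurj⟩).symm⟩

/-! ### Nonvanishing, the stated range, and the theorem -/

theorem nontrivial_extH {n r : ℕ} (h : r ≤ n) : Nontrivial (⋀[ℚ]^r (H n)) := by
  refine Module.nontrivial_of_finrank_pos (R := ℚ) ?_
  rw [exteriorPower.finrank_eq, Module.finrank_fin_fun]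
  exact Nat.choose_pos h

theorem even_or_add_three_le {n i : ℕ} (h : (i : ℚ) + 2 + (1 - (-1) ^ i) / 2 ≤ n) :
    i + 2 ≤ n ∧ (Even i ∨ i + 3 ≤ n) := by
  rcases Nat.even_or_odd i with he | ho
  · rw [he.neg_one_pow, sub_self, zero_div, add_zero] at h
    exact ⟨by exact_mod_cast h, Or.inl he⟩
  · rw [ho.neg_one_pow] at h
    have h3 : (i : ℚ) + 3 ≤ n := by linarith
    have h3' : i + 3 ≤ n := by exact_mod_cast h3
    exact ⟨by omega, Or.inr h3'⟩

end AlbaneseIO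

end

theorem theorem9p2 (i : ℕ) (hi : 2 ≤ i) :
    (∀ n : ℕ, (i : ℚ) + 2 + (1 - (-1) ^ i) / 2 ≤ n →
      AlbaneseIO.SurjectsOnto n i (AlbaneseIO.extHRep n i) ∧
      Nonempty ((AlbaneseIO.extHRep n i).Equiv
        (AlbaneseIO.VRep n (AlbaneseIO.column i) (AlbaneseIO.column 0))) ∧
      Nontrivial (AlbaneseIO.albanese (AlbaneseIO.IOut n) i)) ∧
    (∃ N : ℕ, ∀ n : ℕ, N ≤ n →
      AlbaneseIO.SurjectsOnto n i (AlbaneseIO.homExtHRep n (i + 1)) ∧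
      Nonempty ((AlbaneseIO.homExtHRep n (i + 1)).Equiv
        ((AlbaneseIO.VRep n (AlbaneseIO.column (i + 1)) (AlbaneseIO.column 1)).prod
          (AlbaneseIO.VRep n (AlbaneseIO.column i) (AlbaneseIO.column 0)))) ∧
      Nontrivial (AlbaneseIO.albanese (AlbaneseIO.IOut n) i)) := by
  -- The value `N = i + 3` means `n - 1 - i ≥ 2`, where the trace is nonzero and the coefficients
  -- differ for both parities of i.
  refine ⟨fun n hn => ?_, i + 3, fun n hn => ?_⟩
  · obtain ⟨h, h'⟩ := AlbaneseIO.even_or_add_three_le hn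
    have hs := AlbaneseIO.surjectsOnto_extHRep hi h h'
    have := AlbaneseIO.nontrivial_extH (n := n) (r := i) (by omega)
    exact ⟨hs, AlbaneseIO.nonempty_equiv_extHRep n i, hs.nontrivial⟩
  · have h : i + 2 ≤ n := by omega
    -- The quotient `⋀^i H` is enough for nonvanishing here as well.
    have hs := AlbaneseIO.surjectsOnto_extHRep hi h (Or.inr hn)
    have := AlbaneseIO.nontrivial_extH (n := n) (r := i) (by omega)
    exact ⟨AlbaneseIO.surjectsOnto_homExtHRep hi hn, AlbaneseIO.nonempty_equiv_homExtHRep h,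
      hs.nontrivial⟩
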